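/- Let $q$ be a real function on $\mathbb R$ with $\int_{\mathbb R}(1+|x|)\,|q(x)|\,dx<\infty$ (i.e. $q\in L^1_1$), and let $q_\pm$ be the restriction of $q$ to $\mathbb R_\pm=(0,\pm\infty)$, extended by $0$ to $\mathbb R$. For such a potential $q$ and $\operatorname{Im}k\ge 0$ let $\psi_\pm(\cdot,k)$ be the Jost solutions of $-\psi''+q\psi=k^2\psi$, i.e. $e^{\mp ikx}\psi_\pm(x,k)\to 1$ and $e^{\mp ikx}\partial_x\psi_\pm(x,k)\to\pm ik$ as $x\to\pm\infty$. For $k\in\mathbb R\setminus\{0\}$ the transmission coefficient $T$ and the right and left reflection coefficients $R$, $L$ are determined by $$T(k)\psi_-(x,k)=\overline{\psi_+(x,k)}+R(k)\psi_+(x,k),\qquad T(k)\psi_+(x,k)=\overline{\psi_-(x,k)}+L(k)\psi_-(x,k),\qquad x\in\mathbb R .$$ Let $-\kappa_n^2$ $(\kappa_n>0)$ be the negative eigenvalues of $-\partial_x^2+q$ on $L^2(\mathbb R)$ and $c_n=\|\psi_+(\cdot,i\kappa_n)\|_{L^2(\mathbb R)}^{-1}$. Write $T_+,R_+,L_+,\kappa_n^+,c_n^+$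 for these quantities for the potential $q_+$, and $R_-$ for the right reflection coefficient of $q_-$. Then, for all $k\in\mathbb R\setminus\{0\}$, $$R(k)=G(k)+R_+(k),\qquad G(k)=\frac{T_+(k)^2R_-(k)}{1-L_+(k)R_-(k)},\qquad 1-L_+(k)R_-(k)\neq 0 .$$ The function $G$ is bounded on $\mathbb R\setminus\{0\}$ and is the continuous boundary value on $\mathbb R\setminus\{0\}$ of a meromorphic function on $\mathbb C^+=\{\operatorname{Im}z>0\}$, again denoted $G$, which is analytic on $\mathbb C^+$ apart from the points $i\kappa_n$ and $i\kappa_n^+$. At each $i\kappa_n$ that is not one of the points $i\kappa_m^+$, and at each $i\kappa_n^+$ that is not one of the points $i\kappa_m$, $G$ has a simple pole, with $$\operatorname*{Res}_{k=i\kappa_n}G(k)=i\,c_n^2,\qquad \operatorname*{Res}_{k=i\kappa_n^+}G(k)=-i\,(c_n^+)^2$$ respectively; at a common point $i\kappa_n=i\kappa_m^+$ it has at most a simple pole, with residue $i\bigl(c_n^2-(c_m^+)^2\bigr)$ (zero if the singularity is removable). Furthermore, there is a real function $Q$, absolutely continuous on each $[0,b]$, $b>0$, with $Q'\in L^1(0,\infty)$,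 such that for all $k\in\mathbb R\setminus\{0\}$ $$R_+(k)=T_+(k)\left\{\frac1{2ik}\int_0^\infty e^{-2ikx}q(x)\,dx+\frac1{(2ik)^2}\int_0^\infty e^{-2ikx}Q'(x)\,dx\right\},$$ and $$|Q'(x)|\le C_1|q(x)|+C_2\int_x^\infty|q(t)|\,dt\qquad\text{for almost every }x\ge 0,$$ where the finite constants $C_1,C_2$ depend only on $\|q_+\|_{L^1}=\int_0^\infty|q|$ and $\|q_+\|_{L^1_1}=\int_0^\infty(1+x)|q(x)|\,dx$. -/

import Mathlib

/-- Membership in the weighted space `L¹₁(ℝ)`: `∫ (1 + |x|) |q x| dx < ∞`. -/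
def ShortRange (q : ℝ → ℝ) : Prop :=
  MeasureTheory.Integrable (fun x : ℝ => (1 + |x|) * q x)

/-- The restriction of `q` to `(0, ∞)`, as a potential on the line. -/
noncomputable def rightPart (q : ℝ → ℝ) : ℝ → ℝ := Set.indicator (Set.Ioi 0) q

/-- The restriction of `q` to `(-∞, 0)`, as a potential on the line. -/
noncomputable def leftPart (q : ℝ → ℝ) : ℝ → ℝ := Set.indicator (Set.Iio 0) q

/-- The norm of `L¹(ℝ)`. -/
noncomputable def normL1 (q : ℝ → ℝ) : ℝ := ∫ x : ℝ, |q x|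

/-- The norm of `L¹₁(ℝ)`. -/
noncomputable def normL11 (q : ℝ → ℝ) : ℝ := ∫ x : ℝ, (1 + |x|) * |q x|

/-- `ψ` solves `-ψ'' + q ψ = E ψ` on the line. For locally integrable `q` the integrated equation
says that `ψ'` is locally absolutely continuous and that the equation holds almost everywhere. -/
structure SolvesSchrodinger (q : ℝ → ℝ) (E : ℂ) (ψ : ℝ → ℂ) : Prop where
  differentiable : Differentiable ℝ ψ
  equation : ∀ a b : ℝ, deriv ψ b - deriv ψ a = ∫ t in a..b, ((q t : ℂ) - E) * ψ t

/-- The Jost solution at `+∞`: `ψ(x) = e^{ikx}(1 + o(1))`, `ψ'(x) = e^{ikx}(ik + o(1))`.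
For `k` real or in the upper half plane there is exactly one (if `q` is short-range). -/
structure IsRightJost (q : ℝ → ℝ) (k : ℂ) (ψ : ℝ → ℂ) : Prop where
  solves : SolvesSchrodinger q (k ^ 2) ψ
  asymp : Filter.Tendsto (fun x : ℝ => Complex.exp (-(Complex.I * k * x)) * ψ x)
    Filter.atTop (nhds 1)
  asymp_deriv : Filter.Tendsto (fun x : ℝ => Complex.exp (-(Complex.I * k * x)) * deriv ψ x)
    Filter.atTop (nhds (Complex.I * k))

/-- The Jost solution at `-∞`: `ψ(x) = e^{-ikx}(1 + o(1))`, `ψ'(x) = e^{-ikx}(-ik + o(1))`. -/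
structure IsLeftJost (q : ℝ → ℝ) (k : ℂ) (ψ : ℝ → ℂ) : Prop where
  solves : SolvesSchrodinger q (k ^ 2) ψ
  asymp : Filter.Tendsto (fun x : ℝ => Complex.exp (Complex.I * k * x) * ψ x)
    Filter.atBot (nhds 1)
  asymp_deriv : Filter.Tendsto (fun x : ℝ => Complex.exp (Complex.I * k * x) * deriv ψ x)
    Filter.atBot (nhds (-(Complex.I * k)))

/-- The right Jost solution `ψ₊(·, k)`, `Im k ≥ 0`. -/
noncomputable def rightJost (q : ℝ → ℝ) (k : ℂ) : ℝ → ℂ := Classical.epsilon (IsRightJost q k)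

/-- The left Jost solution `ψ₋(·, k)`, `Im k ≥ 0`. -/
noncomputable def leftJost (q : ℝ → ℝ) (k : ℂ) : ℝ → ℂ := Classical.epsilon (IsLeftJost q k)

/-- The basic scattering relations at a real momentum `k`; for `k ≠ 0` they determine
`T`, `R`, `L`. -/
structure ScatteringRelations (q : ℝ → ℝ) (k : ℝ) (T R L : ℂ) : Prop where
  right : ∀ x : ℝ, T * leftJost q k x
    = (starRingEnd ℂ) (rightJost q k x) + R * rightJost q k x
  left : ∀ x : ℝ, T * rightJost q k x
    = (starRingEnd ℂ) (leftJost q k x) + L * leftJost q k x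

/-- The transmission coefficient `T(k)`, `k ∈ ℝ \ {0}`. -/
noncomputable def transmission (q : ℝ → ℝ) (k : ℝ) : ℂ :=
  Classical.epsilon fun T => ∃ R L, ScatteringRelations q k T R L

/-- The right reflection coefficient `R(k)`, `k ∈ ℝ \ {0}`. -/
noncomputable def rightReflection (q : ℝ → ℝ) (k : ℝ) : ℂ :=
  Classical.epsilon fun R => ∃ T L, ScatteringRelations q k T R L

/-- The left reflection coefficient `L(k)`, `k ∈ ℝ \ {0}`. -/
noncomputable def leftReflection (q : ℝ → ℝ) (k : ℝ) : ℂ :=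
  Classical.epsilon fun L => ∃ T R, ScatteringRelations q k T R L

/-- `κ > 0` and `-κ²` is an eigenvalue of `-d²/dx² + q` on `L²(ℝ)`. -/
def IsBoundState (q : ℝ → ℝ) (κ : ℝ) : Prop :=
  0 < κ ∧ ∃ u : ℝ → ℂ, u ≠ 0 ∧ SolvesSchrodinger q (-(κ : ℂ) ^ 2) u ∧
    MeasureTheory.MemLp u 2 MeasureTheory.volume

/-- The norming constant `‖ψ₊(·, iκ)‖⁻¹` (norm of `L²(ℝ)`) of a bound state. -/
noncomputable def normingConstant (q : ℝ → ℝ) (κ : ℝ) : ℝ :=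
  (Real.sqrt (∫ x : ℝ, ‖rightJost q (Complex.I * κ) x‖ ^ 2))⁻¹

/-- The residue of `F` at a point `z₀` where `F` is analytic or has a simple pole is `r`. -/
def HasResidueSimple (F : ℂ → ℂ) (z₀ r : ℂ) : Prop :=
  MeromorphicAt F z₀ ∧
    Filter.Tendsto (fun z => (z - z₀) * F z) (nhdsWithin z₀ {z₀}ᶜ) (nhds r)

/-- `F` has a pole of order exactly one at `z₀`, with residue `r`. -/
def HasSimplePole (F : ℂ → ℂ) (z₀ r : ℂ) : Prop :=
  meromorphicOrderAt F z₀ = ((-1 : ℤ) : WithTop ℤ) ∧ HasResidueSimple F z₀ r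

/-!
The proof works with the Cauchy data at the origin of the Jost solutions `ψ₊`, `ψ₋`.

*Splitting.* On `[0, ∞)` the right Jost solution of `q` is that of its right part, and on `(-∞, 0]`
the left Jost solution of `q` is that of its left part, while each part has exponential Jost
solutions where it vanishes. Hence every scattering coefficient of `q`, `q₊`, `q₋` is a quotient of
Wronskians, at the origin, of the three vectors `(ψ₊, ψ₊')`, `(ψ₋, ψ₋')`, `(1, -ik)` and their
conjugates, and the identities for `G` are Plücker relations (`rightReflection_split`,
`splitG_eq`). The quotient `splitG` makes sense for `Im k ≥ 0` as well. Its denominator is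
`W(ψ₊, ψ₋) W(ψ₊, e^{-ikx})`, and the zeros of these two Wronskians in the upper half plane are the
bound states of `q` and of `q₊` (`jostW_eq_zero_iff`). That the zeros are simple, and the values of
the residues, follow from Lagrange's identity `W(ψ(k), ψ(l))' = (k² - l²) ψ(k) ψ(l)` in the limit
`k → l` (`splitG_residue_left`, `splitG_residue_right`, `splitG_residue_common`).

The Jost solutions are `e^{ikx} m(x, k)`, with `m` the sum of a Volterra series (`jostM`) whose terms
are bounded by powers of the tail of `|q|`, divided by factorials. The terms are holomorphic in `k`
for `Im k > 0` and continuous for `Im k ≥ 0`, `k ≠ 0`, and both properties pass to the sum.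

*Second-order expansion.* For a potential `p` on the half-line with a finite first moment, the
Volterra terms are Fourier integrals `∫_0^∞ B_n(x, y) e^{2iky} dy`, with kernels bounded by
`η(x + y) Mⁿ / n!`, where `η(x) = ∫_x^∞ |p|` and `M = ∫ t |p(t)| dt` (`abs_kerB_le`,
`jostM_eq_integral`). The ratio `R₊ / T₊` is `1 / (2ik)` times the conjugate of `∫ e^{2ikt} p m`. The
Volterra equation for `m` gives

`∫ e^{2ikt} p (m - 1) = (1 / (2ik)) ∫ e^{2ikt} p(t) (m(t) ∫_0^t p - ∫_t^∞ p m) dt`,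

and inserting the Fourier representation of `m` and collecting frequencies turns the last integral
into the Fourier transform of a real function, `remainder`, with the required bound
(`integral_fexp_mul_jostM`, `abs_remainder_le`). Then `Q' = -remainder`.
-/

namespace Scattering
open MeasureTheory Set Filter Topology

/-! ### Primitives of locally integrable functions -/

/-- `F` is a primitive of the locally integrable function `f` on the line: `f` is integrable on
every bounded interval and `F b - F a = ∫ x in a..b, f x` for all `a`, `b`. This is how local
absolute continuity with a.e. derivative `f` is encoded, in agreement with
`SolvesSchrodinger.equation`. -/
structure IsPrimitive {𝕜 : Type*} [RCLike 𝕜] (f F : ℝ → 𝕜) : Prop where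
  intervalIntegrable : ∀ a b : ℝ, IntervalIntegrable f volume a b
  sub_eq : ∀ a b : ℝ, F b - F a = ∫ x in a..b, f x

namespace IsPrimitive

variable {𝕜 : Type*} [RCLike 𝕜] {f g F G : ℝ → 𝕜}

lemma absolutelyContinuous (h : IsPrimitive f F) (a b : ℝ) :
    AbsolutelyContinuousOnInterval F a b := by
  have h1 : AbsolutelyContinuousOnInterval (fun x ↦ ∫ v in a..x, ‖f v‖) a b :=
    (h.intervalIntegrable a b).norm.absolutelyContinuousOnInterval_intervalIntegral (by simp)
  unfold AbsolutelyContinuousOnInterval at h1 ⊢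
  refine squeeze_zero (fun E ↦ Finset.sum_nonneg fun i _ ↦ dist_nonneg) (fun E ↦ ?_) h1
  refine Finset.sum_le_sum fun i _ ↦ ?_
  rw [dist_comm, dist_comm (∫ v in a..(E.2 i).1, ‖f v‖), dist_eq_norm, h.sub_eq, Real.dist_eq,
    intervalIntegral.integral_interval_sub_left (h.intervalIntegrable _ _).norm
      (h.intervalIntegrable _ _).norm]
  exact intervalIntegral.norm_integral_le_abs_integral_norm

lemma ae_hasDerivAt (h : IsPrimitive f F) (a b : ℝ) :
    ∀ᵐ x, x ∈ uIcc a b → HasDerivAt F (f x) x := by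
  filter_upwards [(h.intervalIntegrable a b).ae_hasDerivAt_integral] with x hx hxab
  have h1 := (hx hxab a (by simp)).const_add (F a)
  refine h1.congr_of_eventuallyEq (Eventually.of_forall fun y ↦ ?_)
  simp [← h.sub_eq a y]

lemma continuous (h : IsPrimitive f F) : Continuous F := by
  have h1 : Continuous fun x ↦ F 0 + ∫ v in (0 : ℝ)..x, f v :=
    continuous_const.add (intervalIntegral.continuous_primitive h.intervalIntegrable 0)
  convert h1 using 2 with x
  simp [← h.sub_eq 0 x]

lemma of_hasDerivAt (hF : ∀ x, HasDerivAt F (f x) x) (hf : Continuous f) : IsPrimitive f F where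
  intervalIntegrable a b := hf.intervalIntegrable a b
  sub_eq a b := (intervalIntegral.integral_eq_sub_of_hasDerivAt (fun x _ ↦ hF x)
    (hf.intervalIntegrable a b)).symm

lemma hasDerivAt (h : IsPrimitive f F) (hf : Continuous f) (x : ℝ) : HasDerivAt F (f x) x := by
  have h1 := (intervalIntegral.integral_hasDerivAt_right (h.intervalIntegrable 0 x)
    (hf.stronglyMeasurableAtFilter _ _) hf.continuousAt).const_add (F 0)
  refine h1.congr_of_eventuallyEq (Eventually.of_forall fun y ↦ ?_)
  simp [← h.sub_eq 0 y]

lemma congr (h : IsPrimitive f F) (hf : f = g) (hF : F = G) : IsPrimitive g G := by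
  rwa [← hf, ← hF]

lemma add (h : IsPrimitive f F) (h' : IsPrimitive g G) :
    IsPrimitive (fun x ↦ f x + g x) (fun x ↦ F x + G x) where
  intervalIntegrable a b := (h.intervalIntegrable a b).add (h'.intervalIntegrable a b)
  sub_eq a b := by
    rw [intervalIntegral.integral_add (h.intervalIntegrable a b) (h'.intervalIntegrable a b),
      ← h.sub_eq, ← h'.sub_eq]
    ring

lemma const_mul (h : IsPrimitive f F) (c : 𝕜) :
    IsPrimitive (fun x ↦ c * f x) (fun x ↦ c * F x) where
  intervalIntegrable a b := (h.intervalIntegrable a b).const_mul c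
  sub_eq a b := by
    rw [intervalIntegral.integral_const_mul, ← h.sub_eq]
    ring

lemma sub (h : IsPrimitive f F) (h' : IsPrimitive g G) :
    IsPrimitive (fun x ↦ f x - g x) (fun x ↦ F x - G x) :=
  (h.add (h'.const_mul (-1))).congr (by ext; ring) (by ext; ring)

/-- The product rule for absolutely continuous functions. -/
lemma mul (h : IsPrimitive f F) (h' : IsPrimitive g G) :
    IsPrimitive (fun x ↦ f x * G x + F x * g x) (fun x ↦ F x * G x) := by
  have hi : ∀ a b : ℝ, IntervalIntegrable (fun x ↦ f x * G x + F x * g x) volume a b :=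
    fun a b ↦ ((h.intervalIntegrable a b).mul_continuousOn h'.continuous.continuousOn).add
      ((h'.intervalIntegrable a b).continuousOn_mul h.continuous.continuousOn)
  refine ⟨hi, fun a b ↦ ?_⟩
  have hp : IsPrimitive (fun x ↦ f x * G x + F x * g x)
      (fun x ↦ ∫ t in a..x, (f t * G t + F t * g t)) :=
    ⟨hi, fun c d ↦ intervalIntegral.integral_interval_sub_left (hi _ _) (hi _ _)⟩
  obtain ⟨C, hC⟩ := (((h.absolutelyContinuous a b).fun_smul (h'.absolutelyContinuous a b)).fun_sub
    (hp.absolutelyContinuous a b)).const_of_ae_hasDerivAt_zero (by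
      filter_upwards [h.ae_hasDerivAt a b, h'.ae_hasDerivAt a b, hp.ae_hasDerivAt a b]
        with x h1 h2 h3 hx
      convert! ((h1 hx).mul (h2 hx)).sub (h3 hx) using 1
      ring)
  have h1 := hC a (by simp)
  have h2 := hC b (by simp)
  simp only [smul_eq_mul, intervalIntegral.integral_same, sub_zero] at h1 h2
  rw [h1, ← h2]
  ring

lemma pow_succ (h : IsPrimitive f F) (n : ℕ) :
    IsPrimitive (fun x ↦ (n + 1) * (F x ^ n * f x)) (fun x ↦ F x ^ (n + 1)) := by
  induction n with
  | zero => simpa using h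
  | succ n ih =>
    refine (ih.mul h).congr (funext fun x ↦ ?_) (funext fun x ↦ by ring)
    push_cast
    ring

lemma star {f F : ℝ → ℂ} (h : IsPrimitive f F) :
    IsPrimitive (fun x ↦ (starRingEnd ℂ) (f x)) (fun x ↦ (starRingEnd ℂ) (F x)) where
  intervalIntegrable a b := by
    have := h.intervalIntegrable a b
    exact ⟨Complex.conjCLE.toContinuousLinearMap.integrable_comp this.1,
      Complex.conjCLE.toContinuousLinearMap.integrable_comp this.2⟩
  sub_eq a b := by
    rw [← map_sub, h.sub_eq, intervalIntegral, intervalIntegral, map_sub, integral_conj,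
      integral_conj]

lemma of_Ioi (hf : ∀ x, IntegrableOn f (Ioi x)) :
    IsPrimitive (fun x ↦ -f x) (fun x ↦ ∫ t in Ioi x, f t) := by
  have hi : ∀ a b : ℝ, IntervalIntegrable f volume a b := fun a b ↦ by
    rw [intervalIntegrable_iff]
    exact (hf (min a b)).mono_set fun x hx ↦ hx.1
  refine ⟨fun a b ↦ (hi a b).neg, fun a b ↦ ?_⟩
  rw [intervalIntegral.integral_neg,
    intervalIntegral.integral_Ioi_sub_Ioi' (hf b) (hf a) ]
  exact intervalIntegral.integral_symm _ _

end IsPrimitive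

/-! ### Tails of integrable weights -/

/-- The tail `∫_x^∞ w` of a weight. -/
noncomputable def tail (w : ℝ → ℝ) (x : ℝ) : ℝ := ∫ t in Ioi x, w t

section tail
variable {w : ℝ → ℝ}

lemma isPrimitive_tail (hw : Integrable w) : IsPrimitive (fun x ↦ -w x) (tail w) :=
  IsPrimitive.of_Ioi fun _ ↦ hw.integrableOn

lemma continuous_tail (hw : Integrable w) : Continuous (tail w) := (isPrimitive_tail hw).continuous

lemma tail_nonneg (h0 : ∀ x, 0 ≤ w x) (x : ℝ) : 0 ≤ tail w x :=
  integral_nonneg fun t ↦ h0 t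

lemma tail_le_integral (hw : Integrable w) (h0 : ∀ x, 0 ≤ w x) (x : ℝ) :
    tail w x ≤ ∫ t, w t :=
  setIntegral_le_integral hw (Eventually.of_forall h0)

lemma tail_anti (hw : Integrable w) (h0 : ∀ x, 0 ≤ w x) : Antitone (tail w) := fun _ _ hxy ↦
  setIntegral_mono_set hw.integrableOn (Eventually.of_forall h0)
    (Ioi_subset_Ioi hxy).eventuallyLE

lemma tendsto_tail_atTop (hw : Integrable w) : Tendsto (tail w) atTop (𝓝 0) := by
  have h := (intervalIntegral_tendsto_integral_Ioi 0 hw.integrableOn tendsto_id).const_sub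
    (tail w 0)
  simp only [id, tail, sub_self] at h
  refine h.congr fun x ↦ ?_
  have := (isPrimitive_tail hw).sub_eq 0 x
  simp only [tail, intervalIntegral.integral_neg] at this ⊢
  linarith

lemma integrable_mul_tail_pow (hw : Integrable w) (h0 : ∀ x, 0 ≤ w x) (n : ℕ) :
    Integrable fun t ↦ w t * tail w t ^ n := by
  refine hw.mul_bdd (c := (∫ t, w t) ^ n) ((continuous_tail hw).pow n).aestronglyMeasurable
    (Eventually.of_forall fun t ↦ ?_)
  rw [Real.norm_of_nonneg (pow_nonneg (tail_nonneg h0 t) n)]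
  exact pow_le_pow_left₀ (tail_nonneg h0 t) (tail_le_integral hw h0 t) n

/-- The iterated tail integrals that control Volterra iterates. -/
lemma integral_mul_tail_pow (hw : Integrable w) (h0 : ∀ x, 0 ≤ w x) (n : ℕ) (x : ℝ) :
    ∫ t in Ioi x, w t * (tail w t ^ n / n.factorial) = tail w x ^ (n + 1) / (n + 1).factorial := by
  have h1 := intervalIntegral_tendsto_integral_Ioi x
    (integrable_mul_tail_pow hw h0 n).integrableOn tendsto_id
  have h2 : ∀ y, ∫ t in x..y, w t * tail w t ^ n =
      (tail w x ^ (n + 1) - tail w y ^ (n + 1)) / (n + 1) := fun y ↦ by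
    have h := ((isPrimitive_tail hw).pow_succ n).sub_eq x y
    rw [eq_div_iff (by positivity), ← neg_inj, neg_sub, h, ← neg_mul,
      ← intervalIntegral.integral_neg, ← intervalIntegral.integral_mul_const]
    refine intervalIntegral.integral_congr fun t _ ↦ ?_
    ring
  have h3 : Tendsto (fun y ↦ (tail w x ^ (n + 1) - tail w y ^ (n + 1)) / ((n : ℝ) + 1)) atTop
      (𝓝 ((tail w x ^ (n + 1) - 0 ^ (n + 1)) / (n + 1))) :=
    (((tendsto_tail_atTop hw).pow (n + 1)).const_sub _).div_const _
  have h4 := tendsto_nhds_unique h1 (h3.congr fun y ↦ (h2 y).symm)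
  simp_rw [← mul_div_assoc]
  rw [integral_div, h4, Nat.factorial_succ]
  push_cast
  rw [zero_pow n.succ_ne_zero, sub_zero, div_div, mul_comm]

end tail

/-! ### Schrödinger solutions: linearity, Wronskians, uniqueness -/

section solutions
variable {q : ℝ → ℝ} {E E' : ℂ} {u v : ℝ → ℂ}

lemma intervalIntegrable_potential_mul (hq : LocallyIntegrable q) (E : ℂ) (hu : Continuous u)
    (a b : ℝ) : IntervalIntegrable (fun t ↦ ((q t : ℂ) - E) * u t) volume a b := by
  have h1 : IntervalIntegrable (fun t ↦ (q t : ℂ)) volume a b :=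
    ⟨((hq.integrableOn_isCompact isCompact_uIcc).mono_set
      (Ioc_subset_Icc_self.trans Icc_subset_uIcc)).ofReal,
    ((hq.integrableOn_isCompact isCompact_uIcc).mono_set
      (Ioc_subset_Icc_self.trans Icc_subset_uIcc')).ofReal⟩
  exact (h1.sub intervalIntegrable_const).mul_continuousOn hu.continuousOn

/-- A solution is twice a primitive: first of its derivative, which in turn is a primitive of
`(q - E) u`. -/
lemma solves_iff (hq : LocallyIntegrable q) :
    SolvesSchrodinger q E u ↔ ∃ u' : ℝ → ℂ, (∀ x, HasDerivAt u (u' x) x) ∧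
      IsPrimitive (fun t ↦ ((q t : ℂ) - E) * u t) u' := by
  constructor
  · intro h
    exact ⟨deriv u, fun x ↦ (h.differentiable x).hasDerivAt,
      intervalIntegrable_potential_mul hq E h.differentiable.continuous, h.equation⟩
  · rintro ⟨u', h1, h2⟩
    have h3 : deriv u = u' := funext fun x ↦ (h1 x).deriv
    exact ⟨fun x ↦ (h1 x).differentiableAt, fun a b ↦ by rw [h3]; exact h2.sub_eq a b⟩

lemma solves_hasDerivAt (h : SolvesSchrodinger q E u) (x : ℝ) : HasDerivAt u (deriv u x) x :=
  (h.differentiable x).hasDerivAt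

lemma isPrimitive_deriv (hq : LocallyIntegrable q) (h : SolvesSchrodinger q E u) :
    IsPrimitive (fun t ↦ ((q t : ℂ) - E) * u t) (deriv u) :=
  ⟨intervalIntegrable_potential_mul hq E h.differentiable.continuous, h.equation⟩

lemma continuous_deriv_solution (hq : LocallyIntegrable q) (h : SolvesSchrodinger q E u) :
    Continuous (deriv u) := (isPrimitive_deriv hq h).continuous

lemma isPrimitive_solution (hq : LocallyIntegrable q) (h : SolvesSchrodinger q E u) :
    IsPrimitive (deriv u) u :=
  IsPrimitive.of_hasDerivAt (solves_hasDerivAt h) (continuous_deriv_solution hq h)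

lemma solves_add (hq : LocallyIntegrable q) (hu : SolvesSchrodinger q E u)
    (hv : SolvesSchrodinger q E v) : SolvesSchrodinger q E (fun x ↦ u x + v x) :=
  (solves_iff hq).2 ⟨fun x ↦ deriv u x + deriv v x,
    fun x ↦ (solves_hasDerivAt hu x).add (solves_hasDerivAt hv x),
    ((isPrimitive_deriv hq hu).add (isPrimitive_deriv hq hv)).congr (by ext; ring) rfl⟩

lemma solves_const_mul (hq : LocallyIntegrable q) (hu : SolvesSchrodinger q E u) (c : ℂ) :
    SolvesSchrodinger q E (fun x ↦ c * u x) :=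
  (solves_iff hq).2 ⟨fun x ↦ c * deriv u x, fun x ↦ (solves_hasDerivAt hu x).const_mul c,
    ((isPrimitive_deriv hq hu).const_mul c).congr (by ext; ring) rfl⟩

lemma hasDerivAt_conj {u : ℝ → ℂ} {u' : ℂ} {x : ℝ} (h : HasDerivAt u u' x) :
    HasDerivAt (fun x ↦ (starRingEnd ℂ) (u x)) ((starRingEnd ℂ) u') x :=
  Complex.conjCLE.toContinuousLinearMap.hasFDerivAt.comp_hasDerivAt x h

/-- Since the potential is real, conjugation turns solutions for `E` into solutions for `Ē`. -/
lemma solves_conj (hq : LocallyIntegrable q) (hu : SolvesSchrodinger q E u) :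
    SolvesSchrodinger q ((starRingEnd ℂ) E) (fun x ↦ (starRingEnd ℂ) (u x)) :=
  (solves_iff hq).2 ⟨fun x ↦ (starRingEnd ℂ) (deriv u x),
    fun x ↦ hasDerivAt_conj (solves_hasDerivAt hu x),
    (isPrimitive_deriv hq hu).star.congr (by ext; simp) rfl⟩

/-- The Wronskian `u v' - u' v`. -/
noncomputable def wronskian (u v : ℝ → ℂ) (x : ℝ) : ℂ := u x * deriv v x - deriv u x * v x

/-- Lagrange's identity. -/
lemma isPrimitive_wronskian (hq : LocallyIntegrable q) (hu : SolvesSchrodinger q E u)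
    (hv : SolvesSchrodinger q E' v) :
    IsPrimitive (fun x ↦ (E - E') * (u x * v x)) (wronskian u v) :=
  (((isPrimitive_solution hq hu).mul (isPrimitive_deriv hq hv)).sub
    ((isPrimitive_deriv hq hu).mul (isPrimitive_solution hq hv))).congr (by ext; ring) rfl

lemma wronskian_eq (hq : LocallyIntegrable q) (hu : SolvesSchrodinger q E u)
    (hv : SolvesSchrodinger q E v) (x y : ℝ) : wronskian u v x = wronskian u v y := by
  have := (isPrimitive_wronskian hq hu hv).sub_eq y x
  simpa [sub_eq_zero] using this

/-- A solution with vanishing Cauchy data at `a` vanishes on `[a, ∞)`: its energy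
`‖u‖ + ‖u'‖` satisfies a homogeneous Volterra inequality on each `[a, b]`. -/
lemma solution_eq_zero_right (hq : LocallyIntegrable q) (hu : SolvesSchrodinger q E u) {a : ℝ}
    (h0 : u a = 0) (h1 : deriv u a = 0) {b : ℝ} (hab : a ≤ b) : u b = 0 := by
  -- the weight is reversed, `t ↦ -t`, so that iterated tails apply
  set ω : ℝ → ℝ := fun t ↦ ‖(q t : ℂ) - E‖ + 1 with hω
  set w : ℝ → ℝ := indicator (Ioc (-b) (-a)) fun s ↦ ω (-s) with hw
  have hωi : ∀ c d : ℝ, IntervalIntegrable ω volume c d := fun c d ↦ by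
    have := (intervalIntegrable_potential_mul (u := fun _ ↦ 1) hq E continuous_const c d).norm
    simp only [mul_one] at this
    exact this.add intervalIntegrable_const
  have hω0 : ∀ t, 0 ≤ ω t := fun t ↦ by positivity
  have hw0 : ∀ t, 0 ≤ w t := fun t ↦ indicator_nonneg (fun s _ ↦ hω0 _) t
  have hwi : Integrable w := by
    rw [hw, integrable_indicator_iff measurableSet_Ioc,
      ← intervalIntegrable_iff_integrableOn_Ioc_of_le (by linarith)]
    have := (IntervalIntegrable.iff_comp_neg (by finiteness)).1 (hωi a b)
    exact this.symm
  set e : ℝ → ℝ := fun t ↦ ‖u t‖ + ‖deriv u t‖ with he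
  have hec : Continuous e := hu.differentiable.continuous.norm.add
    (continuous_deriv_solution hq hu).norm
  obtain ⟨M, hM⟩ := (isCompact_Icc (a := a) (b := b)).exists_bound_of_continuousOn hec.continuousOn
  have he0 : ∀ t, 0 ≤ e t := fun t ↦ by positivity
  have hM0 : 0 ≤ M := (norm_nonneg _).trans (hM a ⟨le_rfl, hab⟩)
  have hstep : ∀ x ∈ Icc a b, e x ≤ ∫ t in a..x, ω t * e t := fun x hx ↦ by
    have hu1 : ‖u x‖ ≤ ∫ t in a..x, ‖deriv u t‖ := by
      have := (isPrimitive_solution hq hu).sub_eq a x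
      rw [h0, sub_zero] at this
      rw [this]
      exact intervalIntegral.norm_integral_le_integral_norm hx.1
    have hu2 : ‖deriv u x‖ ≤ ∫ t in a..x, ‖((q t : ℂ) - E) * u t‖ := by
      have := (isPrimitive_deriv hq hu).sub_eq a x
      rw [h1, sub_zero] at this
      rw [this]
      exact intervalIntegral.norm_integral_le_integral_norm hx.1
    have hi1 := ((isPrimitive_solution hq hu).intervalIntegrable a x).norm
    have hi2 := ((isPrimitive_deriv hq hu).intervalIntegrable a x).norm
    calc e x ≤ ∫ t in a..x, (‖deriv u t‖ + ‖((q t : ℂ) - E) * u t‖) := by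
          rw [intervalIntegral.integral_add hi1 hi2]; exact add_le_add hu1 hu2
      _ ≤ ∫ t in a..x, ω t * e t := by
          refine intervalIntegral.integral_mono_on hx.1 (hi1.add hi2)
            ((hωi a x).mul_continuousOn hec.continuousOn) fun t _ ↦ ?_
          simp only [hω, he, norm_mul]
          nlinarith [norm_nonneg ((q t : ℂ) - E), norm_nonneg (u t), norm_nonneg (deriv u t)]
  have hbound : ∀ n : ℕ, ∀ x ∈ Icc a b, e x ≤ M * (tail w (-x) ^ n / n.factorial) := by
    intro n
    induction n with
    | zero =>
      intro x hx
      simpa using (le_abs_self _).trans (hM x hx)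
    | succ n ih =>
      intro x hx
      have hc : Continuous fun t ↦ M * (tail w (-t) ^ n / n.factorial) :=
        ((((continuous_tail hwi).comp continuous_neg).pow n).div_const _).const_mul _
      calc e x ≤ ∫ t in a..x, ω t * e t := hstep x hx
        _ ≤ ∫ t in a..x, ω t * (M * (tail w (-t) ^ n / n.factorial)) := by
          refine intervalIntegral.integral_mono_on hx.1
            ((hωi a x).mul_continuousOn hec.continuousOn)
            ((hωi a x).mul_continuousOn hc.continuousOn) fun t ht ↦ ?_
          exact mul_le_mul_of_nonneg_left (ih t ⟨ht.1, ht.2.trans hx.2⟩) (hω0 t)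
        _ = ∫ s in (-x)..(-a), ω (-s) * (M * (tail w s ^ n / n.factorial)) := by
          rw [← intervalIntegral.integral_comp_neg]
          simp
        _ ≤ M * ∫ s in Ioi (-x), w s * (tail w s ^ n / n.factorial) := by
          rw [intervalIntegral.integral_of_le (by linarith [hx.1]), ← integral_const_mul]
          have hint : IntegrableOn (fun s ↦ M * (w s * (tail w s ^ n / n.factorial)))
              (Ioi (-x)) := by
            have := ((integrable_mul_tail_pow hwi hw0 n).div_const n.factorial).const_mul M
            simp only [mul_div_assoc] at this
            exact this.integrableOn
          calc _ = ∫ s in Ioc (-x) (-a), M * (w s * (tail w s ^ n / n.factorial)) := by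
                refine setIntegral_congr_fun measurableSet_Ioc fun s hs ↦ ?_
                have : w s = ω (-s) := 
                  indicator_of_mem (show s ∈ Ioc (-b) (-a) from
                    ⟨by linarith [hs.1, hx.2], hs.2⟩) _
                simp only [this]
                ring
            _ ≤ _ := setIntegral_mono_set hint
                (Eventually.of_forall fun s ↦ by have := hw0 s; have := tail_nonneg hw0 s; positivity)
                (Ioc_subset_Ioi_self).eventuallyLE
        _ = M * (tail w (-x) ^ (n + 1) / (n + 1).factorial) := by
          rw [integral_mul_tail_pow hwi hw0]
  have hlim : Tendsto (fun n : ℕ ↦ M * (tail w (-b) ^ n / n.factorial)) atTop (𝓝 (M * 0)) :=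
    (FloorSemiring.tendsto_pow_div_factorial_atTop _).const_mul _
  have hle : e b ≤ M * 0 := ge_of_tendsto' hlim fun n ↦ hbound n b ⟨hab, le_rfl⟩
  have : ‖u b‖ ≤ 0 := by
    simp only [he] at hle
    linarith [norm_nonneg (deriv u b)]
  simpa using this

/-- The reflected potential `x ↦ q (-x)`. -/
def reflect (q : ℝ → ℝ) : ℝ → ℝ := fun x ↦ q (-x)

@[simp] lemma reflect_reflect (q : ℝ → ℝ) : reflect (reflect q) = q := by
  ext; simp [reflect]

lemma solves_reflect (hu : SolvesSchrodinger q E u) :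
    SolvesSchrodinger (reflect q) E (fun x ↦ u (-x)) where
  differentiable := hu.differentiable.comp differentiable_neg
  equation a b := by
    have h : ∀ x, deriv (fun x ↦ u (-x)) x = -deriv u (-x) := fun x ↦ deriv_comp_neg u x
    rw [h, h]
    have h2 := hu.equation (-b) (-a)
    have h3 := intervalIntegral.integral_comp_neg (a := a) (b := b)
      (fun t ↦ ((q t : ℂ) - E) * u t)
    simp only [reflect]
    rw [h3, ← h2]
    ring

lemma locallyIntegrable_reflect (hq : LocallyIntegrable q) : LocallyIntegrable (reflect q) := by
  intro x
  obtain ⟨s, hs, hi⟩ := hq (-x)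
  refine ⟨-s, ?_, ?_⟩
  · exact (continuous_neg (G := ℝ)).continuousAt.preimage_mem_nhds hs
  · exact (Measure.measurePreserving_neg (volume : Measure ℝ)).integrableOn_comp_preimage
      (Homeomorph.neg ℝ).measurableEmbedding |>.2 hi

/-- Uniqueness for the initial value problem. -/
lemma solution_eq_zero (hq : LocallyIntegrable q) (hu : SolvesSchrodinger q E u) {a : ℝ}
    (h0 : u a = 0) (h1 : deriv u a = 0) (b : ℝ) : u b = 0 := by
  rcases le_total a b with hab | hab
  · exact solution_eq_zero_right hq hu h0 h1 hab
  · have := solution_eq_zero_right (locallyIntegrable_reflect hq) (solves_reflect hu)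
      (a := -a) (b := -b) (by simpa using h0)
      (by rw [deriv_comp_neg]; simp [h1]) (by linarith)
    simpa using this

/-- Two solutions with proportional Cauchy data are proportional. -/
lemma solution_eq_mul (hq : LocallyIntegrable q) (hu : SolvesSchrodinger q E u)
    (hv : SolvesSchrodinger q E v) {a : ℝ} {c : ℂ} (h0 : u a = c * v a)
    (h1 : deriv u a = c * deriv v a) : u = fun x ↦ c * v x := by
  have hs := solves_add hq hu (solves_const_mul hq hv (-c))
  have hd : deriv (fun x ↦ u x + -c * v x) a = 0 := by
    have := (solves_hasDerivAt hu a).fun_add ((solves_hasDerivAt hv a).const_mul (-c))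
    rw [this.deriv, h1]
    ring
  funext x
  have := solution_eq_zero hq hs (a := a) (by simp [h0]) hd x
  linear_combination this

/-- Solutions with vanishing Wronskian are proportional to any nonzero one of them. -/
lemma exists_eq_mul_of_wronskian_eq_zero (hq : LocallyIntegrable q)
    (hu : SolvesSchrodinger q E u) (hv : SolvesSchrodinger q E v) {a : ℝ}
    (hw : wronskian u v a = 0) (hv0 : v ≠ 0) : ∃ c : ℂ, u = fun x ↦ c * v x := by
  unfold wronskian at hw
  by_cases h0 : v a = 0
  · have h1 : deriv v a ≠ 0 := fun h1 ↦ hv0 (funext fun x ↦ solution_eq_zero hq hv h0 h1 x)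
    have hu0 : u a = 0 := by
      rw [h0, mul_zero, sub_zero] at hw
      exact (mul_eq_zero.1 hw).resolve_right h1
    exact ⟨deriv u a / deriv v a, solution_eq_mul hq hu hv (a := a) (by simp [h0, hu0])
      (by field_simp)⟩
  · refine ⟨u a / v a, solution_eq_mul hq hu hv (a := a) (by field_simp) ?_⟩
    field_simp
    linear_combination -hw

end solutions

/-! ### Construction of the Jost solutions -/

/-- The kernel `(e^{2iks} - 1) / (2ik)`, `s ≥ 0`, of the Volterra equation for
`e^{-ikx} ψ₊(x, k)`. It is extended by zero to `s ≤ 0`, which makes it continuous on the line. -/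
noncomputable def volterraKernel (k : ℂ) (s : ℝ) : ℂ :=
  (Complex.exp (2 * Complex.I * k * (max s 0 : ℝ)) - 1) / (2 * Complex.I * k)

/-- The Volterra iterates of the constant function `1`. -/
noncomputable def jostIter (q : ℝ → ℝ) (k : ℂ) : ℕ → ℝ → ℂ
  | 0 => fun _ ↦ 1
  | n + 1 => fun x ↦ ∫ t, volterraKernel k (t - x) * ((q t : ℂ) * jostIter q k n t)

/-- The modified Jost solution `m(x, k) = e^{-ikx} ψ₊(x, k)`, as the sum of the Volterra series. -/
noncomputable def jostM (q : ℝ → ℝ) (k : ℂ) (x : ℝ) : ℂ := ∑' n, jostIter q k n x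

/-- The derivative `∂ₓ m(x, k)` of the modified Jost solution. -/
noncomputable def jostD (q : ℝ → ℝ) (k : ℂ) (x : ℝ) : ℂ :=
  -∫ t in Ioi x, Complex.exp (2 * Complex.I * k * (t - x)) * ((q t : ℂ) * jostM q k t)

/-- The Jost solution in terms of the Volterra series. -/
noncomputable def jostSol (q : ℝ → ℝ) (k : ℂ) (x : ℝ) : ℂ :=
  Complex.exp (Complex.I * k * x) * jostM q k x

/-- The derivative of `jostSol`. -/
noncomputable def jostSolDeriv (q : ℝ → ℝ) (k : ℂ) (x : ℝ) : ℂ :=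
  Complex.exp (Complex.I * k * x) * (Complex.I * k * jostM q k x + jostD q k x)

section jost
variable {q : ℝ → ℝ} {k : ℂ}

lemma norm_exp_two_I_mul (k : ℂ) (s : ℝ) :
    ‖Complex.exp (2 * Complex.I * k * s)‖ = Real.exp (-(2 * k.im * s)) := by
  rw [Complex.norm_exp]
  congr 1
  simp

lemma norm_exp_two_I_mul_le (hk : 0 ≤ k.im) {s : ℝ} (hs : 0 ≤ s) :
    ‖Complex.exp (2 * Complex.I * k * s)‖ ≤ 1 := by
  rw [norm_exp_two_I_mul, Real.exp_le_one_iff]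
  have := mul_nonneg hk hs
  linarith

lemma volterraKernel_of_nonpos (k : ℂ) {s : ℝ} (hs : s ≤ 0) : volterraKernel k s = 0 := by
  simp [volterraKernel, max_eq_right hs]

lemma volterraKernel_of_nonneg (k : ℂ) {s : ℝ} (hs : 0 ≤ s) : volterraKernel k s =
    (Complex.exp (2 * Complex.I * k * s) - 1) / (2 * Complex.I * k) := by
  simp [volterraKernel, max_eq_left hs]

lemma continuous_volterraKernel (k : ℂ) : Continuous (volterraKernel k) := by
  unfold volterraKernel
  fun_prop

lemma norm_volterraKernel_le (hk : 0 ≤ k.im) (s : ℝ) : ‖volterraKernel k s‖ ≤ ‖k‖⁻¹ := by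
  have h1 := norm_exp_two_I_mul_le hk (le_max_right s 0)
  have h2 : ‖Complex.exp (2 * Complex.I * k * (max s 0 : ℝ)) - 1‖ ≤ 2 :=
    (norm_sub_le _ _).trans (by rw [norm_one]; linarith)
  rw [volterraKernel, norm_div, norm_mul, norm_mul, Complex.norm_I, Complex.norm_two, mul_one]
  rcases eq_or_ne k 0 with rfl | hk0
  · simp
  · have : 0 < ‖k‖ := norm_pos_iff.2 hk0
    rw [div_le_iff₀ (by positivity)]
    calc _ ≤ (2 : ℝ) := h2
      _ = _ := by field_simp

/-- The weight that controls the Volterra iteration. -/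
noncomputable def jostWeight (q : ℝ → ℝ) (k : ℂ) (t : ℝ) : ℝ := ‖k‖⁻¹ * |q t|

lemma jostWeight_nonneg (q : ℝ → ℝ) (k : ℂ) (t : ℝ) : 0 ≤ jostWeight q k t := by
  unfold jostWeight; positivity

lemma integrable_jostWeight (hq : Integrable q) (k : ℂ) : Integrable (jostWeight q k) :=
  hq.abs.const_mul _

lemma jostIter_continuous_and_le (hq : Integrable q) (hk : 0 ≤ k.im) (n : ℕ) :
    Continuous (jostIter q k n) ∧
      ∀ x, ‖jostIter q k n x‖ ≤ tail (jostWeight q k) x ^ n / n.factorial := by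
  have hw := integrable_jostWeight hq k
  have hw0 := jostWeight_nonneg q k
  induction n with
  | zero => exact ⟨continuous_const, fun x ↦ by simp [jostIter]⟩
  | succ n ih =>
    obtain ⟨hc, hb⟩ := ih
    have hnorm : ∀ x t, ‖volterraKernel k (t - x) * ((q t : ℂ) * jostIter q k n t)‖ ≤
        jostWeight q k t * (tail (jostWeight q k) t ^ n / n.factorial) := fun x t ↦ by
      rw [norm_mul, norm_mul, Complex.norm_real, Real.norm_eq_abs, ← mul_assoc]
      exact mul_le_mul (mul_le_mul_of_nonneg_right (norm_volterraKernel_le hk _) (abs_nonneg _))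
        (hb t) (norm_nonneg _) (jostWeight_nonneg q k t)
    have hbi : Integrable fun t ↦ jostWeight q k t *
        (tail (jostWeight q k) t ^ n / n.factorial) := by
      have := (integrable_mul_tail_pow hw hw0 n).div_const n.factorial
      simpa only [mul_div_assoc] using this
    have hmeas : ∀ x, AEStronglyMeasurable
        (fun t ↦ volterraKernel k (t - x) * ((q t : ℂ) * jostIter q k n t)) volume := fun x ↦
      ((continuous_volterraKernel k).comp (continuous_id.sub continuous_const)).aestronglyMeasurable.mul
        (hq.ofReal.aestronglyMeasurable.mul hc.aestronglyMeasurable)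
    refine ⟨?_, fun x ↦ ?_⟩
    · refine continuous_of_dominated (hmeas) (fun x ↦ Eventually.of_forall (hnorm x)) hbi
        (Eventually.of_forall fun t ↦ ?_)
      exact ((continuous_volterraKernel k).comp (continuous_const.sub continuous_id)).mul
        continuous_const
    · rw [← integral_mul_tail_pow hw hw0]
      have h0 : ∀ t ∉ Ioi x, volterraKernel k (t - x) * ((q t : ℂ) * jostIter q k n t) = 0 :=
        fun t ht ↦ by
          rw [volterraKernel_of_nonpos k (by simpa using ht), zero_mul]
      simp only [jostIter]
      rw [← setIntegral_eq_integral_of_forall_compl_eq_zero h0]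
      exact norm_integral_le_of_norm_le hbi.integrableOn (Eventually.of_forall (hnorm x))

lemma continuous_jostIter (hq : Integrable q) (hk : 0 ≤ k.im) (n : ℕ) :
    Continuous (jostIter q k n) := (jostIter_continuous_and_le hq hk n).1

/-- A bound for the Volterra iterates that is uniform in `x` and locally uniform in `k ≠ 0`. -/
lemma norm_jostIter_le (hq : Integrable q) (hk : 0 ≤ k.im) (n : ℕ) (x : ℝ) :
    ‖jostIter q k n x‖ ≤ (‖k‖⁻¹ * ∫ t, |q t|) ^ n / n.factorial := by
  refine ((jostIter_continuous_and_le hq hk n).2 x).trans ?_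
  gcongr
  · exact tail_nonneg (jostWeight_nonneg q k) x
  · refine (tail_le_integral (integrable_jostWeight hq k) (jostWeight_nonneg q k) x).trans ?_
    simp only [jostWeight]
    rw [integral_const_mul]

/-- The resulting bound for the modified Jost solution. -/
noncomputable def jostBound (q : ℝ → ℝ) (k : ℂ) : ℝ := Real.exp (‖k‖⁻¹ * ∫ t, |q t|)

lemma hasSum_jostBound (q : ℝ → ℝ) (k : ℂ) :
    HasSum (fun n : ℕ ↦ (‖k‖⁻¹ * ∫ t, |q t|) ^ n / n.factorial) (jostBound q k) := by
  rw [jostBound, Real.exp_eq_exp_ℝ]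
  exact NormedSpace.expSeries_div_hasSum_exp _

lemma hasSum_jostM (hq : Integrable q) (hk : 0 ≤ k.im) (x : ℝ) :
    HasSum (fun n ↦ jostIter q k n x) (jostM q k x) :=
  (Summable.of_norm_bounded (hasSum_jostBound q k).summable
    fun n ↦ norm_jostIter_le hq hk n x).hasSum

lemma norm_jostM_le (hq : Integrable q) (hk : 0 ≤ k.im) (x : ℝ) :
    ‖jostM q k x‖ ≤ jostBound q k :=
  tsum_of_norm_bounded (hasSum_jostBound q k) fun n ↦ norm_jostIter_le hq hk n x

lemma continuous_jostM (hq : Integrable q) (hk : 0 ≤ k.im) : Continuous (jostM q k) :=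
  continuous_tsum (continuous_jostIter hq hk) (hasSum_jostBound q k).summable
    fun n x ↦ norm_jostIter_le hq hk n x

lemma integrable_mul_jostM (hq : Integrable q) (hk : 0 ≤ k.im) :
    Integrable fun t ↦ (q t : ℂ) * jostM q k t :=
  hq.ofReal.mul_bdd (c := jostBound q k) (continuous_jostM hq hk).aestronglyMeasurable
    (Eventually.of_forall fun t ↦ norm_jostM_le hq hk t)

/-- The Volterra integral equation for the modified Jost solution. -/
lemma jostM_eq (hq : Integrable q) (hk : 0 ≤ k.im) (x : ℝ) :
    jostM q k x = 1 + ∫ t, volterraKernel k (t - x) * ((q t : ℂ) * jostM q k t) := by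
  have hsum : HasSum (fun n ↦ jostIter q k (n + 1) x)
      (∫ t, volterraKernel k (t - x) * ((q t : ℂ) * jostM q k t)) := by
    refine hasSum_integral_of_dominated_convergence
      (fun n t ↦ (‖k‖⁻¹ * |q t|) * ((‖k‖⁻¹ * ∫ t, |q t|) ^ n / n.factorial)) (fun n ↦ ?_)
      (fun n ↦ Eventually.of_forall fun t ↦ ?_) (Eventually.of_forall fun t ↦ ?_) ?_
      (Eventually.of_forall fun t ↦ ?_)
    · exact ((continuous_volterraKernel k).comp
        (continuous_id.sub continuous_const)).aestronglyMeasurable.mul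
        (hq.ofReal.aestronglyMeasurable.mul (continuous_jostIter hq hk n).aestronglyMeasurable)
    · rw [norm_mul, norm_mul, Complex.norm_real, Real.norm_eq_abs, ← mul_assoc]
      gcongr
      · exact norm_volterraKernel_le hk _
      · exact norm_jostIter_le hq hk n t
    · exact (hasSum_jostBound q k).summable.mul_left _
    · simp_rw [tsum_mul_left]
      exact (hq.abs.const_mul _).mul_const _
    · exact ((hasSum_jostM hq hk t).mul_left _).mul_left _
  have := (hasSum_jostM hq hk x).tsum_eq
  rw [(hasSum_jostM hq hk x).summable.tsum_eq_zero_add, hsum.tsum_eq] at this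
  rw [← this]
  rfl

lemma norm_exp_mul_potential_mul_jostM_le (hq : Integrable q) (hk : 0 ≤ k.im) {x t : ℝ}
    (ht : x ≤ t) :
    ‖Complex.exp (2 * Complex.I * k * (t - x)) * ((q t : ℂ) * jostM q k t)‖ ≤
      |q t| * jostBound q k := by
  rw [norm_mul, norm_mul, Complex.norm_real, Real.norm_eq_abs, ← Complex.ofReal_sub]
  have h1 := norm_exp_two_I_mul_le hk (sub_nonneg.2 ht)
  have h2 := norm_jostM_le hq hk t
  calc _ ≤ 1 * (|q t| * jostBound q k) := by gcongr
    _ = _ := one_mul _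

lemma integrableOn_exp_mul_potential_mul_jostM (hq : Integrable q) (hk : 0 ≤ k.im) (x : ℝ) :
    IntegrableOn (fun t : ℝ ↦ Complex.exp (2 * Complex.I * k * (t - x)) *
      ((q t : ℂ) * jostM q k t)) (Ioi x) := by
  refine Integrable.mono' (hq.abs.mul_const (jostBound q k)).integrableOn ?_ ?_
  · exact (Continuous.aestronglyMeasurable (by fun_prop)).mul
      (integrable_mul_jostM hq hk).aestronglyMeasurable.restrict
  · filter_upwards [ae_restrict_mem measurableSet_Ioi] with t ht
    exact norm_exp_mul_potential_mul_jostM_le hq hk (le_of_lt ht)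

lemma norm_jostD_le (hq : Integrable q) (hk : 0 ≤ k.im) (x : ℝ) :
    ‖jostD q k x‖ ≤ jostBound q k * tail (fun t ↦ |q t|) x := by
  rw [jostD, norm_neg, tail, mul_comm (jostBound q k), ← integral_mul_const]
  refine norm_integral_le_of_norm_le (hq.abs.mul_const (jostBound q k)).integrableOn ?_
  filter_upwards [ae_restrict_mem measurableSet_Ioi] with t ht
  exact norm_exp_mul_potential_mul_jostM_le hq hk (le_of_lt ht)

lemma norm_jostM_sub_one_le (hq : Integrable q) (hk : 0 ≤ k.im) (x : ℝ) :
    ‖jostM q k x - 1‖ ≤ ‖k‖⁻¹ * jostBound q k * tail (fun t ↦ |q t|) x := by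
  rw [jostM_eq hq hk, add_sub_cancel_left, tail, ← integral_const_mul]
  have h0 : ∀ t ∉ Ioi x, volterraKernel k (t - x) * ((q t : ℂ) * jostM q k t) = 0 :=
    fun t ht ↦ by rw [volterraKernel_of_nonpos k (by simpa using ht), zero_mul]
  rw [← setIntegral_eq_integral_of_forall_compl_eq_zero h0]
  refine norm_integral_le_of_norm_le (hq.abs.const_mul _).integrableOn
    (Eventually.of_forall fun t ↦ ?_)
  rw [norm_mul, norm_mul, Complex.norm_real, Real.norm_eq_abs]
  have h1 := norm_volterraKernel_le hk (t - x)
  have h2 := norm_jostM_le hq hk t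
  calc _ ≤ ‖k‖⁻¹ * (|q t| * jostBound q k) := by gcongr
    _ = _ := by ring

lemma tendsto_jostM (hq : Integrable q) (hk : 0 ≤ k.im) :
    Tendsto (jostM q k) atTop (𝓝 1) := by
  rw [tendsto_iff_norm_sub_tendsto_zero]
  refine squeeze_zero (fun _ ↦ norm_nonneg _) (norm_jostM_sub_one_le hq hk) ?_
  simpa using (tendsto_tail_atTop hq.abs).const_mul (‖k‖⁻¹ * jostBound q k)

lemma tendsto_jostD (hq : Integrable q) (hk : 0 ≤ k.im) :
    Tendsto (jostD q k) atTop (𝓝 0) := by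
  rw [tendsto_zero_iff_norm_tendsto_zero]
  refine squeeze_zero (fun _ ↦ norm_nonneg _) (norm_jostD_le hq hk) ?_
  simpa using (tendsto_tail_atTop hq.abs).const_mul (jostBound q k)

lemma exp_isPrimitive (c : ℂ) :
    IsPrimitive (fun x : ℝ ↦ c * Complex.exp (c * x)) (fun x : ℝ ↦ Complex.exp (c * x)) := by
  refine IsPrimitive.of_hasDerivAt (fun x ↦ ?_) (by fun_prop)
  have := ((Complex.ofRealCLM.hasDerivAt (x := x)).const_mul c).cexp
  simpa [mul_comm] using this

/-- `∂ₓ m` is locally absolutely continuous and `∂ₓ² m + 2ik ∂ₓ m = q m`. -/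
lemma isPrimitive_jostD (hq : Integrable q) (hk : 0 ≤ k.im) :
    IsPrimitive (fun x ↦ q x * jostM q k x - 2 * Complex.I * k * jostD q k x) (jostD q k) := by
  have hsplit : ∀ x t : ℝ, Complex.exp (2 * Complex.I * k * (t - x)) =
      Complex.exp (-(2 * Complex.I * k) * x) * Complex.exp (2 * Complex.I * k * t) := fun x t ↦ by
    rw [← Complex.exp_add]; ring_nf
  have hi : ∀ x, IntegrableOn (fun t : ℝ ↦ Complex.exp (2 * Complex.I * k * t) *
      ((q t : ℂ) * jostM q k t)) (Ioi x) := fun x ↦ by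
    have h := (integrableOn_exp_mul_potential_mul_jostM hq hk x).const_mul
      (Complex.exp (2 * Complex.I * k * x))
    refine h.congr (Eventually.of_forall fun t ↦ ?_)
    simp only
    rw [← mul_assoc, ← Complex.exp_add]
    ring_nf
  have hD : jostD q k = fun x : ℝ ↦ -1 * (Complex.exp (-(2 * Complex.I * k) * x) *
      ∫ t in Ioi x, Complex.exp (2 * Complex.I * k * t) * ((q t : ℂ) * jostM q k t)) := by
    funext x
    rw [jostD, ← integral_const_mul, neg_one_mul]
    simp_rw [hsplit x, mul_assoc]
  refine (((exp_isPrimitive (-(2 * Complex.I * k))).mul (IsPrimitive.of_Ioi hi)).const_mul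
    (-1)).congr (funext fun x ↦ ?_) hD.symm
  have : Complex.exp (-(2 * Complex.I * k) * x) * Complex.exp (2 * Complex.I * k * x) = 1 := by
    rw [← Complex.exp_add]; simp
  rw [hD]
  linear_combination ((q x : ℂ) * jostM q k x) * this

lemma isPrimitive_jostM (hq : Integrable q) (hk : 0 ≤ k.im) (hk0 : k ≠ 0) :
    IsPrimitive (jostD q k) (jostM q k) := by
  have hi := integrable_mul_jostM hq hk
  have hk2 : 2 * Complex.I * k ≠ 0 := by simp [hk0]
  -- `2ik (m - 1) = -∂ₓ m - ∫_x^∞ q m`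
  have hM : ∀ x, jostM q k x = 1 + (2 * Complex.I * k)⁻¹ *
      (-1 * jostD q k x - ∫ t in Ioi x, (q t : ℂ) * jostM q k t) := fun x ↦ by
    conv_lhs => rw [jostM_eq hq hk]
    have h0 : ∀ t ∉ Ioi x, volterraKernel k (t - x) * ((q t : ℂ) * jostM q k t) = 0 :=
      fun t ht ↦ by rw [volterraKernel_of_nonpos k (by simpa using ht), zero_mul]
    rw [← setIntegral_eq_integral_of_forall_compl_eq_zero h0, jostD, neg_one_mul, neg_neg,
      ← integral_sub (integrableOn_exp_mul_potential_mul_jostM hq hk x) hi.integrableOn,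
      ← integral_const_mul]
    congr 1
    refine setIntegral_congr_fun measurableSet_Ioi fun t ht ↦ ?_
    rw [volterraKernel_of_nonneg k (sub_nonneg.2 (le_of_lt ht)), Complex.ofReal_sub]
    field_simp
  have h1 : IsPrimitive (fun _ ↦ (0 : ℂ)) (fun _ : ℝ ↦ (1 : ℂ)) := ⟨by simp, by simp⟩
  refine (h1.add ((((isPrimitive_jostD hq hk).const_mul (-1)).sub
    (IsPrimitive.of_Ioi fun x ↦ hi.integrableOn)).const_mul (2 * Complex.I * k)⁻¹)).congr
    (funext fun x ↦ ?_) (funext fun x ↦ (hM x).symm)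
  field_simp
  ring

lemma hasDerivAt_jostSol (hq : Integrable q) (hk : 0 ≤ k.im) (hk0 : k ≠ 0) (x : ℝ) :
    HasDerivAt (jostSol q k) (jostSolDeriv q k x) x := by
  have h1 : HasDerivAt (jostM q k) (jostD q k x) x :=
    (isPrimitive_jostM hq hk hk0).hasDerivAt (isPrimitive_jostD hq hk).continuous x
  have h2 : HasDerivAt (fun x : ℝ ↦ Complex.exp (Complex.I * k * x))
      (Complex.I * k * Complex.exp (Complex.I * k * x)) x :=
    (exp_isPrimitive (Complex.I * k)).hasDerivAt (by fun_prop) x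
  convert! h2.mul h1 using 1
  rw [jostSolDeriv]
  ring

lemma deriv_jostSol (hq : Integrable q) (hk : 0 ≤ k.im) (hk0 : k ≠ 0) :
    deriv (jostSol q k) = jostSolDeriv q k :=
  funext fun x ↦ (hasDerivAt_jostSol hq hk hk0 x).deriv

lemma solves_jostSol (hq : Integrable q) (hk : 0 ≤ k.im) (hk0 : k ≠ 0) :
    SolvesSchrodinger q (k ^ 2) (jostSol q k) := by
  refine (solves_iff hq.locallyIntegrable).2
    ⟨jostSolDeriv q k, hasDerivAt_jostSol hq hk hk0, ?_⟩
  refine ((exp_isPrimitive (Complex.I * k)).mul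
    (((isPrimitive_jostM hq hk hk0).const_mul (Complex.I * k)).add
      (isPrimitive_jostD hq hk))).congr (funext fun x ↦ ?_) rfl
  rw [jostSol]
  linear_combination (Complex.exp (Complex.I * k * x) * jostM q k x * k ^ 2) * Complex.I_sq

lemma exp_neg_mul_exp (c : ℂ) : Complex.exp (-c) * Complex.exp c = 1 := by
  rw [← Complex.exp_add]; simp

lemma isRightJost_jostSol (hq : Integrable q) (hk : 0 ≤ k.im) (hk0 : k ≠ 0) :
    IsRightJost q k (jostSol q k) where
  solves := solves_jostSol hq hk hk0
  asymp := by
    refine (tendsto_jostM hq hk).congr fun x ↦ ?_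
    rw [jostSol, ← mul_assoc, exp_neg_mul_exp, one_mul]
  asymp_deriv := by
    have h := ((tendsto_jostM hq hk).const_mul (Complex.I * k)).add (tendsto_jostD hq hk)
    rw [mul_one, add_zero] at h
    refine h.congr fun x ↦ ?_
    rw [deriv_jostSol hq hk hk0, jostSolDeriv, ← mul_assoc, exp_neg_mul_exp, one_mul]

lemma norm_exp_I_mul (k : ℂ) (s : ℝ) :
    ‖Complex.exp (Complex.I * k * s)‖ = Real.exp (-(k.im * s)) := by
  rw [Complex.norm_exp]
  congr 1
  simp

/-- The constant Wronskian of two right Jost solutions is the limit of `e^{2ikx} (ik - ik)`, hence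
zero; the solutions are therefore proportional, and the asymptotics fixes the factor. -/
lemma isRightJost_unique (hq : Integrable q) (hk : 0 ≤ k.im) {ψ φ : ℝ → ℂ}
    (hψ : IsRightJost q k ψ) (hφ : IsRightJost q k φ) : ψ = φ := by
  have hloc := hq.locallyIntegrable
  have hφ0 : φ ≠ 0 := by
    rintro rfl
    simpa using tendsto_nhds_unique hφ.asymp (by simp : Tendsto _ _ (𝓝 (0 : ℂ)))
  -- `e^{-2ikx} W(ψ, φ) → 1 · ik - ik · 1 = 0`, and `|e^{2ikx}| ≤ 1` for `x ≥ 0`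
  have h1 := (hψ.asymp.mul hφ.asymp_deriv).sub (hψ.asymp_deriv.mul hφ.asymp)
  rw [one_mul, mul_one, sub_self] at h1
  have hw : wronskian ψ φ 0 = 0 := by
    have h2 : Tendsto (fun _ : ℝ ↦ ‖wronskian ψ φ 0‖) atTop (𝓝 0) := by
      refine squeeze_zero' (Eventually.of_forall fun _ ↦ norm_nonneg _) ?_
        (tendsto_zero_iff_norm_tendsto_zero.1 h1)
      filter_upwards [eventually_ge_atTop 0] with x hx
      rw [wronskian_eq hloc hψ.solves hφ.solves 0 x]
      have h3 : wronskian ψ φ x = Complex.exp (2 * Complex.I * k * x) *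
          (Complex.exp (-(Complex.I * k * x)) * ψ x *
            (Complex.exp (-(Complex.I * k * x)) * deriv φ x) -
          Complex.exp (-(Complex.I * k * x)) * deriv ψ x *
            (Complex.exp (-(Complex.I * k * x)) * φ x)) := by
        have : Complex.exp (2 * Complex.I * k * x) * (Complex.exp (-(Complex.I * k * x)) *
            Complex.exp (-(Complex.I * k * x))) = 1 := by
          rw [← Complex.exp_add, ← Complex.exp_add, ← Complex.exp_zero]; ring_nf
        rw [wronskian]
        linear_combination (-(ψ x * deriv φ x - deriv ψ x * φ x)) * this
      rw [h3, norm_mul]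
      exact mul_le_of_le_one_left (norm_nonneg _) (norm_exp_two_I_mul_le hk hx)
    simpa using tendsto_nhds_unique tendsto_const_nhds h2
  obtain ⟨c, hc⟩ := exists_eq_mul_of_wronskian_eq_zero hloc hψ.solves hφ.solves hw hφ0
  have h4 : Tendsto (fun x : ℝ ↦ Complex.exp (-(Complex.I * k * x)) * ψ x) atTop (𝓝 (c * 1)) := by
    refine (hφ.asymp.const_mul c).congr fun x ↦ ?_
    rw [hc]
    ring
  have h5 := tendsto_nhds_unique hψ.asymp h4
  rw [mul_one] at h5
  rw [hc, ← h5]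
  simp

lemma rightJost_eq (hq : Integrable q) (hk : 0 ≤ k.im) (hk0 : k ≠ 0) :
    rightJost q k = jostSol q k :=
  isRightJost_unique hq hk
    (Classical.epsilon_spec (p := IsRightJost q k) ⟨_, isRightJost_jostSol hq hk hk0⟩)
    (isRightJost_jostSol hq hk hk0)

/-- Reflection exchanges left and right Jost solutions. -/
lemma isLeftJost_iff (ψ : ℝ → ℂ) :
    IsLeftJost q k ψ ↔ IsRightJost (reflect q) k (fun x ↦ ψ (-x)) := by
  have hd : ∀ x, deriv (fun x ↦ ψ (-x)) x = -deriv ψ (-x) := fun x ↦ deriv_comp_neg ψ x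
  constructor
  · intro h
    refine ⟨solves_reflect h.solves, ?_, ?_⟩
    · refine (h.asymp.comp tendsto_neg_atTop_atBot).congr fun x ↦ ?_
      simp
    · have := (h.asymp_deriv.comp tendsto_neg_atTop_atBot).neg
      rw [neg_neg] at this
      refine this.congr fun x ↦ ?_
      simp [hd]
  · intro h
    refine ⟨by simpa using solves_reflect h.solves, ?_, ?_⟩
    · refine (h.asymp.comp tendsto_neg_atBot_atTop).congr fun x ↦ ?_
      simp
    · refine (h.asymp_deriv.comp tendsto_neg_atBot_atTop).neg.congr fun x ↦ ?_
      simp [hd]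

lemma integrable_reflect (hq : Integrable q) : Integrable (reflect q) := hq.comp_neg

lemma leftJost_eq (hq : Integrable q) (hk : 0 ≤ k.im) (hk0 : k ≠ 0) :
    leftJost q k = fun x ↦ jostSol (reflect q) k (-x) := by
  have hr := isRightJost_jostSol (integrable_reflect hq) hk hk0
  have hex : IsLeftJost q k (fun x ↦ jostSol (reflect q) k (-x)) :=
    (isLeftJost_iff _).2 (by simpa using hr)
  have h := (isLeftJost_iff _).1 (Classical.epsilon_spec (p := IsLeftJost q k) ⟨_, hex⟩)
  have h2 := isRightJost_unique (integrable_reflect hq) hk h hr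
  funext x
  have := congrFun h2 (-x)
  simpa [leftJost] using this

end jost

/-! ### Locality and dependence on the momentum -/

section locality
variable {q q' : ℝ → ℝ} {k : ℂ} {x₀ : ℝ}

lemma jostIter_congr (h : ∀ᵐ t, x₀ < t → q t = q' t) (k : ℂ) (n : ℕ) {x : ℝ} (hx : x₀ ≤ x) :
    jostIter q k n x = jostIter q' k n x := by
  induction n generalizing x with
  | zero => rfl
  | succ n ih =>
    refine integral_congr_ae ?_
    filter_upwards [h] with t ht
    rcases le_or_gt t x with h1 | h1
    · simp [volterraKernel_of_nonpos k (sub_nonpos.2 h1)]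
    · simp only [ht (hx.trans_lt h1), ih (hx.trans h1.le)]

/-- The modified Jost solution at `x` depends only on the potential on `(x, ∞)`. -/
lemma jostM_congr (h : ∀ᵐ t, x₀ < t → q t = q' t) (k : ℂ) {x : ℝ} (hx : x₀ ≤ x) :
    jostM q k x = jostM q' k x := by
  simp only [jostM, jostIter_congr h k _ hx]

lemma jostD_congr (h : ∀ᵐ t, x₀ < t → q t = q' t) (k : ℂ) {x : ℝ} (hx : x₀ ≤ x) :
    jostD q k x = jostD q' k x := by
  unfold jostD
  congr 1
  refine integral_congr_ae ?_
  filter_upwards [ae_restrict_of_ae h, ae_restrict_mem measurableSet_Ioi] with t ht htx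
  have htx : x < t := htx
  rw [ht (hx.trans_lt htx), jostM_congr h k (hx.trans htx.le)]

lemma jostSol_congr (h : ∀ᵐ t, x₀ < t → q t = q' t) (k : ℂ) {x : ℝ} (hx : x₀ ≤ x) :
    jostSol q k x = jostSol q' k x := by
  rw [jostSol, jostSol, jostM_congr h k hx]

lemma jostSolDeriv_congr (h : ∀ᵐ t, x₀ < t → q t = q' t) (k : ℂ) {x : ℝ} (hx : x₀ ≤ x) :
    jostSolDeriv q k x = jostSolDeriv q' k x := by
  rw [jostSolDeriv, jostSolDeriv, jostM_congr h k hx, jostD_congr h k hx]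

lemma jostM_eq_one (hq : Integrable q) (hk : 0 ≤ k.im) (h : ∀ t, x₀ < t → q t = 0) {x : ℝ}
    (hx : x₀ ≤ x) : jostM q k x = 1 ∧ jostD q k x = 0 := by
  have h0 : tail (fun t ↦ |q t|) x = 0 :=
    setIntegral_eq_zero_of_forall_eq_zero fun t ht ↦ by simp [h t (hx.trans_lt ht)]
  have h1 := norm_jostM_sub_one_le hq hk x
  have h2 := norm_jostD_le hq hk x
  rw [h0, mul_zero] at h1 h2
  exact ⟨sub_eq_zero.1 (norm_le_zero_iff.1 h1), norm_le_zero_iff.1 h2⟩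

end locality

/-- An integral of functions that depend holomorphically on a parameter, with an integrable
majorant, is holomorphic: Cauchy's estimate bounds the derivatives. -/
lemma differentiableOn_integral_of_dominated {F : ℂ → ℝ → ℂ} {U : Set ℂ} (hU : IsOpen U)
    {μ : Measure ℝ} {bound : ℝ → ℝ} (hb : Integrable bound μ)
    (hm : ∀ k ∈ U, AEStronglyMeasurable (F k) μ)
    (hF : ∀ᵐ t ∂μ, ∀ k ∈ U, ‖F k t‖ ≤ bound t)
    (hd : ∀ t, DifferentiableOn ℂ (fun k ↦ F k t) U) :
    DifferentiableOn ℂ (fun k ↦ ∫ t, F k t ∂μ) U := by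
  intro k₀ hk₀
  obtain ⟨r, hr, hball⟩ := Metric.isOpen_iff.1 hU k₀ hk₀
  have hs : Metric.ball k₀ (r / 2) ∈ 𝓝 k₀ := Metric.ball_mem_nhds _ (by positivity)
  have hUn : ∀ᶠ k in 𝓝 k₀, k ∈ U := hU.mem_nhds hk₀
  have hdiff : ∀ t, ∀ k ∈ U, HasDerivAt (fun k ↦ F k t) (deriv (fun k ↦ F k t) k) k :=
    fun t k hk ↦ ((hd t).differentiableAt (hU.mem_nhds hk)).hasDerivAt
  have hsub : Metric.ball k₀ (r / 2) ⊆ U :=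
    (Metric.ball_subset_ball (by linarith)).trans hball
  refine (hasDerivAt_integral_of_dominated_loc_of_deriv_le (F' := fun k t ↦ deriv (F · t) k)
    (bound := fun t ↦ bound t / (r / 4)) hs (hUn.mono fun k hk ↦ hm k hk)
    (hb.mono' (hm k₀ hk₀) (hF.mono fun t ht ↦ ht k₀ hk₀)) ?_ ?_ (hb.div_const _)
    (Eventually.of_forall fun t k hk ↦ hdiff t k (hsub hk))).2.differentiableAt.differentiableWithinAt
  · obtain ⟨s, -, hs1, hs2⟩ := exists_seq_strictAnti_tendsto' (show (0 : ℝ) < r by exact hr)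
    have hs3 : ∀ n, k₀ + (s n : ℂ) ∈ U := fun n ↦ hball (by
      simpa [abs_of_pos (hs1 n).1] using (hs1 n).2)
    refine aestronglyMeasurable_of_tendsto_ae atTop
      (f := fun n t ↦ (s n : ℂ)⁻¹ • (F (k₀ + s n) t - F k₀ t))
      (fun n ↦ ((hm _ (hs3 n)).fun_sub (hm k₀ hk₀)).fun_const_smul _)
      (Eventually.of_forall fun t ↦ ?_)
    have h1 := (hasDerivAt_iff_tendsto_slope_zero.1 (hdiff t k₀ hk₀))
    refine h1.comp (tendsto_nhdsWithin_iff.2 ⟨?_, Eventually.of_forall fun n ↦ ?_⟩)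
    · exact (Complex.continuous_ofReal.tendsto' 0 0 (by simp)).comp hs2
    · simpa using (hs1 n).1.ne'
  · filter_upwards [hF] with t ht k hk
    refine Complex.norm_deriv_le_of_forall_mem_sphere_norm_le (by positivity)
      (DifferentiableOn.diffContOnCl ((hd t).mono ?_)) fun z hz ↦ ht z (hball ?_)
    · rw [closure_ball _ (by positivity)]
      refine Subset.trans (fun z hz ↦ ?_) hball
      have := dist_triangle z k k₀
      simp only [Metric.mem_closedBall, Metric.mem_ball] at hz hk ⊢
      linarith
    · have := dist_triangle z k k₀
      simp only [Metric.mem_sphere, Metric.mem_ball] at hz hk ⊢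
      linarith

section momentum
variable {q : ℝ → ℝ} {δ : ℝ}

/-- The closed upper half plane without a disc around `0`. On it the Volterra series converges
uniformly. -/
def closedDomain (δ : ℝ) : Set ℂ := {k | 0 ≤ k.im ∧ δ < ‖k‖}

/-- The open upper half plane without a disc around `0`. -/
def openDomain (δ : ℝ) : Set ℂ := {k | 0 < k.im ∧ δ < ‖k‖}

lemma isOpen_openDomain (δ : ℝ) : IsOpen (openDomain δ) :=
  (isOpen_lt continuous_const Complex.continuous_im).inter (isOpen_lt continuous_const continuous_norm)

lemma openDomain_subset (δ : ℝ) : openDomain δ ⊆ closedDomain δ := fun _ hk ↦ ⟨hk.1.le, hk.2⟩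

lemma ne_zero_of_mem_closedDomain (hδ : 0 < δ) {k : ℂ} (hk : k ∈ closedDomain δ) : k ≠ 0 :=
  norm_pos_iff.1 (hδ.trans hk.2)

lemma norm_inv_le_of_mem (hδ : 0 < δ) {k : ℂ} (hk : k ∈ closedDomain δ) : ‖k‖⁻¹ ≤ δ⁻¹ :=
  inv_anti₀ hδ hk.2.le

/-- A majorant of the modified Jost solutions on `closedDomain δ`. -/
noncomputable def uniformJostBound (q : ℝ → ℝ) (δ : ℝ) : ℝ := Real.exp (δ⁻¹ * ∫ t, |q t|)

lemma hasSum_uniformJostBound (q : ℝ → ℝ) (δ : ℝ) :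
    HasSum (fun n : ℕ ↦ (δ⁻¹ * ∫ t, |q t|) ^ n / n.factorial) (uniformJostBound q δ) := by
  rw [uniformJostBound, Real.exp_eq_exp_ℝ]
  exact NormedSpace.expSeries_div_hasSum_exp _

lemma norm_jostIter_le_uniform (hq : Integrable q) (hδ : 0 < δ) {k : ℂ} (hk : k ∈ closedDomain δ)
    (n : ℕ) (x : ℝ) : ‖jostIter q k n x‖ ≤ (δ⁻¹ * ∫ t, |q t|) ^ n / n.factorial := by
  refine (norm_jostIter_le hq hk.1 n x).trans ?_
  have : 0 ≤ ∫ t, |q t| := integral_nonneg fun t ↦ abs_nonneg _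
  gcongr
  exact hk.2.le

lemma norm_jostM_le_uniform (hq : Integrable q) (hδ : 0 < δ) {k : ℂ} (hk : k ∈ closedDomain δ)
    (x : ℝ) : ‖jostM q k x‖ ≤ uniformJostBound q δ :=
  tsum_of_norm_bounded (hasSum_uniformJostBound q δ)
    fun n ↦ norm_jostIter_le_uniform hq hδ hk n x

lemma continuousOn_volterraKernel (hδ : 0 < δ) (s : ℝ) :
    ContinuousOn (fun k ↦ volterraKernel k s) (closedDomain δ) := by
  unfold volterraKernel
  refine ContinuousOn.div (by fun_prop) (by fun_prop) fun k hk ↦ ?_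
  simp [ne_zero_of_mem_closedDomain hδ hk]

lemma differentiableOn_volterraKernel (hδ : 0 < δ) (s : ℝ) :
    DifferentiableOn ℂ (fun k ↦ volterraKernel k s) (openDomain δ) := by
  unfold volterraKernel
  refine DifferentiableOn.div (by fun_prop) (by fun_prop) fun k hk ↦ ?_
  simp [ne_zero_of_mem_closedDomain hδ (openDomain_subset δ hk)]

lemma aestronglyMeasurable_volterra (hq : Integrable q) {k : ℂ} (hk : 0 ≤ k.im) (n : ℕ) (x : ℝ) :
    AEStronglyMeasurable (fun t ↦ volterraKernel k (t - x) * ((q t : ℂ) * jostIter q k n t))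
      volume :=
  ((continuous_volterraKernel k).comp (continuous_id.sub continuous_const)).aestronglyMeasurable.mul
    (hq.ofReal.aestronglyMeasurable.mul (continuous_jostIter hq hk n).aestronglyMeasurable)

lemma norm_volterra_le (hq : Integrable q) (hδ : 0 < δ) {k : ℂ} (hk : k ∈ closedDomain δ)
    (n : ℕ) (x t : ℝ) : ‖volterraKernel k (t - x) * ((q t : ℂ) * jostIter q k n t)‖ ≤
      δ⁻¹ * (|q t| * ((δ⁻¹ * ∫ t, |q t|) ^ n / n.factorial)) := by
  rw [norm_mul, norm_mul, Complex.norm_real, Real.norm_eq_abs]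
  gcongr
  · exact (norm_volterraKernel_le hk.1 _).trans (norm_inv_le_of_mem hδ hk)
  · exact norm_jostIter_le_uniform hq hδ hk n t

lemma continuousOn_jostIter_momentum (hq : Integrable q) (hδ : 0 < δ) (n : ℕ) (x : ℝ) :
    ContinuousOn (fun k ↦ jostIter q k n x) (closedDomain δ) := by
  induction n generalizing x with
  | zero => exact continuousOn_const
  | succ n ih =>
    exact continuousOn_of_dominated (fun k hk ↦ aestronglyMeasurable_volterra hq hk.1 n x)
      (fun k hk ↦ Eventually.of_forall (norm_volterra_le hq hδ hk n x))
      ((hq.abs.mul_const _).const_mul _)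
      (Eventually.of_forall fun t ↦ (continuousOn_volterraKernel hδ _).mul
        (continuousOn_const.mul (ih t)))

lemma differentiableOn_jostIter (hq : Integrable q) (hδ : 0 < δ) (n : ℕ) (x : ℝ) :
    DifferentiableOn ℂ (fun k ↦ jostIter q k n x) (openDomain δ) := by
  induction n generalizing x with
  | zero => exact differentiableOn_const _
  | succ n ih =>
    exact differentiableOn_integral_of_dominated (isOpen_openDomain δ)
      ((hq.abs.mul_const _).const_mul _)
      (fun k hk ↦ aestronglyMeasurable_volterra hq hk.1.le n x)
      (Eventually.of_forall fun t k hk ↦ norm_volterra_le hq hδ (openDomain_subset δ hk) n x t)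
      (fun t ↦ (differentiableOn_volterraKernel hδ _).mul ((differentiableOn_const _).mul (ih t)))

lemma continuousOn_jostM_momentum (hq : Integrable q) (hδ : 0 < δ) (x : ℝ) :
    ContinuousOn (fun k ↦ jostM q k x) (closedDomain δ) :=
  continuousOn_tsum (fun n ↦ continuousOn_jostIter_momentum hq hδ n x)
    (hasSum_uniformJostBound q δ).summable fun n _ hk ↦ norm_jostIter_le_uniform hq hδ hk n x

lemma differentiableOn_jostM (hq : Integrable q) (hδ : 0 < δ) (x : ℝ) :
    DifferentiableOn ℂ (fun k ↦ jostM q k x) (openDomain δ) :=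
  Complex.differentiableOn_tsum_of_summable_norm (hasSum_uniformJostBound q δ).summable
    (fun n ↦ differentiableOn_jostIter hq hδ n x) (isOpen_openDomain δ)
    fun n _ hk ↦ norm_jostIter_le_uniform hq hδ (openDomain_subset δ hk) n x

lemma ae_norm_jostD_integrand_le (hq : Integrable q) (hδ : 0 < δ) (x : ℝ) :
    ∀ᵐ t : ℝ ∂volume.restrict (Ioi x), ∀ k ∈ closedDomain δ,
      ‖Complex.exp (2 * Complex.I * k * (t - x)) * ((q t : ℂ) * jostM q k t)‖ ≤
        |q t| * uniformJostBound q δ := by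
  filter_upwards [ae_restrict_mem measurableSet_Ioi] with t ht k hk
  rw [norm_mul, norm_mul, Complex.norm_real, Real.norm_eq_abs, ← Complex.ofReal_sub]
  have h1 := norm_exp_two_I_mul_le hk.1 (sub_nonneg.2 (le_of_lt ht))
  have h2 := norm_jostM_le_uniform hq hδ hk t
  calc _ ≤ 1 * (|q t| * uniformJostBound q δ) := by gcongr
    _ = _ := one_mul _

lemma continuousOn_jostD_momentum (hq : Integrable q) (hδ : 0 < δ) (x : ℝ) :
    ContinuousOn (fun k ↦ jostD q k x) (closedDomain δ) := by
  have hb := ae_norm_jostD_integrand_le hq hδ x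
  refine (continuousOn_of_dominated
    (fun k hk ↦ (integrableOn_exp_mul_potential_mul_jostM hq hk.1 x).aestronglyMeasurable)
    (fun k hk ↦ hb.mono fun t ht ↦ ht k hk) (hq.abs.mul_const _).integrableOn
    (Eventually.of_forall fun t ↦ ?_)).neg
  exact ContinuousOn.mul (by fun_prop)
    (continuousOn_const.mul (continuousOn_jostM_momentum hq hδ t))

lemma differentiableOn_jostD (hq : Integrable q) (hδ : 0 < δ) (x : ℝ) :
    DifferentiableOn ℂ (fun k ↦ jostD q k x) (openDomain δ) := by
  have hb := ae_norm_jostD_integrand_le hq hδ x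
  refine (differentiableOn_integral_of_dominated (isOpen_openDomain δ)
    (hq.abs.mul_const (uniformJostBound q δ)).integrableOn
    (fun k hk ↦ (integrableOn_exp_mul_potential_mul_jostM hq hk.1.le x).aestronglyMeasurable)
    (hb.mono fun t ht k hk ↦ ht k (openDomain_subset δ hk)) (fun t ↦ ?_)).neg
  exact DifferentiableOn.mul (by fun_prop)
    ((differentiableOn_const _).mul (differentiableOn_jostM hq hδ t))

lemma continuousWithinAt_of_closedDomain {f : ℂ → ℂ}
    (h : ∀ δ, 0 < δ → ContinuousOn f (closedDomain δ)) {k : ℂ} (hk : 0 ≤ k.im) (hk0 : k ≠ 0) :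
    ContinuousWithinAt f {z | 0 ≤ z.im} k := by
  have hk' : 0 < ‖k‖ := norm_pos_iff.2 hk0
  refine (h (‖k‖ / 2) (by positivity) k ⟨hk, by linarith⟩).mono_of_mem_nhdsWithin ?_
  exact inter_mem self_mem_nhdsWithin (nhdsWithin_le_nhds
    ((isOpen_lt continuous_const continuous_norm).mem_nhds
      (show ‖k‖ / 2 < ‖k‖ by linarith)))

lemma differentiableOn_of_openDomain {f : ℂ → ℂ}
    (h : ∀ δ, 0 < δ → DifferentiableOn ℂ f (openDomain δ)) :
    DifferentiableOn ℂ f {z | 0 < z.im} := by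
  intro k hk
  have hk' : 0 < ‖k‖ := norm_pos_iff.2 (by rintro rfl; simp at hk)
  exact ((h (‖k‖ / 2) (by positivity)).differentiableAt
    ((isOpen_openDomain _).mem_nhds ⟨hk, by linarith⟩)).differentiableWithinAt

lemma continuousWithinAt_jostSol (hq : Integrable q) {k : ℂ} (hk : 0 ≤ k.im) (hk0 : k ≠ 0)
    (x : ℝ) : ContinuousWithinAt (fun k ↦ jostSol q k x) {z | 0 ≤ z.im} k := by
  refine continuousWithinAt_of_closedDomain (fun δ hδ ↦ ?_) hk hk0
  exact ContinuousOn.mul (by fun_prop) (continuousOn_jostM_momentum hq hδ x)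

lemma continuousWithinAt_jostSolDeriv (hq : Integrable q) {k : ℂ} (hk : 0 ≤ k.im) (hk0 : k ≠ 0)
    (x : ℝ) : ContinuousWithinAt (fun k ↦ jostSolDeriv q k x) {z | 0 ≤ z.im} k := by
  refine continuousWithinAt_of_closedDomain (fun δ hδ ↦ ?_) hk hk0
  exact ContinuousOn.mul (by fun_prop) (ContinuousOn.add (ContinuousOn.mul (by fun_prop)
    (continuousOn_jostM_momentum hq hδ x)) (continuousOn_jostD_momentum hq hδ x))

lemma differentiableOn_jostSol (hq : Integrable q) (x : ℝ) :
    DifferentiableOn ℂ (fun k ↦ jostSol q k x) {z | 0 < z.im} := by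
  refine differentiableOn_of_openDomain fun δ hδ ↦ ?_
  exact DifferentiableOn.mul (by fun_prop) (differentiableOn_jostM hq hδ x)

lemma differentiableOn_jostSolDeriv (hq : Integrable q) (x : ℝ) :
    DifferentiableOn ℂ (fun k ↦ jostSolDeriv q k x) {z | 0 < z.im} := by
  refine differentiableOn_of_openDomain fun δ hδ ↦ ?_
  exact DifferentiableOn.mul (by fun_prop) (DifferentiableOn.add (DifferentiableOn.mul
    (by fun_prop) (differentiableOn_jostM hq hδ x)) (differentiableOn_jostD hq hδ x))

end momentum

/-! ### Scattering coefficients from Cauchy data at the origin -/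

/-- `ψ₊(0, k)`. -/
noncomputable def rightVal (q : ℝ → ℝ) (k : ℂ) : ℂ := jostSol q k 0

/-- `∂ₓ ψ₊(0, k)`. -/
noncomputable def rightSlope (q : ℝ → ℝ) (k : ℂ) : ℂ := jostSolDeriv q k 0

/-- `ψ₋(0, k)`. -/
noncomputable def leftVal (q : ℝ → ℝ) (k : ℂ) : ℂ := jostSol (reflect q) k 0

/-- `∂ₓ ψ₋(0, k)`. -/
noncomputable def leftSlope (q : ℝ → ℝ) (k : ℂ) : ℂ := -jostSolDeriv (reflect q) k 0

/-- The Jost function `W(ψ₊, ψ₋)`, whose zeros in the upper half plane are the bound states. -/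
noncomputable def jostW (q : ℝ → ℝ) (k : ℂ) : ℂ :=
  rightVal q k * leftSlope q k - rightSlope q k * leftVal q k

section data
variable {q : ℝ → ℝ} {k : ℂ}

lemma rightJost_zero (hq : Integrable q) (hk : 0 ≤ k.im) (hk0 : k ≠ 0) :
    rightJost q k 0 = rightVal q k ∧ deriv (rightJost q k) 0 = rightSlope q k := by
  rw [rightJost_eq hq hk hk0, deriv_jostSol hq hk hk0]
  exact ⟨rfl, rfl⟩

lemma leftJost_zero (hq : Integrable q) (hk : 0 ≤ k.im) (hk0 : k ≠ 0) :
    leftJost q k 0 = leftVal q k ∧ deriv (leftJost q k) 0 = leftSlope q k := by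
  rw [leftJost_eq hq hk hk0, deriv_comp_neg, deriv_jostSol (integrable_reflect hq) hk hk0]
  simp [leftVal, leftSlope]

lemma solves_rightJost (hq : Integrable q) (hk : 0 ≤ k.im) (hk0 : k ≠ 0) :
    SolvesSchrodinger q (k ^ 2) (rightJost q k) := by
  rw [rightJost_eq hq hk hk0]; exact solves_jostSol hq hk hk0

lemma solves_leftJost (hq : Integrable q) (hk : 0 ≤ k.im) (hk0 : k ≠ 0) :
    SolvesSchrodinger q (k ^ 2) (leftJost q k) := by
  rw [leftJost_eq hq hk hk0]
  simpa using solves_reflect (solves_jostSol (integrable_reflect hq) hk hk0)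

lemma integrable_rightPart (hq : Integrable q) : Integrable (rightPart q) :=
  hq.indicator measurableSet_Ioi

lemma integrable_leftPart (hq : Integrable q) : Integrable (leftPart q) :=
  hq.indicator measurableSet_Iio

lemma rightPart_of_pos {t : ℝ} (ht : 0 < t) : rightPart q t = q t := indicator_of_mem ht _

lemma reflect_rightPart_of_pos {t : ℝ} (ht : 0 < t) : reflect (rightPart q) t = 0 :=
  indicator_of_notMem (by simp [ht.le]) _

lemma leftPart_of_pos {t : ℝ} (ht : 0 < t) : leftPart q t = 0 :=
  indicator_of_notMem (by simp [ht.le]) _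

lemma reflect_leftPart_of_pos {t : ℝ} (ht : 0 < t) : reflect (leftPart q) t = reflect q t :=
  indicator_of_mem (by simpa using ht) _

lemma right_data_rightPart (q : ℝ → ℝ) (k : ℂ) :
    rightVal (rightPart q) k = rightVal q k ∧ rightSlope (rightPart q) k = rightSlope q k := by
  have h : ∀ᵐ t, 0 < t → rightPart q t = q t :=
    Eventually.of_forall fun _ ht ↦ rightPart_of_pos ht
  exact ⟨jostSol_congr h k le_rfl, jostSolDeriv_congr h k le_rfl⟩

lemma left_data_leftPart (q : ℝ → ℝ) (k : ℂ) :
    leftVal (leftPart q) k = leftVal q k ∧ leftSlope (leftPart q) k = leftSlope q k := by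
  have h : ∀ᵐ t, 0 < t → reflect (leftPart q) t = reflect q t :=
    Eventually.of_forall fun _ ht ↦ reflect_leftPart_of_pos ht
  exact ⟨jostSol_congr h k le_rfl, congrArg Neg.neg (jostSolDeriv_congr h k le_rfl)⟩

lemma left_data_rightPart (hq : Integrable q) (hk : 0 ≤ k.im) :
    leftVal (rightPart q) k = 1 ∧ leftSlope (rightPart q) k = -(Complex.I * k) := by
  obtain ⟨h1, h2⟩ := jostM_eq_one (integrable_reflect (integrable_rightPart hq)) hk
    (fun t ht ↦ reflect_rightPart_of_pos ht) le_rfl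
  simp [leftVal, leftSlope, jostSol, jostSolDeriv, h1, h2]

lemma right_data_leftPart (hq : Integrable q) (hk : 0 ≤ k.im) :
    rightVal (leftPart q) k = 1 ∧ rightSlope (leftPart q) k = Complex.I * k := by
  obtain ⟨h1, h2⟩ := jostM_eq_one (integrable_leftPart hq) hk
    (fun t ht ↦ leftPart_of_pos ht) le_rfl
  simp [rightVal, rightSlope, jostSol, jostSolDeriv, h1, h2]

end data

section real
variable {q : ℝ → ℝ} {k : ℝ}

open scoped ComplexConjugate

/-- The Wronskian of `ψ₊` with its conjugate at a real momentum. -/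
lemma wronskian_right_conj (hq : Integrable q) (hk0 : k ≠ 0) :
    rightVal q k * conj (rightSlope q k) - rightSlope q k * conj (rightVal q k) =
      -(2 * Complex.I * k) := by
  have hk : 0 ≤ (k : ℂ).im := by simp
  have hk0' : (k : ℂ) ≠ 0 := by exact_mod_cast hk0
  have hs := solves_jostSol hq hk hk0'
  have hJ := isRightJost_jostSol hq hk hk0'
  have hloc := hq.locallyIntegrable
  have hs' : SolvesSchrodinger q ((k : ℂ) ^ 2) (fun x ↦ conj (jostSol q k x)) := by
    simpa using solves_conj hloc hs
  have hd : ∀ x, deriv (fun x ↦ conj (jostSol q k x)) x = conj (deriv (jostSol q k) x) :=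
    fun x ↦ (hasDerivAt_conj (solves_hasDerivAt hs x)).deriv
  have hcc : ∀ {f : ℝ → ℂ} {l : ℂ}, Tendsto f atTop (𝓝 l) →
      Tendsto (fun x ↦ conj (f x)) atTop (𝓝 (conj l)) :=
    fun h ↦ (Complex.continuous_conj.tendsto _).comp h
  have hlim := (hJ.asymp.mul (hcc hJ.asymp_deriv)).sub (hJ.asymp_deriv.mul (hcc hJ.asymp))
  have hconst : Tendsto (fun _ : ℝ ↦ wronskian (jostSol q k) (fun x ↦ conj (jostSol q k x)) 0)
      atTop (𝓝 (1 * conj (Complex.I * k) - Complex.I * k * conj 1)) := by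
    refine hlim.congr fun x ↦ ?_
    rw [wronskian_eq hloc hs hs' 0 x, wronskian, hd]
    simp only [map_mul]
    have h1 : Complex.exp (-(Complex.I * k * x)) * conj (Complex.exp (-(Complex.I * k * x))) = 1 := by
      rw [← Complex.exp_conj, ← Complex.exp_add]
      simp
    linear_combination (jostSol q k x * conj (deriv (jostSol q k) x) -
      deriv (jostSol q k) x * conj (jostSol q k x)) * h1
  have h := tendsto_nhds_unique tendsto_const_nhds hconst
  rw [wronskian, hd, deriv_jostSol hq hk hk0'] at h
  rw [rightVal, rightSlope, h]
  simp
  ring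

lemma wronskian_left_conj (hq : Integrable q) (hk0 : k ≠ 0) :
    leftVal q k * conj (leftSlope q k) - leftSlope q k * conj (leftVal q k) =
      2 * Complex.I * k := by
  have h := wronskian_right_conj (integrable_reflect hq) hk0
  simp only [rightVal, rightSlope, leftVal, leftSlope, map_neg] at h ⊢
  linear_combination -h

/-- The Plücker identity between the two Jost solutions and their conjugates. -/
lemma jostW_mul_conj (hq : Integrable q) (hk0 : k ≠ 0) :
    jostW q k * conj (jostW q k) = 4 * (k : ℂ) ^ 2 +
      (conj (rightVal q k) * leftSlope q k - conj (rightSlope q k) * leftVal q k) *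
      conj (conj (rightVal q k) * leftSlope q k - conj (rightSlope q k) * leftVal q k) := by
  have h1 := wronskian_right_conj hq hk0
  have h2 := wronskian_left_conj hq hk0
  simp only [jostW, map_sub, map_mul, Complex.conj_conj]
  linear_combination (leftVal q k * conj (leftSlope q k) - leftSlope q k * conj (leftVal q k)) * h1
    - 2 * Complex.I * k * h2 - 4 * (k : ℂ) ^ 2 * Complex.I_sq

lemma normSq_jostW (hq : Integrable q) (hk0 : k ≠ 0) :
    ‖jostW q k‖ ^ 2 = 4 * k ^ 2 +
      ‖conj (rightVal q k) * leftSlope q k - conj (rightSlope q k) * leftVal q k‖ ^ 2 := by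
  have h := jostW_mul_conj hq hk0
  rw [Complex.mul_conj, Complex.mul_conj, Complex.normSq_eq_norm_sq,
    Complex.normSq_eq_norm_sq] at h
  exact_mod_cast h

lemma jostW_ne_zero_of_real (hq : Integrable q) (hk0 : k ≠ 0) : jostW q k ≠ 0 := by
  intro h
  have := normSq_jostW hq hk0
  rw [h, norm_zero] at this
  have : 0 < k ^ 2 := by positivity
  nlinarith [sq_nonneg ‖conj (rightVal q k) * leftSlope q k - conj (rightSlope q k) * leftVal q k‖]

/-- The scattering relations hold exactly for the quotients of Wronskians. -/
lemma scatteringRelations_iff (hq : Integrable q) (hk0 : k ≠ 0) (T R L : ℂ) :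
    ScatteringRelations q k T R L ↔
      T = -(2 * Complex.I * k) / jostW q k ∧
      R = -(conj (rightVal q k) * leftSlope q k - conj (rightSlope q k) * leftVal q k) / jostW q k ∧
      L = (conj (leftVal q k) * rightSlope q k - conj (leftSlope q k) * rightVal q k) /
        jostW q k := by
  have hk : 0 ≤ (k : ℂ).im := by simp
  have hk0' : (k : ℂ) ≠ 0 := by exact_mod_cast hk0
  have hloc := hq.locallyIntegrable
  have hw := jostW_ne_zero_of_real hq hk0
  have hjw : jostW q k = rightVal q k * leftSlope q k - rightSlope q k * leftVal q k := rfl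
  have hwr := wronskian_right_conj hq hk0
  have hwl := wronskian_left_conj hq hk0
  have hsr := solves_rightJost hq hk hk0'
  have hsl := solves_leftJost hq hk hk0'
  obtain ⟨hr0, hr1⟩ := rightJost_zero hq hk hk0'
  obtain ⟨hl0, hl1⟩ := leftJost_zero hq hk hk0'
  have hdr : ∀ c, HasDerivAt (fun x ↦ conj (rightJost q k x) + c * rightJost q k x)
      (conj (rightSlope q k) + c * rightSlope q k) 0 := fun c ↦ by
    have h := solves_hasDerivAt hsr 0
    rw [hr1] at h
    exact (hasDerivAt_conj h).add (h.const_mul c)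
  have hdl : ∀ c, HasDerivAt (fun x ↦ conj (leftJost q k x) + c * leftJost q k x)
      (conj (leftSlope q k) + c * leftSlope q k) 0 := fun c ↦ by
    have h := solves_hasDerivAt hsl 0
    rw [hl1] at h
    exact (hasDerivAt_conj h).add (h.const_mul c)
  constructor
  · rintro ⟨h1, h2⟩
    have e1 := h1 0
    have e2 := h2 0
    have d1 : T * leftSlope q k = conj (rightSlope q k) + R * rightSlope q k := by
      have h := (solves_hasDerivAt hsl 0).const_mul T
      rw [funext h1, hl1] at h
      exact h.unique (hdr R)
    have d2 : T * rightSlope q k = conj (leftSlope q k) + L * leftSlope q k := by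
      have h := (solves_hasDerivAt hsr 0).const_mul T
      rw [funext h2, hr1] at h
      exact h.unique (hdl L)
    rw [hr0, hl0] at e1 e2
    refine ⟨?_, ?_, ?_⟩ <;> rw [eq_div_iff hw, jostW]
    · linear_combination rightVal q k * d1 - rightSlope q k * e1 + hwr
    · linear_combination leftVal q k * d1 - leftSlope q k * e1
    · linear_combination rightSlope q k * e2 - rightVal q k * d2
  · rintro ⟨hT, hR, hL⟩
    rw [eq_div_iff hw] at hT hR hL
    have hsr' : SolvesSchrodinger q ((k : ℂ) ^ 2) (fun x ↦ conj (rightJost q k x)) := by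
      simpa using solves_conj hloc hsr
    have hsl' : SolvesSchrodinger q ((k : ℂ) ^ 2) (fun x ↦ conj (leftJost q k x)) := by
      simpa using solves_conj hloc hsl
    constructor
    · have := solution_eq_mul hloc (solves_add hloc hsr' (solves_const_mul hloc hsr R)) hsl
        (a := 0) (c := T) ?_ ?_
      · exact fun x ↦ (congrFun this x).symm
      · rw [hr0, hl0]
        refine mul_right_cancel₀ hw ?_
        linear_combination rightVal q k * hR - leftVal q k * hT + leftVal q k * hwr +
          conj (rightVal q k) * hjw
      · rw [(hdr R).deriv, hl1]
        refine mul_right_cancel₀ hw ?_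
        linear_combination rightSlope q k * hR - leftSlope q k * hT + leftSlope q k * hwr +
          conj (rightSlope q k) * hjw
    · have := solution_eq_mul hloc (solves_add hloc hsl' (solves_const_mul hloc hsl L)) hsr
        (a := 0) (c := T) ?_ ?_
      · exact fun x ↦ (congrFun this x).symm
      · rw [hr0, hl0]
        refine mul_right_cancel₀ hw ?_
        linear_combination leftVal q k * hL - rightVal q k * hT - rightVal q k * hwl +
          conj (leftVal q k) * hjw
      · rw [(hdl L).deriv, hr1]
        refine mul_right_cancel₀ hw ?_
        linear_combination leftSlope q k * hL - rightSlope q k * hT - rightSlope q k * hwl +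
          conj (leftSlope q k) * hjw

lemma transmission_eq (hq : Integrable q) (hk0 : k ≠ 0) :
    transmission q k = -(2 * Complex.I * k) / jostW q k := by
  obtain ⟨R, L, h⟩ := Classical.epsilon_spec (p := fun T ↦ ∃ R L, ScatteringRelations q k T R L)
    ⟨_, _, _, (scatteringRelations_iff hq hk0 _ _ _).2 ⟨rfl, rfl, rfl⟩⟩
  exact ((scatteringRelations_iff hq hk0 _ _ _).1 h).1

lemma rightReflection_eq (hq : Integrable q) (hk0 : k ≠ 0) :
    rightReflection q k =
      -(conj (rightVal q k) * leftSlope q k - conj (rightSlope q k) * leftVal q k) / jostW q k := by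
  obtain ⟨T, L, h⟩ := Classical.epsilon_spec (p := fun R ↦ ∃ T L, ScatteringRelations q k T R L)
    ⟨_, _, _, (scatteringRelations_iff hq hk0 _ _ _).2 ⟨rfl, rfl, rfl⟩⟩
  exact ((scatteringRelations_iff hq hk0 _ _ _).1 h).2.1

lemma leftReflection_eq (hq : Integrable q) (hk0 : k ≠ 0) :
    leftReflection q k =
      (conj (leftVal q k) * rightSlope q k - conj (leftSlope q k) * rightVal q k) /
        jostW q k := by
  obtain ⟨T, R, h⟩ := Classical.epsilon_spec (p := fun L ↦ ∃ T R, ScatteringRelations q k T R L)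
    ⟨_, _, _, (scatteringRelations_iff hq hk0 _ _ _).2 ⟨rfl, rfl, rfl⟩⟩
  exact ((scatteringRelations_iff hq hk0 _ _ _).1 h).2.2

lemma norm_rightReflection_le_one (hq : Integrable q) (hk0 : k ≠ 0) :
    ‖rightReflection q k‖ ≤ 1 := by
  have hw := norm_pos_iff.2 (jostW_ne_zero_of_real hq hk0)
  rw [rightReflection_eq hq hk0, norm_div, norm_neg, div_le_one hw]
  refine le_of_sq_le_sq ?_ hw.le
  rw [normSq_jostW hq hk0]
  nlinarith [sq_nonneg k]

end real

/-! ### The splitting of the reflection coefficient -/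

/-- The function `G = R - R₊` in terms of Wronskians at the origin:
`-2ik W(ψ₋, e^{-ikx}) / (W(ψ₊, ψ₋) W(ψ₊, e^{-ikx}))`. -/
noncomputable def splitG (q : ℝ → ℝ) (k : ℂ) : ℂ :=
  -(2 * Complex.I * k) * (leftVal q k * -(Complex.I * k) - leftSlope q k) /
    (jostW q k * jostW (rightPart q) k)

section splitting
variable {q : ℝ → ℝ} {k : ℝ}

lemma rightReflection_split (hq : Integrable q) (hk0 : k ≠ 0) :
    rightReflection q k = splitG q k + rightReflection (rightPart q) k := by
  have hk : 0 ≤ (k : ℂ).im := by simp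
  have hw := jostW_ne_zero_of_real hq hk0
  have hw' := jostW_ne_zero_of_real (integrable_rightPart hq) hk0
  rw [rightReflection_eq hq hk0, rightReflection_eq (integrable_rightPart hq) hk0, splitG,
    ← sub_eq_iff_eq_add, div_sub_div _ _ hw hw']
  congr 1
  obtain ⟨h1, h2⟩ := right_data_rightPart q k
  obtain ⟨h3, h4⟩ := left_data_rightPart hq hk
  have h := wronskian_right_conj hq hk0
  simp only [jostW, h1, h2, h3, h4]
  linear_combination (leftVal q k * -(Complex.I * k) - leftSlope q k) * h

lemma splitG_eq (hq : Integrable q) (hk0 : k ≠ 0) :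
    1 - leftReflection (rightPart q) k * rightReflection (leftPart q) k ≠ 0 ∧
    splitG q k = transmission (rightPart q) k ^ 2 * rightReflection (leftPart q) k
      / (1 - leftReflection (rightPart q) k * rightReflection (leftPart q) k) := by
  have hk : 0 ≤ (k : ℂ).im := by simp
  have hk0' : (k : ℂ) ≠ 0 := by exact_mod_cast hk0
  have hw := jostW_ne_zero_of_real hq hk0
  have hw1 := jostW_ne_zero_of_real (integrable_rightPart hq) hk0
  have hw2 := jostW_ne_zero_of_real (integrable_leftPart hq) hk0
  obtain ⟨h1, h2⟩ := right_data_rightPart q k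
  obtain ⟨h3, h4⟩ := left_data_rightPart hq hk
  obtain ⟨h5, h6⟩ := right_data_leftPart hq hk
  obtain ⟨h7, h8⟩ := left_data_leftPart q k
  have key : 1 - leftReflection (rightPart q) k * rightReflection (leftPart q) k =
      -(2 * Complex.I * k) * jostW q k / (jostW (rightPart q) k * jostW (leftPart q) k) := by
    rw [leftReflection_eq (integrable_rightPart hq) hk0,
      rightReflection_eq (integrable_leftPart hq) hk0, eq_div_iff (mul_ne_zero hw1 hw2),
      sub_mul, one_mul]
    have : ∀ a b c d : ℂ, c ≠ 0 → d ≠ 0 → a / c * (b / d) * (c * d) = a * b := fun a b c d hc hd ↦ by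
      field_simp
    rw [this _ _ _ _ hw1 hw2]
    simp only [jostW, h1, h2, h3, h4, h5, h6, h7, h8, map_neg, map_mul, map_one, Complex.conj_I,
      Complex.conj_ofReal]
    ring
  refine ⟨?_, ?_⟩
  · rw [key]
    refine div_ne_zero (mul_ne_zero ?_ hw) (mul_ne_zero hw1 hw2)
    simp [hk0']
  · rw [key, transmission_eq (integrable_rightPart hq) hk0,
      rightReflection_eq (integrable_leftPart hq) hk0, splitG, h5, h6, h7, h8]
    simp only [map_one, map_mul, Complex.conj_I, Complex.conj_ofReal]
    field_simp
    ring

lemma norm_splitG_le (hq : Integrable q) (k : ℝ) : ‖splitG q k‖ ≤ 2 := by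
  rcases eq_or_ne k 0 with rfl | hk0
  · simp [splitG]
  · have h1 := norm_rightReflection_le_one hq hk0
    have h2 := norm_rightReflection_le_one (integrable_rightPart hq) hk0
    rw [eq_sub_of_add_eq (rightReflection_split hq hk0).symm]
    exact (norm_sub_le _ _).trans (by linarith)

lemma continuousWithinAt_splitG (hq : Integrable q) (hk0 : k ≠ 0) :
    ContinuousWithinAt (splitG q) {z : ℂ | 0 ≤ z.im} k := by
  have hk : 0 ≤ (k : ℂ).im := by simp
  have hk0' : (k : ℂ) ≠ 0 := by exact_mod_cast hk0
  have hrv : ∀ {q}, Integrable q → ContinuousWithinAt (rightVal q) {z : ℂ | 0 ≤ z.im} k :=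
    fun h ↦ continuousWithinAt_jostSol h hk hk0' 0
  have hrs : ∀ {q}, Integrable q → ContinuousWithinAt (rightSlope q) {z : ℂ | 0 ≤ z.im} k :=
    fun h ↦ continuousWithinAt_jostSolDeriv h hk hk0' 0
  have hlv : ∀ {q}, Integrable q → ContinuousWithinAt (leftVal q) {z : ℂ | 0 ≤ z.im} k :=
    fun h ↦ continuousWithinAt_jostSol (integrable_reflect h) hk hk0' 0
  have hls : ∀ {q}, Integrable q → ContinuousWithinAt (leftSlope q) {z : ℂ | 0 ≤ z.im} k :=
    fun h ↦ (continuousWithinAt_jostSolDeriv (integrable_reflect h) hk hk0' 0).neg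
  have hW : ∀ {q}, Integrable q → ContinuousWithinAt (jostW q) {z : ℂ | 0 ≤ z.im} k :=
    fun h ↦ ((hrv h).mul (hls h)).sub ((hrs h).mul (hlv h))
  refine ContinuousWithinAt.div (ContinuousWithinAt.mul (by fun_prop)
    (((hlv hq).mul (by fun_prop)).sub (hls hq)))
    ((hW hq).mul (hW (integrable_rightPart hq)))
    (mul_ne_zero (jostW_ne_zero_of_real hq hk0)
      (jostW_ne_zero_of_real (integrable_rightPart hq) hk0))

end splitting

/-! ### Bound states are the zeros of the Jost function -/

section decay
variable {q : ℝ → ℝ} {k : ℂ}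

lemma norm_jostSol_le (hq : Integrable q) (hk : 0 ≤ k.im) (x : ℝ) :
    ‖jostSol q k x‖ ≤ Real.exp (-(k.im * x)) * jostBound q k := by
  rw [jostSol, norm_mul, norm_exp_I_mul]
  gcongr
  exact norm_jostM_le hq hk x

lemma norm_jostSolDeriv_le (hq : Integrable q) (hk : 0 ≤ k.im) (x : ℝ) :
    ‖jostSolDeriv q k x‖ ≤
      Real.exp (-(k.im * x)) * (jostBound q k * (‖k‖ + ∫ t, |q t|)) := by
  rw [jostSolDeriv, norm_mul, norm_exp_I_mul]
  gcongr
  have h0 : 0 ≤ jostBound q k := (Real.exp_pos _).le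
  calc _ ≤ ‖Complex.I * k * jostM q k x‖ + ‖jostD q k x‖ := norm_add_le _ _
    _ ≤ ‖k‖ * jostBound q k + jostBound q k * ∫ t, |q t| := by
      gcongr
      · rw [norm_mul, norm_mul, Complex.norm_I, one_mul]
        gcongr
        exact norm_jostM_le hq hk x
      · refine (norm_jostD_le hq hk x).trans ?_
        gcongr
        exact tail_le_integral hq.abs (fun _ ↦ abs_nonneg _) x
    _ = _ := by ring

lemma tendsto_exp_neg_mul_atTop {a : ℝ} (ha : 0 < a) :
    Tendsto (fun x : ℝ ↦ Real.exp (-(a * x))) atTop (𝓝 0) :=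
  Real.tendsto_exp_neg_atTop_nhds_zero.comp (tendsto_id.const_mul_atTop ha)

lemma tendsto_jostSol_zero (hq : Integrable q) (hk : 0 < k.im) :
    Tendsto (jostSol q k) atTop (𝓝 0) := by
  rw [tendsto_zero_iff_norm_tendsto_zero]
  refine squeeze_zero (fun _ ↦ norm_nonneg _) (norm_jostSol_le hq hk.le) ?_
  simpa using (tendsto_exp_neg_mul_atTop hk).mul_const (jostBound q k)

lemma tendsto_jostSolDeriv_zero (hq : Integrable q) (hk : 0 < k.im) :
    Tendsto (jostSolDeriv q k) atTop (𝓝 0) := by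
  rw [tendsto_zero_iff_norm_tendsto_zero]
  refine squeeze_zero (fun _ ↦ norm_nonneg _) (norm_jostSolDeriv_le hq hk.le) ?_
  simpa using (tendsto_exp_neg_mul_atTop hk).mul_const (jostBound q k * (‖k‖ + ∫ t, |q t|))

lemma ne_zero_of_im_pos (hk : 0 < k.im) : k ≠ 0 := by
  rintro rfl; simp at hk

lemma continuous_jostSol (hq : Integrable q) (hk : 0 ≤ k.im) : Continuous (jostSol q k) := by
  have := continuous_jostM hq hk
  unfold jostSol
  fun_prop

lemma integrableOn_sq_norm_jostSol (hq : Integrable q) (hk : 0 < k.im) :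
    IntegrableOn (fun x ↦ ‖jostSol q k x‖ ^ 2) (Ioi 0) := by
  have hi : IntegrableOn (fun x ↦ jostBound q k ^ 2 * Real.exp (-(2 * k.im) * x)) (Ioi 0) :=
    (integrableOn_exp_mul_Ioi (by linarith) 0).const_mul _
  refine Integrable.mono' hi
    ((continuous_jostSol hq hk.le).norm.pow 2).aestronglyMeasurable (Eventually.of_forall fun x ↦ ?_)
  rw [Real.norm_of_nonneg (by positivity)]
  calc _ ≤ (Real.exp (-(k.im * x)) * jostBound q k) ^ 2 := by
        gcongr; exact norm_jostSol_le hq hk.le x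
    _ = _ := by rw [mul_pow, ← Real.exp_nat_mul]; push_cast; ring_nf

/-- Lagrange's identity on `(0, ∞)` for decaying solutions. -/
lemma wronskian_zero_eq_integral (hq : LocallyIntegrable q) {E E' : ℂ} {u v : ℝ → ℂ}
    (hu : SolvesSchrodinger q E u) (hv : SolvesSchrodinger q E' v)
    (hw : Tendsto (wronskian u v) atTop (𝓝 0)) (hi : IntegrableOn (fun x ↦ u x * v x) (Ioi 0)) :
    wronskian u v 0 = -((E - E') * ∫ x in Ioi 0, u x * v x) := by
  have h1 := intervalIntegral_tendsto_integral_Ioi 0 (hi.const_mul (E - E')) tendsto_id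
  have h2 := (hw.sub_const (wronskian u v 0)).congr
    fun x ↦ (isPrimitive_wronskian hq hu hv).sub_eq 0 x
  have h3 := tendsto_nhds_unique h2 h1
  rw [integral_const_mul] at h3
  rw [← h3]
  ring

lemma integrableOn_jostSol_mul {l : ℂ} (hq : Integrable q) (hk : 0 < k.im) (hl : 0 < l.im) :
    IntegrableOn (fun x ↦ jostSol q k x * jostSol q l x) (Ioi 0) := by
  refine Integrable.mono' ((integrableOn_sq_norm_jostSol hq hk).add
    (integrableOn_sq_norm_jostSol hq hl))
    ((continuous_jostSol hq hk.le).mul (continuous_jostSol hq hl.le)).aestronglyMeasurable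
    (Eventually.of_forall fun x ↦ ?_)
  rw [norm_mul]
  simp only [Pi.add_apply]
  nlinarith [sq_nonneg (‖jostSol q k x‖ - ‖jostSol q l x‖), sq_nonneg ‖jostSol q k x‖,
    sq_nonneg ‖jostSol q l x‖]

lemma lagrange_right {l : ℂ} (hq : Integrable q) (hk : 0 < k.im) (hl : 0 < l.im) :
    rightVal q k * rightSlope q l - rightSlope q k * rightVal q l =
      -((k ^ 2 - l ^ 2) * ∫ x in Ioi 0, jostSol q k x * jostSol q l x) := by
  have hk0 := ne_zero_of_im_pos hk
  have hl0 := ne_zero_of_im_pos hl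
  have hw : ∀ x, wronskian (jostSol q k) (jostSol q l) x =
      jostSol q k x * jostSolDeriv q l x - jostSolDeriv q k x * jostSol q l x := fun x ↦ by
    rw [wronskian, deriv_jostSol hq hk.le hk0, deriv_jostSol hq hl.le hl0]
  have hlim : Tendsto (wronskian (jostSol q k) (jostSol q l)) atTop (𝓝 0) := by
    refine Tendsto.congr (fun x ↦ (hw x).symm) ?_
    simpa using ((tendsto_jostSol_zero hq hk).mul (tendsto_jostSolDeriv_zero hq hl)).sub
      ((tendsto_jostSolDeriv_zero hq hk).mul (tendsto_jostSol_zero hq hl))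
  have h := wronskian_zero_eq_integral hq.locallyIntegrable (solves_jostSol hq hk.le hk0)
    (solves_jostSol hq hl.le hl0) hlim (integrableOn_jostSol_mul hq hk hl)
  rw [← h, hw]
  rfl

open scoped ComplexConjugate in
lemma lagrange_right_conj (hq : Integrable q) (hk : 0 < k.im) :
    rightVal q k * conj (rightSlope q k) - rightSlope q k * conj (rightVal q k) =
      -((k ^ 2 - (conj k) ^ 2) * (∫ x in Ioi 0, ‖jostSol q k x‖ ^ 2 : ℝ)) := by
  have hk0 := ne_zero_of_im_pos hk
  have hs := solves_jostSol hq hk.le hk0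
  have hw : ∀ x, wronskian (jostSol q k) (fun x ↦ conj (jostSol q k x)) x =
      jostSol q k x * conj (jostSolDeriv q k x) - jostSolDeriv q k x * conj (jostSol q k x) :=
    fun x ↦ by
      rw [wronskian, (hasDerivAt_conj (solves_hasDerivAt hs x)).deriv, deriv_jostSol hq hk.le hk0]
  have hcc : ∀ {f : ℝ → ℂ}, Tendsto f atTop (𝓝 0) → Tendsto (fun x ↦ conj (f x)) atTop (𝓝 0) :=
    fun h ↦ (Complex.continuous_conj.tendsto' 0 0 (map_zero _)).comp h
  have hsq : ∀ x, jostSol q k x * conj (jostSol q k x) = ((‖jostSol q k x‖ ^ 2 : ℝ) : ℂ) :=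
    fun x ↦ by rw [Complex.mul_conj, Complex.normSq_eq_norm_sq]
  have h := wronskian_zero_eq_integral hq.locallyIntegrable hs (solves_conj hq.locallyIntegrable hs)
    ?_ ?_
  · rw [hw] at h
    simp only [hsq, integral_complex_ofReal, map_pow] at h
    exact h
  · refine Tendsto.congr (fun x ↦ (hw x).symm) ?_
    simpa using ((tendsto_jostSol_zero hq hk).mul (hcc (tendsto_jostSolDeriv_zero hq hk))).sub
      ((tendsto_jostSolDeriv_zero hq hk).mul (hcc (tendsto_jostSol_zero hq hk)))
  · simp_rw [hsq]
    exact (integrableOn_sq_norm_jostSol hq hk).ofReal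

lemma jostSol_ne_zero (hq : Integrable q) (hk : 0 ≤ k.im) (hk0 : k ≠ 0) : jostSol q k ≠ 0 := by
  intro h
  have h1 := (isRightJost_jostSol hq hk hk0).asymp
  rw [h] at h1
  simpa using tendsto_nhds_unique h1 (by simp : Tendsto _ _ (𝓝 (0 : ℂ)))

/-- The Jost solution does not vanish identically on `(0, ∞)`, because of its asymptotics. -/
lemma integral_sq_norm_jostSol_pos (hq : Integrable q) (hk : 0 < k.im) :
    0 < ∫ x in Ioi 0, ‖jostSol q k x‖ ^ 2 := by
  refine lt_of_le_of_ne (integral_nonneg fun _ ↦ by positivity) fun h0 ↦ ?_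
  have h1 := (integral_eq_zero_iff_of_nonneg (fun _ ↦ by positivity)
    (integrableOn_sq_norm_jostSol hq hk)).1 h0.symm
  have hc := (continuous_jostSol hq hk.le).norm.pow 2
  have h2 : EqOn (fun x ↦ ‖jostSol q k x‖ ^ 2) 0 (Ioi 0) :=
    Measure.eqOn_open_of_ae_eq h1 isOpen_Ioi hc.continuousOn continuousOn_const
  have h3 := (isRightJost_jostSol hq hk.le (ne_zero_of_im_pos hk)).asymp
  have h4 : Tendsto (fun x : ℝ ↦ Complex.exp (-(Complex.I * k * x)) * jostSol q k x) atTop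
      (𝓝 0) := by
    refine tendsto_const_nhds.congr' ?_
    filter_upwards [eventually_gt_atTop 0] with x hx
    have : jostSol q k x = 0 := by simpa using h2 hx
    rw [this, mul_zero]
  simpa using tendsto_nhds_unique h3 h4

end decay

section bound
variable {q : ℝ → ℝ} {k : ℂ}

/-- At a zero of the Jost function the left Jost solution is a multiple of the right one. -/
lemma exists_leftJost_eq_mul (hq : Integrable q) (hk : 0 < k.im) (hW : jostW q k = 0) :
    ∃ β : ℂ, β ≠ 0 ∧ (∀ x, jostSol (reflect q) k x = β * jostSol q k (-x)) ∧
      leftVal q k = β * rightVal q k ∧ leftSlope q k = β * rightSlope q k := by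
  have hk0 := ne_zero_of_im_pos hk
  have hs := solves_jostSol hq hk.le hk0
  have hs' := solves_reflect (solves_jostSol (integrable_reflect hq) hk.le hk0)
  rw [reflect_reflect] at hs'
  have hw : wronskian (fun x ↦ jostSol (reflect q) k (-x)) (jostSol q k) 0 = 0 := by
    rw [wronskian, deriv_comp_neg, deriv_jostSol hq hk.le hk0,
      deriv_jostSol (integrable_reflect hq) hk.le hk0]
    rw [jostW, rightVal, leftVal, rightSlope, leftSlope] at hW
    simp only [neg_zero]
    linear_combination -hW
  obtain ⟨β, hβ⟩ := exists_eq_mul_of_wronskian_eq_zero hq.locallyIntegrable hs' hs hw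
    (jostSol_ne_zero hq hk.le hk0)
  have h1 : ∀ x, jostSol (reflect q) k x = β * jostSol q k (-x) := fun x ↦ by
    simpa using congrFun hβ (-x)
  refine ⟨β, ?_, h1, by simpa [leftVal, rightVal] using h1 0, ?_⟩
  · rintro rfl
    exact jostSol_ne_zero (integrable_reflect hq) hk.le hk0 (funext fun x ↦ by simp [h1])
  · have h2 := congrArg (fun f ↦ deriv f 0) hβ
    rw [deriv_comp_neg, ((solves_hasDerivAt hs 0).const_mul β).deriv,
      deriv_jostSol hq hk.le hk0, deriv_jostSol (integrable_reflect hq) hk.le hk0] at h2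
    simpa [leftSlope, rightSlope] using h2

lemma integrable_sq_norm_jostSol (hq : Integrable q) (hk : 0 < k.im) (hW : jostW q k = 0) :
    Integrable fun x ↦ ‖jostSol q k x‖ ^ 2 := by
  obtain ⟨β, hβ0, hβ, -, -⟩ := exists_leftJost_eq_mul hq hk hW
  have h1 := (integrableOn_sq_norm_jostSol (integrable_reflect hq) hk).const_mul (‖β‖ ^ 2)⁻¹
  have h2 : IntegrableOn (fun x ↦ ‖jostSol q k (-x)‖ ^ 2) (Ioi 0) := by
    refine h1.congr (Eventually.of_forall fun x ↦ ?_)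
    have : ‖β‖ ≠ 0 := norm_ne_zero_iff.2 hβ0
    simp only [hβ, norm_mul, mul_pow]
    field_simp
  have h3 : IntegrableOn (fun x ↦ ‖jostSol q k x‖ ^ 2) (Iio 0) := by
    have := IntegrableOn.comp_neg_Iio (c := 0) (f := fun x ↦ ‖jostSol q k (-x)‖ ^ 2) (by simpa using h2)
    simpa using this
  rw [← integrableOn_univ, ← Iic_union_Ioi (a := (0 : ℝ))]
  exact ((integrableOn_Iic_iff_integrableOn_Iio (by finiteness)).2 h3).union (integrableOn_sq_norm_jostSol hq hk)

open scoped ComplexConjugate in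
/-- Self-adjointness: zeros of the Jost function in the open upper half plane lie on the imaginary
axis. -/
lemma re_eq_zero_of_jostW_eq_zero (hq : Integrable q) (hk : 0 < k.im) (hW : jostW q k = 0) :
    k.re = 0 := by
  obtain ⟨β, hβ0, -, h0, h1⟩ := exists_leftJost_eq_mul hq hk hW
  have hr := lagrange_right_conj hq hk
  have hl := lagrange_right_conj (integrable_reflect hq) hk
  have hp1 := integral_sq_norm_jostSol_pos hq hk
  have hp2 := integral_sq_norm_jostSol_pos (integrable_reflect hq) hk
  set A := ∫ x in Ioi 0, ‖jostSol q k x‖ ^ 2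
  set B := ∫ x in Ioi 0, ‖jostSol (reflect q) k x‖ ^ 2
  have hv : rightVal (reflect q) k = β * rightVal q k := h0
  have hs : rightSlope (reflect q) k = -(β * rightSlope q k) := by
    rw [← h1, leftSlope, neg_neg]; rfl
  rw [hv, hs] at hl
  simp only [map_neg, map_mul] at hl
  have hsum : (k ^ 2 - (conj k) ^ 2) * ((‖β‖ ^ 2 * A + B : ℝ) : ℂ) = 0 := by
    have hb : β * conj β = ((‖β‖ ^ 2 : ℝ) : ℂ) := by
      rw [Complex.mul_conj, Complex.normSq_eq_norm_sq]
    push_cast at hb ⊢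
    linear_combination (β * conj β) * hr + hl - (k ^ 2 - (conj k) ^ 2) * A * hb
  have hpos : ‖β‖ ^ 2 * A + B ≠ 0 := by positivity
  have h2 := (mul_eq_zero.1 hsum).resolve_right (by exact_mod_cast hpos)
  have h3 := congrArg Complex.im h2
  simp [pow_two] at h3
  have : k.re * k.im = 0 := by linarith
  exact (mul_eq_zero.1 this).resolve_right hk.ne'

lemma isBoundState_of_jostW_eq_zero (hq : Integrable q) {κ : ℝ} (hκ : 0 < κ)
    (hW : jostW q (Complex.I * κ) = 0) : IsBoundState q κ := by
  have hk : 0 < (Complex.I * κ).im := by simpa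
  have hk0 := ne_zero_of_im_pos hk
  refine ⟨hκ, jostSol q (Complex.I * κ), jostSol_ne_zero hq hk.le hk0, ?_, ?_⟩
  · have := solves_jostSol hq hk.le hk0
    rwa [mul_pow, Complex.I_sq, neg_one_mul] at this
  · rw [memLp_two_iff_integrable_sq_norm (continuous_jostSol hq hk.le).aestronglyMeasurable]
    exact integrable_sq_norm_jostSol hq hk hW

/-- The Wronskian of a square integrable solution with the decaying Jost solution vanishes. It is
constant; averaging it over `[y, y + 1]` against the bump `(x - y)(y + 1 - x)` and integrating by
parts removes the derivative of the square integrable solution, and the result tends to `0`. -/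
lemma wronskian_eq_zero_of_memLp (hq : Integrable q) (hk : 0 < k.im) {u : ℝ → ℂ}
    (hu : SolvesSchrodinger q (k ^ 2) u) (hu2 : MemLp u 2 volume) :
    wronskian u (jostSol q k) 0 = 0 := by
  have hk0 := ne_zero_of_im_pos hk
  have hloc := hq.locallyIntegrable
  have hs := solves_jostSol hq hk.le hk0
  have huc : Continuous u := hu.differentiable.continuous
  have hψc := continuous_jostSol hq hk.le
  have hψ'c : Continuous (jostSolDeriv q k) := by
    rw [← deriv_jostSol hq hk.le hk0]; exact continuous_deriv_solution hloc hs
  set c := wronskian u (jostSol q k) 0 with hc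
  have hu2' := (memLp_two_iff_integrable_sq_norm huc.aestronglyMeasurable).1 hu2
  set S := ∫ x, ‖u x‖ ^ 2
  set C := jostBound q k
  set C' := jostBound q k * (‖k‖ + ∫ t, |q t|)
  have hC0 : 0 ≤ C := (Real.exp_pos _).le
  have hC'0 : 0 ≤ C' := mul_nonneg hC0 (add_nonneg (norm_nonneg _)
    (integral_nonneg fun _ ↦ abs_nonneg _))
  have key : ∀ y : ℝ, c * (1 / 6) = ∫ x in y..(y + 1),
      u x * (2 * jostSolDeriv q k x * ((x - y) * (y + 1 - x)) +
        jostSol q k x * (2 * y + 1 - 2 * x)) := fun y ↦ by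
    have hφ : IsPrimitive (fun x : ℝ ↦ (2 * y + 1 - 2 * x : ℂ))
        (fun x : ℝ ↦ ((x - y) * (y + 1 - x) : ℂ)) := by
      refine IsPrimitive.of_hasDerivAt (fun x ↦ ?_) (by fun_prop)
      have h1 : HasDerivAt (fun x : ℝ ↦ (x : ℂ)) 1 x := Complex.ofRealCLM.hasDerivAt
      convert! (h1.sub_const (y : ℂ)).mul (h1.const_sub ((y : ℂ) + 1)) using 1
      ring
    have hint1 : ∫ x in y..(y + 1), ((x - y) * (y + 1 - x) : ℂ) = 1 / 6 := by
      have h1 := intervalIntegral.integral_comp_sub_right (a := y) (b := y + 1)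
        (fun t : ℝ ↦ ((t * (1 - t) : ℝ) : ℂ)) y
      have h2 : ∫ t in (0 : ℝ)..1, t * (1 - t) = 1 / 6 := by
        have : ∀ t : ℝ, t * (1 - t) = t - t ^ 2 := fun t ↦ by ring
        simp_rw [this]
        rw [intervalIntegral.integral_sub (by simp) (by simp), integral_id, integral_pow]
        norm_num
      have h3 : ∫ t in (0 : ℝ)..1, ((t * (1 - t) : ℝ) : ℂ) = ((1 / 6 : ℝ) : ℂ) := by
        rw [intervalIntegral.integral_ofReal, h2]
      rw [sub_self, add_sub_cancel_left, h3] at h1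
      convert! h1 using 2
      · ext x
        push_cast
        ring
      · norm_num
    have hP := (((isPrimitive_solution hloc hu).mul (isPrimitive_solution hloc hs)).mul
      hφ).sub_eq y (y + 1)
    simp only [deriv_jostSol hq hk.le hk0] at hP
    have hW : ∀ x, deriv u x * jostSol q k x = u x * jostSolDeriv q k x - c := fun x ↦ by
      rw [hc, wronskian_eq hloc hu hs 0 x, wronskian, deriv_jostSol hq hk.le hk0]
      ring
    have hsum : ∀ x : ℝ, (deriv u x * jostSol q k x + u x * jostSolDeriv q k x) *
        ((x - y) * (y + 1 - x)) + u x * jostSol q k x * (2 * y + 1 - 2 * x) =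
        u x * (2 * jostSolDeriv q k x * ((x - y) * (y + 1 - x)) +
        jostSol q k x * (2 * y + 1 - 2 * x)) - c * ((x - y) * (y + 1 - x)) := fun x ↦ by
      rw [hW]; ring
    simp_rw [hsum] at hP
    rw [intervalIntegral.integral_sub (Continuous.intervalIntegrable (by fun_prop) _ _)
      (Continuous.intervalIntegrable (by fun_prop) _ _),
      intervalIntegral.integral_const_mul, hint1] at hP
    push_cast at hP
    linear_combination hP
  have hbound : ∀ y : ℝ, ‖c * (1 / 6)‖ ≤
      Real.exp (-(k.im * y)) * ((2 * C' + C) * (1 + S)) := fun y ↦ by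
    have hmono : ‖c * (1 / 6)‖ ≤ ∫ x in y..(y + 1),
        Real.exp (-(k.im * y)) * (2 * C' + C) * (1 + ‖u x‖ ^ 2) := by
      rw [key y]
      refine intervalIntegral.norm_integral_le_of_norm_le (by linarith)
        (Eventually.of_forall fun x hx ↦ ?_) (Continuous.intervalIntegrable (by fun_prop) _ _)
      have hxy : y ≤ x := hx.1.le
      have he : Real.exp (-(k.im * x)) ≤ Real.exp (-(k.im * y)) :=
        Real.exp_le_exp.2 (neg_le_neg (mul_le_mul_of_nonneg_left hxy hk.le))
      have h1 : ‖jostSol q k x‖ ≤ Real.exp (-(k.im * y)) * C :=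
        (norm_jostSol_le hq hk.le x).trans (mul_le_mul_of_nonneg_right he hC0)
      have h2 : ‖jostSolDeriv q k x‖ ≤ Real.exp (-(k.im * y)) * C' :=
        (norm_jostSolDeriv_le hq hk.le x).trans (mul_le_mul_of_nonneg_right he hC'0)
      have h3 : ‖((x - y) * (y + 1 - x) : ℂ)‖ ≤ 1 := by
        have : ((x - y) * (y + 1 - x) : ℂ) = (((x - y) * (y + 1 - x) : ℝ) : ℂ) := by push_cast; ring
        rw [this, Complex.norm_real, Real.norm_eq_abs, abs_le]
        constructor <;> nlinarith [hx.1, hx.2]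
      have h4 : ‖(2 * y + 1 - 2 * x : ℂ)‖ ≤ 1 := by
        have : (2 * y + 1 - 2 * x : ℂ) = ((2 * y + 1 - 2 * x : ℝ) : ℂ) := by push_cast; ring
        rw [this, Complex.norm_real, Real.norm_eq_abs, abs_le]
        constructor <;> linarith [hx.1, hx.2]
      have h5 : ‖u x‖ ≤ 1 + ‖u x‖ ^ 2 := by nlinarith [sq_nonneg (‖u x‖ - 1)]
      calc _ ≤ ‖u x‖ * (2 * ‖jostSolDeriv q k x‖ * ‖((x - y) * (y + 1 - x) : ℂ)‖ +
            ‖jostSol q k x‖ * ‖(2 * y + 1 - 2 * x : ℂ)‖) := by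
            rw [norm_mul]
            gcongr
            refine (norm_add_le _ _).trans ?_
            simp
        _ ≤ (1 + ‖u x‖ ^ 2) * (2 * (Real.exp (-(k.im * y)) * C') * 1 +
            Real.exp (-(k.im * y)) * C * 1) := by gcongr
        _ = _ := by ring
    refine hmono.trans ?_
    rw [intervalIntegral.integral_const_mul, mul_assoc]
    gcongr
    rw [intervalIntegral.integral_add (by simp) (Continuous.intervalIntegrable (by fun_prop) _ _)]
    simp only [intervalIntegral.integral_const, add_sub_cancel_left, smul_eq_mul, mul_one]
    gcongr
    rw [intervalIntegral.integral_of_le (by linarith)]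
    exact setIntegral_le_integral hu2' (Eventually.of_forall fun _ ↦ by positivity)
  have hlim : Tendsto (fun y : ℝ ↦ Real.exp (-(k.im * y)) * ((2 * C' + C) * (1 + S))) atTop
      (𝓝 0) := by
    simpa using (tendsto_exp_neg_mul_atTop hk).mul_const ((2 * C' + C) * (1 + S))
  have h := ge_of_tendsto' hlim hbound
  have h2 : c * (1 / 6) = 0 := norm_le_zero_iff.1 h
  simpa using h2

lemma jostW_eq_zero_of_isBoundState (hq : Integrable q) {κ : ℝ} (h : IsBoundState q κ) :
    jostW q (Complex.I * κ) = 0 := by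
  obtain ⟨hκ, u, hu0, hu, hu2⟩ := h
  have hk : 0 < (Complex.I * κ).im := by simpa
  have hk0 := ne_zero_of_im_pos hk
  have hE : -(κ : ℂ) ^ 2 = (Complex.I * κ) ^ 2 := by rw [mul_pow, Complex.I_sq, neg_one_mul]
  rw [hE] at hu
  have h1 := wronskian_eq_zero_of_memLp hq hk hu hu2
  have h2 := wronskian_eq_zero_of_memLp (integrable_reflect hq) hk (solves_reflect hu)
    (hu2.comp_measurePreserving (Measure.measurePreserving_neg volume))
  have hs := solves_jostSol hq hk.le hk0
  have hs' := solves_jostSol (integrable_reflect hq) hk.le hk0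
  have hw1 : wronskian (jostSol q (Complex.I * κ)) u 0 = 0 := by
    rw [wronskian] at h1 ⊢
    linear_combination -h1
  have hw2 : wronskian (jostSol (reflect q) (Complex.I * κ)) (fun x ↦ u (-x)) 0 = 0 := by
    rw [wronskian] at h2 ⊢
    linear_combination -h2
  obtain ⟨c, hc⟩ := exists_eq_mul_of_wronskian_eq_zero hq.locallyIntegrable hs hu hw1 hu0
  obtain ⟨d, hd⟩ := exists_eq_mul_of_wronskian_eq_zero (integrable_reflect hq).locallyIntegrable
    hs' (solves_reflect hu) hw2 (fun h ↦ hu0 (funext fun x ↦ by simpa using congrFun h (-x)))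
  have e1 : rightSlope q (Complex.I * κ) = c * deriv u 0 := by
    rw [rightSlope, ← deriv_jostSol hq hk.le hk0, hc,
      ((solves_hasDerivAt hu 0).const_mul c).deriv]
  have e2 : leftSlope q (Complex.I * κ) = d * deriv u 0 := by
    rw [leftSlope, ← deriv_jostSol (integrable_reflect hq) hk.le hk0, hd,
      ((solves_hasDerivAt (solves_reflect hu) 0).const_mul d).deriv, deriv_comp_neg]
    simp
  have e3 : rightVal q (Complex.I * κ) = c * u 0 := congrFun hc 0
  have e4 : leftVal q (Complex.I * κ) = d * u 0 := by simpa [leftVal] using congrFun hd 0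
  rw [jostW, e1, e2, e3, e4]
  ring

/-- In the open upper half plane the Jost function vanishes exactly at the points `iκ`
with `κ` a bound state. -/
lemma jostW_eq_zero_iff (hq : Integrable q) (hk : 0 < k.im) :
    jostW q k = 0 ↔ ∃ κ : ℝ, IsBoundState q κ ∧ k = Complex.I * κ := by
  constructor
  · intro h
    have hre := re_eq_zero_of_jostW_eq_zero hq hk h
    have hk' : k = Complex.I * (k.im : ℝ) := by
      apply Complex.ext <;> simp [hre]
    exact ⟨k.im, isBoundState_of_jostW_eq_zero hq hk (by rwa [← hk']), hk'⟩
  · rintro ⟨κ, h, rfl⟩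
    exact jostW_eq_zero_of_isBoundState hq h

end bound

/-! ### Simple zeros of the Jost function and residues of `G` -/

section derivatives
variable {q : ℝ → ℝ} {l : ℂ}

lemma isOpen_upper : IsOpen {z : ℂ | 0 < z.im} := isOpen_lt continuous_const Complex.continuous_im

lemma eventually_upper (hl : 0 < l.im) : ∀ᶠ z in 𝓝 l, 0 < z.im := isOpen_upper.mem_nhds hl

lemma differentiableOn_leftSlope (hq : Integrable q) :
    DifferentiableOn ℂ (leftSlope q) {z | 0 < z.im} :=
  (differentiableOn_jostSolDeriv (integrable_reflect hq) 0).neg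

lemma differentiableOn_leftVal (hq : Integrable q) :
    DifferentiableOn ℂ (leftVal q) {z | 0 < z.im} :=
  differentiableOn_jostSol (integrable_reflect hq) 0

lemma differentiableOn_rightVal (hq : Integrable q) :
    DifferentiableOn ℂ (rightVal q) {z | 0 < z.im} := differentiableOn_jostSol hq 0

lemma differentiableOn_rightSlope (hq : Integrable q) :
    DifferentiableOn ℂ (rightSlope q) {z | 0 < z.im} := differentiableOn_jostSolDeriv hq 0

lemma differentiableOn_jostW (hq : Integrable q) :
    DifferentiableOn ℂ (jostW q) {z | 0 < z.im} :=
  ((differentiableOn_rightVal hq).mul (differentiableOn_leftSlope hq)).sub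
    ((differentiableOn_rightSlope hq).mul (differentiableOn_leftVal hq))

lemma hasDerivAt_of_upper {f : ℂ → ℂ} (h : DifferentiableOn ℂ f {z | 0 < z.im}) (hl : 0 < l.im) :
    HasDerivAt f (deriv f l) l :=
  (h.differentiableAt (isOpen_upper.mem_nhds hl)).hasDerivAt

/-- The overlap integral of two Jost solutions on `(0, ∞)` depends continuously on the momentum. -/
lemma tendsto_integral_jostSol_mul (hq : Integrable q) (hl : 0 < l.im) :
    Tendsto (fun k ↦ ∫ x in Ioi 0, jostSol q k x * jostSol q l x) (𝓝 l)
      (𝓝 (∫ x in Ioi 0, jostSol q l x * jostSol q l x)) := by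
  have hl' : 0 < ‖l‖ := norm_pos_iff.2 (ne_zero_of_im_pos hl)
  set δ := ‖l‖ / 2
  have hδ : 0 < δ := half_pos hl'
  have hmem : ∀ᶠ k in 𝓝 l, k ∈ openDomain δ :=
    (isOpen_openDomain δ).mem_nhds ⟨hl, half_lt_self hl'⟩
  have hb : Integrable (fun x ↦ (uniformJostBound q δ * jostBound q l) *
      Real.exp (-l.im * x)) (volume.restrict (Ioi 0)) :=
    (integrableOn_exp_mul_Ioi (by linarith) 0).const_mul _
  refine tendsto_integral_filter_of_dominated_convergence _ ?_ ?_ hb ?_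
  · filter_upwards [hmem] with k hk
    exact ((continuous_jostSol hq hk.1.le).mul (continuous_jostSol hq hl.le)).aestronglyMeasurable
  · filter_upwards [hmem] with k hk
    filter_upwards [ae_restrict_mem measurableSet_Ioi] with x hx
    have h1 : ‖jostSol q k x‖ ≤ 1 * uniformJostBound q δ := by
      rw [jostSol, norm_mul, norm_exp_I_mul]
      gcongr
      · rw [Real.exp_le_one_iff]
        have := mul_pos hk.1 hx
        linarith
      · exact norm_jostM_le_uniform hq hδ (openDomain_subset δ hk) x
    have h2 : 0 ≤ uniformJostBound q δ := (Real.exp_pos _).le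
    rw [norm_mul]
    calc _ ≤ (1 * uniformJostBound q δ) * (Real.exp (-(l.im * x)) * jostBound q l) := by
          exact mul_le_mul h1 (norm_jostSol_le hq hl.le x) (norm_nonneg _) (by positivity)
      _ = _ := by ring_nf
  · refine Eventually.of_forall fun x ↦ ?_
    have h1 := (differentiableOn_jostSol hq x).continuousOn.continuousAt
      (isOpen_upper.mem_nhds hl)
    exact h1.tendsto.mul_const _

/-- The Wronskian of `ψ₊` with its momentum derivative. -/
lemma deriv_right_wronskian (hq : Integrable q) (hl : 0 < l.im) :
    deriv (rightVal q) l * rightSlope q l - deriv (rightSlope q) l * rightVal q l =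
      -(2 * l * ∫ x in Ioi 0, jostSol q l x * jostSol q l x) := by
  have h1 := ((hasDerivAt_of_upper (differentiableOn_rightVal hq) hl).mul_const
    (rightSlope q l)).sub ((hasDerivAt_of_upper (differentiableOn_rightSlope hq) hl).mul_const
    (rightVal q l))
  have h2 := hasDerivAt_iff_tendsto_slope.1 h1
  have h3 : Tendsto (fun k ↦ -((k + l) * ∫ x in Ioi 0, jostSol q k x * jostSol q l x)) (𝓝[≠] l)
      (𝓝 (-((l + l) * ∫ x in Ioi 0, jostSol q l x * jostSol q l x))) := by
    refine (Tendsto.mul ?_ (tendsto_integral_jostSol_mul hq hl)).neg.mono_left nhdsWithin_le_nhds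
    exact (continuous_id.add continuous_const).tendsto l
  have h4 := tendsto_nhds_unique h2 (h3.congr' ?_)
  · rw [h4]; ring
  · filter_upwards [self_mem_nhdsWithin, nhdsWithin_le_nhds (eventually_upper hl)] with k hk hk'
    have hkl : k - l ≠ 0 := sub_ne_zero.2 hk
    rw [slope_def_field, eq_div_iff hkl]
    have := lagrange_right hq hk' hl
    simp only [Pi.sub_apply]
    linear_combination -this

lemma deriv_left_wronskian (hq : Integrable q) (hl : 0 < l.im) :
    deriv (leftVal q) l * leftSlope q l - deriv (leftSlope q) l * leftVal q l =
      2 * l * ∫ x in Ioi 0, jostSol (reflect q) l x * jostSol (reflect q) l x := by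
  have h := deriv_right_wronskian (integrable_reflect hq) hl
  have h1 : leftVal q = rightVal (reflect q) := rfl
  have h2 : leftSlope q = fun k ↦ -rightSlope (reflect q) k := rfl
  rw [h1, h2, deriv.fun_neg]
  linear_combination -h

/-- The total mass `∫ ψ₊(x, l)² dx` over the line. -/
noncomputable def mass (q : ℝ → ℝ) (l : ℂ) : ℂ := ∫ x, jostSol q l x * jostSol q l x

lemma mass_eq (hq : Integrable q) (hl : 0 < l.im) (hW : jostW q l = 0) {β : ℂ} (hβ0 : β ≠ 0)
    (hβ : ∀ x, jostSol (reflect q) l x = β * jostSol q l (-x)) :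
    mass q l = (∫ x in Ioi 0, jostSol q l x * jostSol q l x) +
      (∫ x in Ioi 0, jostSol (reflect q) l x * jostSol (reflect q) l x) / β ^ 2 := by
  have hc := continuous_jostSol hq hl.le
  have hi : Integrable fun x ↦ jostSol q l x * jostSol q l x := by
    refine (integrable_sq_norm_jostSol hq hl hW).mono' (hc.mul hc).aestronglyMeasurable
      (Eventually.of_forall fun x ↦ ?_)
    rw [norm_mul, pow_two]
  have h1 : ∫ x in Ioi 0, jostSol (reflect q) l x * jostSol (reflect q) l x =
      β ^ 2 * ∫ x in Iic 0, jostSol q l x * jostSol q l x := by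
    have h := integral_comp_neg_Iic (0 : ℝ)
      (fun x ↦ jostSol (reflect q) l x * jostSol (reflect q) l x)
    rw [neg_zero] at h
    rw [← h, ← integral_const_mul]
    congr 1
    ext x
    simp only [hβ, neg_neg]
    ring
  have h2 := integral_add_compl (measurableSet_Ioi (a := (0 : ℝ))) hi
  rw [compl_Ioi] at h2
  rw [h1, mass, ← h2]
  field_simp

/-- At a bound state the Jost function has derivative `-2lβ ∫ ψ₊²`, where `ψ₋ = β ψ₊`. -/
lemma deriv_jostW (hq : Integrable q) (hl : 0 < l.im) (hW : jostW q l = 0) {β : ℂ} (hβ0 : β ≠ 0)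
    (hβ : ∀ x, jostSol (reflect q) l x = β * jostSol q l (-x))
    (h0 : leftVal q l = β * rightVal q l) (h1 : leftSlope q l = β * rightSlope q l) :
    deriv (jostW q) l = -(2 * l * β * mass q l) := by
  have hd := ((hasDerivAt_of_upper (differentiableOn_rightVal hq) hl).mul
    (hasDerivAt_of_upper (differentiableOn_leftSlope hq) hl)).sub
    ((hasDerivAt_of_upper (differentiableOn_rightSlope hq) hl).mul
    (hasDerivAt_of_upper (differentiableOn_leftVal hq) hl))
  have hr := deriv_right_wronskian hq hl
  have hl' := deriv_left_wronskian hq hl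
  rw [mass_eq hq hl hW hβ0 hβ]
  have : deriv (jostW q) l = _ := hd.deriv
  rw [this]
  refine mul_right_cancel₀ hβ0 ?_
  set A := ∫ x in Ioi 0, jostSol q l x * jostSol q l x
  set B := ∫ x in Ioi 0, jostSol (reflect q) l x * jostSol (reflect q) l x
  have hB : B / β ^ 2 * β ^ 2 = B := by field_simp
  rw [h0, h1] at hl' ⊢
  linear_combination β ^ 2 * hr - hl' + 2 * l * hB

end derivatives

section norming
variable {q : ℝ → ℝ} {κ : ℝ}

open scoped ComplexConjugate

/-- The Jost solution at `iκ` is real. -/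
lemma conj_jostSol (hq : Integrable q) (hκ : 0 < κ) (x : ℝ) :
    conj (jostSol q (Complex.I * κ) x) = jostSol q (Complex.I * κ) x := by
  have hk : 0 < (Complex.I * κ).im := by simpa
  have hk0 := ne_zero_of_im_pos hk
  have hJ := isRightJost_jostSol hq hk.le hk0
  have hIk : Complex.I * (Complex.I * κ) = ((-κ : ℝ) : ℂ) := by
    rw [← mul_assoc, Complex.I_mul_I]; simp
  have hE : ∀ x : ℝ, Complex.exp (-(Complex.I * (Complex.I * κ) * x)) =
      conj (Complex.exp (-(Complex.I * (Complex.I * κ) * x))) := fun x ↦ by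
    rw [← Complex.exp_conj, map_neg, map_mul, hIk, Complex.conj_ofReal, Complex.conj_ofReal]
  have hcc : ∀ {f : ℝ → ℂ} {a : ℂ}, Tendsto f atTop (𝓝 a) →
      Tendsto (fun x ↦ conj (f x)) atTop (𝓝 (conj a)) :=
    fun h ↦ (Complex.continuous_conj.tendsto _).comp h
  have hd : ∀ x, deriv (fun x ↦ conj (jostSol q (Complex.I * κ) x)) x =
      conj (deriv (jostSol q (Complex.I * κ)) x) :=
    fun x ↦ (hasDerivAt_conj (solves_hasDerivAt hJ.solves x)).deriv
  suffices h : IsRightJost q (Complex.I * κ) (fun x ↦ conj (jostSol q (Complex.I * κ) x)) from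
    congrFun (isRightJost_unique hq hk.le h hJ) x
  refine ⟨?_, ?_, ?_⟩
  · have := solves_conj hq.locallyIntegrable hJ.solves
    rwa [show conj ((Complex.I * κ) ^ 2) = (Complex.I * κ) ^ 2 by simp [mul_pow]] at this
  · have := hcc hJ.asymp
    rw [map_one] at this
    exact this.congr fun x ↦ by rw [map_mul, ← hE]
  · have := hcc hJ.asymp_deriv
    rw [hIk, Complex.conj_ofReal, ← hIk] at this
    exact this.congr fun x ↦ by rw [map_mul, ← hE, hd]

lemma mass_eq_ofReal (hq : Integrable q) (hκ : 0 < κ) :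
    mass q (Complex.I * κ) = (∫ x, ‖jostSol q (Complex.I * κ) x‖ ^ 2 : ℝ) := by
  rw [mass, ← integral_complex_ofReal]
  congr 1
  ext x
  conv_lhs => rw [← conj_jostSol hq hκ x]
  rw [mul_comm, conj_jostSol hq hκ x]
  conv_lhs => enter [2]; rw [← conj_jostSol hq hκ x]
  rw [Complex.mul_conj, Complex.normSq_eq_norm_sq]

lemma normingConstant_sq (hq : Integrable q) (hκ : 0 < κ) :
    (normingConstant q κ : ℂ) ^ 2 = (mass q (Complex.I * κ))⁻¹ := by
  have hk : 0 < (Complex.I * κ).im := by simpa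
  rw [mass_eq_ofReal hq hκ, normingConstant, rightJost_eq hq hk.le (ne_zero_of_im_pos hk)]
  rw [← Complex.ofReal_pow, inv_pow, Real.sq_sqrt (integral_nonneg fun _ ↦ by positivity),
    Complex.ofReal_inv]

lemma mass_ne_zero (hq : Integrable q) (h : IsBoundState q κ) : mass q (Complex.I * κ) ≠ 0 := by
  have hκ := h.1
  have hk : 0 < (Complex.I * κ).im := by simpa
  have h1 := integral_sq_norm_jostSol_pos hq hk
  have h2 := setIntegral_le_integral (s := Ioi 0)
    (integrable_sq_norm_jostSol hq hk (jostW_eq_zero_of_isBoundState hq h))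
    (Eventually.of_forall fun _ ↦ by positivity)
  rw [mass_eq_ofReal hq hκ]
  exact_mod_cast (h1.trans_le h2).ne'

end norming

section poles
variable {q : ℝ → ℝ} {κ : ℝ}

/-- The numerator of `G`. -/
noncomputable def splitNum (q : ℝ → ℝ) (k : ℂ) : ℂ :=
  -(2 * Complex.I * k) * (leftVal q k * -(Complex.I * k) - leftSlope q k)

lemma splitG_eq_div (q : ℝ → ℝ) :
    splitG q = fun k ↦ splitNum q k / (jostW q k * jostW (rightPart q) k) := rfl

lemma differentiableOn_splitNum (hq : Integrable q) :
    DifferentiableOn ℂ (splitNum q) {z | 0 < z.im} :=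
  DifferentiableOn.mul (by fun_prop) (((differentiableOn_leftVal hq).mul (by fun_prop)).sub
    (differentiableOn_leftSlope hq))

lemma analyticAt_of_upper {f : ℂ → ℂ} (h : DifferentiableOn ℂ f {z | 0 < z.im}) {l : ℂ}
    (hl : 0 < l.im) : AnalyticAt ℂ f l :=
  h.analyticAt (isOpen_upper.mem_nhds hl)

lemma meromorphicAt_splitG (hq : Integrable q) {l : ℂ} (hl : 0 < l.im) :
    MeromorphicAt (splitG q) l :=
  (analyticAt_of_upper (differentiableOn_splitNum hq) hl).meromorphicAt.div
    ((analyticAt_of_upper (differentiableOn_jostW hq) hl).meromorphicAt.mul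
    (analyticAt_of_upper (differentiableOn_jostW (integrable_rightPart hq)) hl).meromorphicAt)

lemma analyticAt_splitG (hq : Integrable q) {l : ℂ} (hl : 0 < l.im)
    (h : ∀ κ : ℝ, IsBoundState q κ ∨ IsBoundState (rightPart q) κ → l ≠ Complex.I * κ) :
    AnalyticAt ℂ (splitG q) l := by
  refine (analyticAt_of_upper (differentiableOn_splitNum hq) hl).div
    ((analyticAt_of_upper (differentiableOn_jostW hq) hl).mul
    (analyticAt_of_upper (differentiableOn_jostW (integrable_rightPart hq)) hl))
    (mul_ne_zero (fun h0 ↦ ?_) (fun h0 ↦ ?_))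
  · obtain ⟨κ, hκ, hl'⟩ := (jostW_eq_zero_iff hq hl).1 h0
    exact h κ (Or.inl hκ) hl'
  · obtain ⟨κ, hκ, hl'⟩ := (jostW_eq_zero_iff (integrable_rightPart hq) hl).1 h0
    exact h κ (Or.inr hκ) hl'

/-- A residue that does not vanish belongs to a pole of order exactly one. -/
lemma hasSimplePole_of_ne_zero {F : ℂ → ℂ} {z₀ r : ℂ} (h : HasResidueSimple F z₀ r) (hr : r ≠ 0) :
    HasSimplePole F z₀ r := by
  refine ⟨?_, h⟩
  obtain ⟨hm, hlim⟩ := h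
  have hid : MeromorphicAt (fun z : ℂ ↦ z - z₀) z₀ := by fun_prop
  have h1 : meromorphicOrderAt (fun z : ℂ ↦ z - z₀) z₀ = 1 := by
    have : meromorphicOrderAt (fun z : ℂ ↦ z - z₀) z₀ = ((1 : ℤ) : WithTop ℤ) :=
      (meromorphicOrderAt_eq_int_iff hid).2 ⟨fun _ ↦ 1, analyticAt_const, one_ne_zero,
        Eventually.of_forall fun z ↦ by simp⟩
    exact this
  have h2 := (tendsto_ne_zero_iff_meromorphicOrderAt_eq_zero (hid.mul hm)).1 ⟨r, hr, hlim⟩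
  rw [meromorphicOrderAt_mul hid hm, h1] at h2
  cases h3 : meromorphicOrderAt F z₀ with
  | top => rw [h3] at h2; simp at h2
  | coe n =>
    rw [h3] at h2
    have h4 : (1 : ℤ) + n = 0 := by exact_mod_cast h2
    have : n = -1 := by omega
    rw [this]

lemma tendsto_slope_of_upper {f : ℂ → ℂ} (h : DifferentiableOn ℂ f {z | 0 < z.im}) {l : ℂ}
    (hl : 0 < l.im) (h0 : f l = 0) :
    Tendsto (fun z ↦ (z - l)⁻¹ * f z) (𝓝[≠] l) (𝓝 (deriv f l)) := by
  refine (hasDerivAt_iff_tendsto_slope.1 (hasDerivAt_of_upper h hl)).congr fun z ↦ ?_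
  rw [slope_def_module, h0, sub_zero, smul_eq_mul]

lemma tendsto_of_upper {f : ℂ → ℂ} (h : DifferentiableOn ℂ f {z | 0 < z.im}) {l : ℂ}
    (hl : 0 < l.im) : Tendsto f (𝓝[≠] l) (𝓝 (f l)) :=
  (hasDerivAt_of_upper h hl).continuousAt.tendsto.mono_left nhdsWithin_le_nhds

/-- At a bound state of `q` alone, `ψ₋ = β ψ₊`, so the numerator of `G` contains the nonvanishing
factor `β W(ψ₊, e^{-ikx})` of the denominator; the simple zero of `W(ψ₊, ψ₋)` remains. -/
lemma splitG_residue_left (hq : Integrable q) (h : IsBoundState q κ)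
    (h' : ¬ IsBoundState (rightPart q) κ) :
    HasSimplePole (splitG q) (Complex.I * κ) (Complex.I * (normingConstant q κ : ℂ) ^ 2) := by
  have hκ := h.1
  have hq' := integrable_rightPart hq
  set l := Complex.I * κ with hl_def
  have hl : 0 < l.im := by simpa [l]
  have hl0 := ne_zero_of_im_pos hl
  have hW := jostW_eq_zero_of_isBoundState hq h
  have hW' : jostW (rightPart q) l ≠ 0 := fun h0 ↦ h' (isBoundState_of_jostW_eq_zero hq' hκ h0)
  obtain ⟨β, hβ0, hβ, hv, hs⟩ := exists_leftJost_eq_mul hq hl hW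
  have hN : mass q l ≠ 0 := mass_ne_zero hq h
  have hd := deriv_jostW hq hl hW hβ0 hβ hv hs
  have hd0 : deriv (jostW q) l ≠ 0 := by
    rw [hd]; simp [hl0, hβ0, hN, l]
  obtain ⟨r1, r2⟩ := right_data_rightPart q l
  obtain ⟨l1, l2⟩ := left_data_rightPart hq hl.le
  rw [normingConstant_sq hq hκ]
  refine hasSimplePole_of_ne_zero ⟨meromorphicAt_splitG hq hl, ?_⟩
    (mul_ne_zero Complex.I_ne_zero (inv_ne_zero hN))
  have hlim := (tendsto_of_upper (differentiableOn_splitNum hq) hl).div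
    ((tendsto_slope_of_upper (differentiableOn_jostW hq) hl hW).mul
      (tendsto_of_upper (differentiableOn_jostW hq') hl)) (mul_ne_zero hd0 hW')
  have hval : splitNum q l / (deriv (jostW q) l * jostW (rightPart q) l) =
      Complex.I * (mass q l)⁻¹ := by
    have hnum : splitNum q l = -(2 * Complex.I * l) * (β * jostW (rightPart q) l) := by
      rw [splitNum, hv, hs, jostW, r1, r2, l1, l2]; ring
    rw [hnum, hd]
    field_simp
  rw [hval] at hlim
  refine hlim.congr fun z ↦ ?_
  simp only [splitG_eq_div, Pi.div_apply, div_eq_mul_inv, mul_inv, inv_inv]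
  ring

/-- At a bound state of the right part alone, `e^{-ikx} = γ ψ₊` in terms of Cauchy data at the
origin, so the numerator of `G` contains the nonvanishing factor `γ W(ψ₊, ψ₋)` of the
denominator; the simple zero of `W(ψ₊, e^{-ikx})` remains. -/
lemma splitG_residue_right (hq : Integrable q) (h' : IsBoundState (rightPart q) κ)
    (h : ¬ IsBoundState q κ) :
    HasSimplePole (splitG q) (Complex.I * κ)
      (-(Complex.I * (normingConstant (rightPart q) κ : ℂ) ^ 2)) := by
  have hκ := h'.1
  have hq' := integrable_rightPart hq
  set l := Complex.I * κ with hl_def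
  have hl : 0 < l.im := by simpa [l]
  have hl0 := ne_zero_of_im_pos hl
  have hW' := jostW_eq_zero_of_isBoundState hq' h'
  have hW : jostW q l ≠ 0 := fun h0 ↦ h (isBoundState_of_jostW_eq_zero hq hκ h0)
  obtain ⟨γ, hγ0, hγ, hv, hs⟩ := exists_leftJost_eq_mul hq' hl hW'
  have hN : mass (rightPart q) l ≠ 0 := mass_ne_zero hq' h'
  have hd := deriv_jostW hq' hl hW' hγ0 hγ hv hs
  have hd0 : deriv (jostW (rightPart q)) l ≠ 0 := by
    rw [hd]; simp [hl0, hγ0, hN, l]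
  obtain ⟨r1, r2⟩ := right_data_rightPart q l
  obtain ⟨l1, l2⟩ := left_data_rightPart hq hl.le
  rw [normingConstant_sq hq' hκ]
  refine hasSimplePole_of_ne_zero ⟨meromorphicAt_splitG hq hl, ?_⟩
    (neg_ne_zero.2 (mul_ne_zero Complex.I_ne_zero (inv_ne_zero hN)))
  have hlim := (tendsto_of_upper (differentiableOn_splitNum hq) hl).div
    ((tendsto_of_upper (differentiableOn_jostW hq) hl).mul
      (tendsto_slope_of_upper (differentiableOn_jostW hq') hl hW')) (mul_ne_zero hW hd0)
  rw [l1, r1] at hv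
  rw [l2, r2] at hs
  have hval : splitNum q l / (jostW q l * deriv (jostW (rightPart q)) l) =
      -(Complex.I * (mass (rightPart q) l)⁻¹) := by
    have hnum : splitNum q l = 2 * Complex.I * l * (γ * jostW q l) := by
      rw [splitNum, jostW, hs]
      linear_combination (2 * Complex.I * l * leftSlope q l) * hv
    rw [hnum, hd]
    field_simp
  rw [hval] at hlim
  refine hlim.congr fun z ↦ ?_
  simp only [splitG_eq_div, Pi.div_apply, div_eq_mul_inv, mul_inv, inv_inv]
  ring

/-- At a common bound state the numerator and both factors of the denominator vanish, and the
residue is the quotient of derivatives. That of the numerator is the difference of the masses of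
`ψ₊` for `q` and for its right part, hence may be zero. -/
lemma splitG_residue_common (hq : Integrable q) (h : IsBoundState q κ)
    (h' : IsBoundState (rightPart q) κ) :
    HasResidueSimple (splitG q) (Complex.I * κ)
      (Complex.I * ((normingConstant q κ : ℂ) ^ 2
        - (normingConstant (rightPart q) κ : ℂ) ^ 2)) := by
  have hκ := h.1
  have hq' := integrable_rightPart hq
  set l := Complex.I * κ with hl_def
  have hl : 0 < l.im := by simpa [l]
  have hl0 := ne_zero_of_im_pos hl
  have hW := jostW_eq_zero_of_isBoundState hq h
  have hW' := jostW_eq_zero_of_isBoundState hq' h'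
  obtain ⟨β, hβ0, hβ, hv, hs⟩ := exists_leftJost_eq_mul hq hl hW
  obtain ⟨γ, hγ0, hγ, hv', hs'⟩ := exists_leftJost_eq_mul hq' hl hW'
  have hN : mass q l ≠ 0 := mass_ne_zero hq h
  have hN' : mass (rightPart q) l ≠ 0 := mass_ne_zero hq' h'
  have hd := deriv_jostW hq hl hW hβ0 hβ hv hs
  have hd' := deriv_jostW hq' hl hW' hγ0 hγ hv' hs'
  have hm := mass_eq hq hl hW hβ0 hβ
  have hm' := mass_eq hq' hl hW' hγ0 hγ
  have hd0 : deriv (jostW q) l ≠ 0 := by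
    rw [hd]; simp [hl0, hβ0, hN, l]
  have hd0' : deriv (jostW (rightPart q)) l ≠ 0 := by
    rw [hd']; simp [hl0, hγ0, hN', l]
  have hlw := deriv_left_wronskian hq hl
  have hlw' := deriv_left_wronskian hq' hl
  obtain ⟨r1, r2⟩ := right_data_rightPart q l
  obtain ⟨l1, l2⟩ := left_data_rightPart hq hl.le
  -- the left Jost solution of `rightPart q` has Cauchy data `(1, -ik)` at every momentum
  have dl1 : deriv (leftVal (rightPart q)) l = 0 := by
    have : leftVal (rightPart q) =ᶠ[𝓝 l] fun _ ↦ 1 :=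
      (eventually_upper hl).mono fun z hz ↦ (left_data_rightPart hq hz.le).1
    rw [this.deriv_eq]; simp
  have dl2 : deriv (leftSlope (rightPart q)) l = -Complex.I := by
    have : leftSlope (rightPart q) =ᶠ[𝓝 l] fun z ↦ -(Complex.I * z) :=
      (eventually_upper hl).mono fun z hz ↦ (left_data_rightPart hq hz.le).2
    rw [this.deriv_eq]
    simp
  -- the two masses differ only by their parts on `(-∞, 0)`
  have hsame : ∫ x in Ioi 0, jostSol (rightPart q) l x * jostSol (rightPart q) l x =
      ∫ x in Ioi 0, jostSol q l x * jostSol q l x := by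
    refine setIntegral_congr_fun measurableSet_Ioi fun x hx ↦ ?_
    have : jostSol (rightPart q) l x = jostSol q l x :=
      jostSol_congr (x₀ := 0) (Eventually.of_forall fun _ ht ↦ rightPart_of_pos ht) l (le_of_lt hx)
    simp only [this]
  rw [hsame] at hm'
  rw [dl1, dl2, l1, l2] at hlw'
  rw [l1, r1] at hv'
  rw [l2, r2] at hs'
  set A := ∫ x in Ioi 0, jostSol q l x * jostSol q l x
  set B := ∫ x in Ioi 0, jostSol (reflect q) l x * jostSol (reflect q) l x
  set B' := ∫ x in Ioi 0, jostSol (reflect (rightPart q)) l x *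
    jostSol (reflect (rightPart q)) l x
  have hnum0 : splitNum q l = 0 := by
    rw [splitNum, hv, hs]
    refine mul_eq_zero_of_right _ ?_
    linear_combination β * rightVal q l * hs' - β * rightSlope q l * hv'
  -- the derivative of the Wronskian in the numerator, from Lagrange's identity for `ψ₋`
  -- and for `e^{-ikx}` on the left half-line (`hlw`, `hlw'`)
  have hdn : deriv (splitNum q) l = -(2 * Complex.I * l) *
      (2 * l * β * γ * (mass q l - mass (rightPart q) l)) := by
    have hdi : HasDerivAt (fun z : ℂ ↦ -(Complex.I * z)) (-Complex.I) l := by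
      simpa using ((hasDerivAt_id l).const_mul Complex.I).fun_neg
    have hdp : HasDerivAt (fun z : ℂ ↦ -(2 * Complex.I * z)) (-(2 * Complex.I)) l := by
      simpa using ((hasDerivAt_id l).const_mul (2 * Complex.I)).fun_neg
    have hall := hdp.mul (((hasDerivAt_of_upper (differentiableOn_leftVal hq) hl).mul hdi).sub
      (hasDerivAt_of_upper (differentiableOn_leftSlope hq) hl))
    have hder : deriv (splitNum q) l = _ := hall.deriv
    have hB : B / β ^ 2 * β ^ 2 = B := by field_simp
    have hB' : B' / γ ^ 2 * γ ^ 2 = B' := by field_simp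
    have hzero : leftVal q l * -(Complex.I * l) - leftSlope q l = 0 := by
      rw [hv, hs]
      linear_combination β * rightVal q l * hs' - β * rightSlope q l * hv'
    rw [hv, hs] at hlw
    rw [hder]
    simp only [Pi.mul_apply, Pi.sub_apply, hzero, mul_zero, zero_add]
    congr 1
    refine mul_right_cancel₀ (mul_ne_zero hβ0 hγ0) ?_
    rw [hm, hm', hv]
    linear_combination β * γ * deriv (leftVal q) l * hs' - β * γ * deriv (leftSlope q) l * hv' +
      γ ^ 2 * hlw + Complex.I * β ^ 2 * hv' - β ^ 2 * hlw' - 2 * l * γ ^ 2 * hB +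
      2 * l * β ^ 2 * hB'
  refine ⟨meromorphicAt_splitG hq hl, ?_⟩
  have hlim := (tendsto_slope_of_upper (differentiableOn_splitNum hq) hl hnum0).div
    ((tendsto_slope_of_upper (differentiableOn_jostW hq) hl hW).mul
      (tendsto_slope_of_upper (differentiableOn_jostW hq') hl hW')) (mul_ne_zero hd0 hd0')
  have hval : deriv (splitNum q) l / (deriv (jostW q) l * deriv (jostW (rightPart q)) l) =
      Complex.I * ((normingConstant q κ : ℂ) ^ 2 - (normingConstant (rightPart q) κ : ℂ) ^ 2) := by
    rw [normingConstant_sq hq hκ, normingConstant_sq hq' hκ, ← hl_def, hdn, hd, hd']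
    field_simp
    ring
  rw [hval] at hlim
  refine hlim.congr' ?_
  filter_upwards [self_mem_nhdsWithin] with z hz
  have hzl : z - l ≠ 0 := sub_ne_zero.2 hz
  simp only [splitG_eq_div, Pi.div_apply, div_eq_mul_inv, mul_inv, inv_inv]
  field_simp

end poles

/-! ### The transformation kernel on the half-line -/

/-- Fubini's theorem for a superposition of integrals over intervals. -/
lemma integral_mul_interval_eq {α : Type*} [MeasurableSpace α] {μ : Measure α} [SFinite μ]
    {h : α → ℂ} {a b : α → ℝ} {e : ℝ → ℂ} (he : Continuous e) (he1 : ∀ y, ‖e y‖ ≤ 1)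
    (hh : AEStronglyMeasurable h μ) (ha : Measurable a) (hb : Measurable b)
    (hab : ∀ᵐ s ∂μ, a s ≤ b s) (hi : Integrable (fun s ↦ ‖h s‖ * (b s - a s)) μ) :
    ∫ s, h s * (∫ y in a s..b s, e y) ∂μ =
      ∫ y, e y * ∫ s, {s | a s < y ∧ y < b s}.indicator h s ∂μ := by
  classical
  set S : Set (α × ℝ) := {w | a w.1 < w.2 ∧ w.2 < b w.1} with hS
  have hSm : MeasurableSet S :=
    (measurableSet_lt (ha.comp measurable_fst) measurable_snd).inter
      (measurableSet_lt measurable_snd (hb.comp measurable_fst))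
  set f : α × ℝ → ℂ := S.indicator fun w ↦ h w.1 * e w.2 with hf
  have hsec : ∀ s, (fun y ↦ f (s, y)) = (Ioo (a s) (b s)).indicator fun y ↦ h s * e y := by
    intro s
    ext y
    simp [hf, hS, indicator_apply]
  have hfm : AEStronglyMeasurable f (μ.prod volume) :=
    (hh.comp_fst.mul he.aestronglyMeasurable.comp_snd).indicator hSm
  have hsi : ∀ s, Integrable (fun y ↦ f (s, y)) := fun s ↦ by
    rw [hsec, integrable_indicator_iff measurableSet_Ioo]
    exact ((continuous_const.mul he).integrableOn_Icc).mono_set Ioo_subset_Icc_self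
  have hfi : Integrable f (μ.prod volume) := by
    refine (integrable_prod_iff hfm).2 ⟨Eventually.of_forall hsi, ?_⟩
    refine hi.mono' hfm.norm.integral_prod_right' ?_
    filter_upwards [hab] with s hs
    rw [Real.norm_of_nonneg (integral_nonneg fun _ ↦ norm_nonneg _)]
    have h1 : ∀ y, ‖f (s, y)‖ ≤ (Ioo (a s) (b s)).indicator (fun _ ↦ ‖h s‖) y := fun y ↦ by
      have := congrFun (hsec s) y
      rw [this, norm_indicator_eq_indicator_norm]
      refine indicator_le_indicator ?_
      rw [norm_mul]
      exact mul_le_of_le_one_right (norm_nonneg _) (he1 y)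
    calc _ ≤ ∫ y, (Ioo (a s) (b s)).indicator (fun _ ↦ ‖h s‖) y :=
          integral_mono (hsi s).norm
            ((integrable_indicator_iff measurableSet_Ioo).2 (by simp)) h1
      _ = _ := by
          rw [integral_indicator measurableSet_Ioo, setIntegral_const]
          simp [measureReal_def, hs, mul_comm]
  have h1 : ∀ᵐ s ∂μ, h s * (∫ y in a s..b s, e y) = ∫ y, f (s, y) := by
    filter_upwards [hab] with s hs
    rw [hsec, integral_indicator measurableSet_Ioo, integral_const_mul,
      intervalIntegral.integral_of_le hs, integral_Ioc_eq_integral_Ioo]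
  rw [integral_congr_ae h1, integral_integral_swap (f := fun s y ↦ f (s, y)) hfi]
  congr 1
  ext y
  rw [← integral_const_mul]
  congr 1
  ext s
  simp only [hf, hS, indicator_apply, mem_ofPred_eq]
  split_ifs <;> ring

/-- The iterates `B_n(x, y)` of the transformation kernel: the Volterra iterates of the Jost
function are `∫_0^∞ B_n(x, y) e^{2iky} dy`. In the recursion `w = (t, z)`, and the constraint
`z < y < z + t - x` comes from writing the Volterra kernel times `e^{2ikz}` as
`∫_z^{z + t - x} e^{2iky} dy`. -/
noncomputable def kerB (p : ℝ → ℝ) : ℕ → ℝ → ℝ → ℝ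
  | 0 => fun x y ↦ ∫ t in Ioi (x + y), p t
  | n + 1 => fun x y ↦ ∫ w : ℝ × ℝ,
      {w : ℝ × ℝ | (x < w.1 ∧ 0 < w.2) ∧ w.2 < y ∧ y < w.2 + (w.1 - x)}.indicator
        (fun w ↦ p w.1 * kerB p n w.1 w.2) w

/-- The hypotheses on the potential under which the transformation kernel is built: a measurable
representative, supported in `(0, ∞)`, with integrable first moment. -/
structure HalfLinePotential (p : ℝ → ℝ) : Prop where
  measurable : Measurable p
  integrable : Integrable p
  integrable_moment : Integrable fun t ↦ t * p t
  support : ∀ t ≤ 0, p t = 0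

/-- The tail `η(x) = ∫_x^∞ |p|`. -/
noncomputable def eta (p : ℝ → ℝ) : ℝ → ℝ := tail fun t ↦ |p t|

/-- The tail `∫_x^∞ t |p(t)| dt` of the first moment. -/
noncomputable def momentTail (p : ℝ → ℝ) : ℝ → ℝ := tail fun t ↦ |t * p t|

section kernel
variable {p : ℝ → ℝ}

lemma eta_nonneg (x : ℝ) : 0 ≤ eta p x := tail_nonneg (fun _ ↦ abs_nonneg _) x

lemma momentTail_nonneg (x : ℝ) : 0 ≤ momentTail p x := tail_nonneg (fun _ ↦ abs_nonneg _) x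

lemma HalfLinePotential.eta_anti (hp : HalfLinePotential p) : Antitone (eta p) :=
  tail_anti hp.integrable.abs fun _ ↦ abs_nonneg _

lemma HalfLinePotential.continuous_eta (hp : HalfLinePotential p) : Continuous (eta p) :=
  continuous_tail hp.integrable.abs

lemma HalfLinePotential.momentTail_le (hp : HalfLinePotential p) (x : ℝ) :
    momentTail p x ≤ ∫ t, |t * p t| :=
  tail_le_integral hp.integrable_moment.abs (fun _ ↦ abs_nonneg _) x

/-- `∫_0^∞ η < ∞`, by integration by parts. -/
lemma HalfLinePotential.integrableOn_eta (hp : HalfLinePotential p) :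
    IntegrableOn (eta p) (Ioi 0) := by
  have hid : IsPrimitive (fun _ ↦ (1 : ℝ)) (fun x : ℝ ↦ x) :=
    IsPrimitive.of_hasDerivAt (fun x ↦ hasDerivAt_id x) continuous_const
  have hprod := hid.mul (isPrimitive_tail hp.integrable.abs)
  refine integrableOn_Ioi_of_intervalIntegral_norm_bounded (∫ t, |t * p t|) 0
    (fun Y : ℝ ↦ (hp.continuous_eta.integrableOn_Icc).mono_set Ioc_subset_Icc_self) tendsto_id ?_
  filter_upwards [eventually_ge_atTop 0] with Y hY
  have h1 := hprod.sub_eq 0 Y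
  have hi1 : IntervalIntegrable (fun x ↦ tail (fun t ↦ |p t|) x) volume 0 Y :=
    hp.continuous_eta.intervalIntegrable _ _
  have hi2 : IntervalIntegrable (fun x ↦ x * |p x|) volume 0 Y :=
    ((hp.integrable.abs.intervalIntegrable).continuousOn_mul continuousOn_id)
  have h2 : ∫ x in (0 : ℝ)..Y, (1 * tail (fun t ↦ |p t|) x + x * -|p x|) =
      (∫ x in (0 : ℝ)..Y, tail (fun t ↦ |p t|) x) - ∫ x in (0 : ℝ)..Y, x * |p x| := by
    rw [← intervalIntegral.integral_sub hi1 hi2]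
    congr 1
    ext x
    ring
  rw [h2, zero_mul, sub_zero] at h1
  have h3 : ∫ x in (0 : ℝ)..Y, x * |p x| = ∫ x in (0 : ℝ)..Y, |x * p x| := by
    refine intervalIntegral.integral_congr fun x hx ↦ ?_
    rw [uIcc_of_le hY] at hx
    simp only [abs_mul, abs_of_nonneg hx.1]
  have h4 : ∫ x in Ioc 0 Y, |x * p x| = (∫ t, |t * p t|) - momentTail p Y := by
    have h5 := integral_add_compl (measurableSet_Ioc (a := (0 : ℝ)) (b := Y))
      hp.integrable_moment.abs
    have h6 : ∫ x in (Ioc 0 Y)ᶜ, |x * p x| = momentTail p Y := by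
      refine setIntegral_eq_of_subset_of_forall_sdiff_eq_zero measurableSet_Ioc.compl
        (fun x hx ↦ fun h ↦ absurd h.2 (not_le.2 hx)) fun x hx ↦ ?_
      have : x ≤ 0 := by
        by_contra h0
        exact hx.1 ⟨not_le.1 h0, not_lt.1 hx.2⟩
      rw [hp.support x this]
      simp
    linarith
  have h7 : Y * eta p Y ≤ momentTail p Y := by
    unfold eta momentTail tail
    rw [← integral_const_mul]
    refine setIntegral_mono_on (hp.integrable.abs.const_mul Y).integrableOn
      hp.integrable_moment.abs.integrableOn measurableSet_Ioi fun t ht ↦ ?_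
    rw [abs_mul, abs_of_nonneg (hY.trans (le_of_lt ht))]
    exact mul_le_mul_of_nonneg_right (le_of_lt ht) (abs_nonneg _)
  have h8 : ∫ x in (0 : ℝ)..id Y, ‖eta p x‖ = ∫ x in (0 : ℝ)..Y, tail (fun t ↦ |p t|) x := by
    refine intervalIntegral.integral_congr fun x _ ↦ ?_
    exact Real.norm_of_nonneg (eta_nonneg x)
  rw [h8]
  rw [h3, intervalIntegral.integral_of_le hY (f := fun x ↦ |x * p x|), h4] at h1
  change Y * eta p Y = _ at h1
  linarith

lemma stronglyMeasurable_kerB (hp : HalfLinePotential p) (n : ℕ) :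
    StronglyMeasurable fun w : ℝ × ℝ ↦ kerB p n w.1 w.2 := by
  induction n with
  | zero =>
    have h := (IsPrimitive.of_Ioi fun x ↦ hp.integrable.integrableOn (s := Ioi x)).continuous
    exact (h.comp (continuous_fst.add continuous_snd)).stronglyMeasurable
  | succ n ih =>
    have hS : MeasurableSet {v : (ℝ × ℝ) × (ℝ × ℝ) | (v.1.1 < v.2.1 ∧ 0 < v.2.2) ∧
        v.2.2 < v.1.2 ∧ v.1.2 < v.2.2 + (v.2.1 - v.1.1)} := by
      have h1 : Measurable fun v : (ℝ × ℝ) × (ℝ × ℝ) ↦ v.1.1 := by fun_prop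
      have h2 : Measurable fun v : (ℝ × ℝ) × (ℝ × ℝ) ↦ v.1.2 := by fun_prop
      have h3 : Measurable fun v : (ℝ × ℝ) × (ℝ × ℝ) ↦ v.2.1 := by fun_prop
      have h4 : Measurable fun v : (ℝ × ℝ) × (ℝ × ℝ) ↦ v.2.2 := by fun_prop
      exact ((measurableSet_lt h1 h3).inter (measurableSet_lt measurable_const h4)).inter
        ((measurableSet_lt h4 h2).inter (measurableSet_lt h2 (h4.add (h3.sub h1))))
    have hf : StronglyMeasurable fun v : (ℝ × ℝ) × (ℝ × ℝ) ↦ p v.2.1 * kerB p n v.2.1 v.2.2 :=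
      (hp.measurable.stronglyMeasurable.comp_measurable
        (measurable_fst.comp measurable_snd)).mul (ih.comp_measurable measurable_snd)
    exact (hf.indicator hS).integral_prod_right'

/-- The gain of `η(x + y)` at every order is what makes the remainder of the second-order expansion
integrable. -/
lemma abs_kerB_le (hp : HalfLinePotential p) (n : ℕ) {x y : ℝ} (hx : 0 ≤ x) (hy : 0 ≤ y) :
    |kerB p n x y| ≤ eta p (x + y) * (momentTail p x ^ n / n.factorial) := by
  induction n generalizing x y with
  | zero =>
    simp only [kerB, pow_zero, Nat.factorial_zero, Nat.cast_one, div_one, mul_one]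
    exact abs_integral_le_integral_abs
  | succ n ih =>
    have hw := hp.integrable_moment.abs
    have hw0 : ∀ t, 0 ≤ |t * p t| := fun t ↦ abs_nonneg _
    -- on the domain of integration `t + z > x + y`, and the section at `t` has length `≤ t - x`
    set c : ℝ → ℝ := fun t ↦ eta p (x + y) * (|p t| * (momentTail p t ^ n / n.factorial)) with hc
    have hc0 : ∀ t, 0 ≤ c t := fun t ↦ by
      have := eta_nonneg (p := p) (x + y)
      have := momentTail_nonneg (p := p) t
      positivity
    have hcm : Measurable c := by
      have : Measurable (momentTail p) := (continuous_tail hw).measurable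
      have := hp.measurable
      fun_prop
    set S : Set (ℝ × ℝ) := {w | x < w.1 ∧ x + y - w.1 < w.2 ∧ w.2 < y} with hS
    have hSm : MeasurableSet S := by
      exact (measurableSet_lt measurable_const measurable_fst).inter
        ((measurableSet_lt (measurable_const.sub measurable_fst) measurable_snd).inter
          (measurableSet_lt measurable_snd measurable_const))
    set g : ℝ × ℝ → ℝ := S.indicator fun w ↦ c w.1 with hg
    have hsec : ∀ t, (fun z ↦ g (t, z)) =
        (Ioi x).indicator (fun t ↦ (Ioo (x + y - t) y).indicator (fun _ ↦ c t)) t := by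
      intro t
      ext z
      by_cases h1 : x < t <;> simp [hg, hS, indicator_apply, h1]
    have hgm : AEStronglyMeasurable g (volume.prod volume) :=
      ((hcm.comp measurable_fst).stronglyMeasurable.indicator hSm).aestronglyMeasurable
    have hsec_int : ∀ t, ∫ z, g (t, z) = (Ioi x).indicator (fun t ↦ (t - x) * c t) t := by
      intro t
      rw [hsec]
      by_cases h1 : x < t
      · rw [indicator_of_mem (show t ∈ Ioi x from h1), indicator_of_mem (show t ∈ Ioi x from h1),
          integral_indicator measurableSet_Ioo, setIntegral_const]
        have h2 : y - (x + y - t) = t - x := by ring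
        simp [measureReal_def, h2, h1.le]
      · rw [indicator_of_notMem (show t ∉ Ioi x from h1),
          indicator_of_notMem (show t ∉ Ioi x from h1)]
        simp
    have hdom : ∀ t, ‖(Ioi x).indicator (fun t ↦ (t - x) * c t) t‖ ≤
        eta p (x + y) * (Ioi x).indicator
          (fun t ↦ |t * p t| * (momentTail p t ^ n / n.factorial)) t := by
      intro t
      by_cases h1 : x < t
      · rw [indicator_of_mem (show t ∈ Ioi x from h1), indicator_of_mem (show t ∈ Ioi x from h1),
          Real.norm_of_nonneg (mul_nonneg (by linarith) (hc0 t))]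
        have ht : t - x ≤ |t| := by rw [abs_of_pos (hx.trans_lt h1)]; linarith
        calc (t - x) * c t ≤ |t| * c t := mul_le_mul_of_nonneg_right ht (hc0 t)
          _ = _ := by rw [hc, abs_mul]; ring
      · rw [indicator_of_notMem (show t ∉ Ioi x from h1),
          indicator_of_notMem (show t ∉ Ioi x from h1)]
        simp
    have hdomi : Integrable fun t ↦ eta p (x + y) * (Ioi x).indicator
          (fun t ↦ |t * p t| * (momentTail p t ^ n / n.factorial)) t := by
      have := (integrable_mul_tail_pow hw hw0 n).div_const n.factorial
      simp only [mul_div_assoc] at this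
      exact (this.indicator measurableSet_Ioi).const_mul _
    have hsi : ∀ t, Integrable fun z ↦ g (t, z) := fun t ↦ by
      rw [hsec]
      by_cases h1 : x < t
      · rw [indicator_of_mem (show t ∈ Ioi x from h1),
          integrable_indicator_iff measurableSet_Ioo]
        simp
      · rw [indicator_of_notMem (show t ∉ Ioi x from h1)]
        exact integrable_zero _ _ _
    have hg0 : ∀ w, 0 ≤ g w := fun w ↦ indicator_nonneg (fun w _ ↦ hc0 _) w
    have hgi : Integrable g (volume.prod volume) := by
      refine (integrable_prod_iff hgm).2 ⟨Eventually.of_forall hsi, ?_⟩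
      simp_rw [Real.norm_of_nonneg (hg0 _), hsec_int]
      refine hdomi.mono' ?_ (Eventually.of_forall hdom)
      exact (((measurable_id.sub_const x).mul hcm).indicator
        measurableSet_Ioi).aestronglyMeasurable
    have hle : ∀ w : ℝ × ℝ,
        ‖{w : ℝ × ℝ | (x < w.1 ∧ 0 < w.2) ∧ w.2 < y ∧ y < w.2 + (w.1 - x)}.indicator
        (fun w ↦ p w.1 * kerB p n w.1 w.2) w‖ ≤ g w := by
      intro w
      by_cases h1 : w ∈ {w : ℝ × ℝ | (x < w.1 ∧ 0 < w.2) ∧ w.2 < y ∧ y < w.2 + (w.1 - x)}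
      · obtain ⟨⟨h2, h3⟩, h4, h5⟩ := id h1
        rw [indicator_of_mem h1, hg, indicator_of_mem (show w ∈ S from ⟨h2, by linarith, h4⟩),
          norm_mul, Real.norm_eq_abs, Real.norm_eq_abs]
        have h6 := ih (hx.trans h2.le) h3.le
        have h7 := hp.eta_anti (show x + y ≤ w.1 + w.2 by linarith)
        have h8 := momentTail_nonneg (p := p) w.1
        calc _ ≤ |p w.1| * (eta p (x + y) * (momentTail p w.1 ^ n / n.factorial)) := by
              gcongr
              exact h6.trans (by gcongr)
          _ = _ := by rw [hc]; ring
      · rw [indicator_of_notMem h1, norm_zero]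
        exact hg0 w
    calc |kerB p (n + 1) x y| ≤ ∫ w, g w :=
          norm_integral_le_of_norm_le hgi (Eventually.of_forall hle)
      _ = ∫ t, ∫ z, g (t, z) := integral_prod _ hgi
      _ ≤ ∫ t, eta p (x + y) * (Ioi x).indicator
          (fun t ↦ |t * p t| * (momentTail p t ^ n / n.factorial)) t := by
          simp_rw [hsec_int]
          refine integral_mono_of_nonneg (Eventually.of_forall fun t ↦ ?_) hdomi
            (Eventually.of_forall fun t ↦ (le_abs_self _).trans (hdom t))
          exact indicator_nonneg (fun s hs ↦ mul_nonneg (sub_nonneg.2 (le_of_lt hs)) (hc0 s)) t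
      _ = _ := by
          rw [integral_const_mul, integral_indicator measurableSet_Ioi]
          congr 1
          exact integral_mul_tail_pow hw hw0 n x

end kernel

/-! ### The modified Jost solution as a Fourier integral -/

/-- The exponential `e^{2iky}`. -/
noncomputable def fexp (k y : ℝ) : ℂ := Complex.exp (2 * Complex.I * k * y)

section fexp
variable {p : ℝ → ℝ} {k : ℝ}

lemma norm_fexp (k y : ℝ) : ‖fexp k y‖ = 1 := by
  rw [fexp, norm_exp_two_I_mul]
  simp

lemma fexp_zero (k : ℝ) : fexp k 0 = 1 := by simp [fexp]

lemma continuous_fexp (k : ℝ) : Continuous (fexp k) := by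
  unfold fexp
  fun_prop

lemma fexp_add (k y z : ℝ) : fexp k (y + z) = fexp k y * fexp k z := by
  rw [fexp, fexp, fexp, ← Complex.exp_add]
  push_cast
  ring_nf

lemma conj_fexp (k y : ℝ) :
    (starRingEnd ℂ) (fexp k y) = Complex.exp (-(2 * Complex.I * k * y)) := by
  rw [fexp, ← Complex.exp_conj]
  congr 1
  simp [map_mul, Complex.conj_ofReal, Complex.conj_I, Complex.conj_ofNat]

lemma volterraKernel_mul_fexp (hk0 : k ≠ 0) {s : ℝ} (hs : 0 ≤ s) (z : ℝ) :
    volterraKernel k s * fexp k z = ∫ y in z..(z + s), fexp k y := by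
  have hk : 2 * Complex.I * (k : ℂ) ≠ 0 := by simp [hk0]
  have h1 : ∀ y, HasDerivAt (fun y : ℝ ↦ fexp k y / (2 * Complex.I * k)) (fexp k y) y := fun y ↦ by
    have h2 := ((exp_isPrimitive (2 * Complex.I * k)).hasDerivAt (by fun_prop) y).div_const
      (2 * Complex.I * k)
    rwa [mul_div_cancel_left₀ _ hk] at h2
  rw [intervalIntegral.integral_eq_sub_of_hasDerivAt (fun y _ ↦ h1 y)
    ((continuous_fexp k).intervalIntegrable _ _), volterraKernel_of_nonneg _ hs, fexp_add]
  change (fexp k s - 1) / _ * _ = _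
  ring

/-- The coefficients of the bound `|B_n(x, y)| ≤ η(x + y) Mⁿ / n!`, `M = ∫ t |p|`. -/
noncomputable def kerCoeff (p : ℝ → ℝ) (n : ℕ) : ℝ := (∫ t, |t * p t|) ^ n / n.factorial

lemma kerCoeff_nonneg (p : ℝ → ℝ) (n : ℕ) : 0 ≤ kerCoeff p n := by
  have : 0 ≤ ∫ t, |t * p t| := integral_nonneg fun _ ↦ abs_nonneg _
  unfold kerCoeff
  positivity

lemma hasSum_kerCoeff (p : ℝ → ℝ) : HasSum (kerCoeff p) (Real.exp (∫ t, |t * p t|)) := by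
  rw [Real.exp_eq_exp_ℝ]
  exact NormedSpace.expSeries_div_hasSum_exp _

lemma abs_kerB_le_kerCoeff (hp : HalfLinePotential p) (n : ℕ) {x y : ℝ} (hx : 0 ≤ x)
    (hy : 0 ≤ y) : |kerB p n x y| ≤ eta p (x + y) * kerCoeff p n := by
  refine (abs_kerB_le hp n hx hy).trans (mul_le_mul_of_nonneg_left ?_
    (eta_nonneg _))
  have h1 := momentTail_nonneg (p := p) x
  have h2 := hp.momentTail_le x
  unfold kerCoeff
  gcongr

lemma abs_kerB_le_eta (hp : HalfLinePotential p) (n : ℕ) {x y : ℝ} (hx : 0 ≤ x)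
    (hy : 0 ≤ y) : |kerB p n x y| ≤ eta p y * kerCoeff p n :=
  (abs_kerB_le_kerCoeff hp n hx hy).trans (mul_le_mul_of_nonneg_right
    (hp.eta_anti (by linarith)) (kerCoeff_nonneg p n))

/-- Integrability of the integrand of the recursion for `B_n`, with the weight `t - x`. -/
lemma integrable_kerB_integrand (hp : HalfLinePotential p) (n : ℕ) {x : ℝ} (hx : 0 ≤ x) :
    Integrable (fun w : ℝ × ℝ ↦ ‖((p w.1 * kerB p n w.1 w.2 : ℝ) : ℂ)‖ * (w.1 - x))
      ((volume.restrict (Ioi x)).prod (volume.restrict (Ioi 0))) := by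
  have hb : Integrable (fun w : ℝ × ℝ ↦ |w.1 * p w.1| * (eta p w.2 * kerCoeff p n))
      ((volume.restrict (Ioi x)).prod (volume.restrict (Ioi 0))) :=
    hp.integrable_moment.abs.restrict.mul_prod (hp.integrableOn_eta.mul_const _)
  refine hb.mono' ?_ ?_
  · have h1 : Measurable fun w : ℝ × ℝ ↦ p w.1 := hp.measurable.comp measurable_fst
    have h2 := (stronglyMeasurable_kerB hp n).measurable
    exact (((Complex.measurable_ofReal.comp (h1.mul h2)).norm).mul
      (measurable_fst.sub_const x)).aestronglyMeasurable
  · rw [Measure.prod_restrict]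
    filter_upwards [ae_restrict_mem (measurableSet_Ioi.prod measurableSet_Ioi)] with w hw
    have h1 : x < w.1 := hw.1
    have h2 : 0 < w.2 := hw.2
    have h3 := abs_kerB_le_eta hp n (hx.trans h1.le) h2.le
    rw [Complex.norm_real, norm_mul, norm_norm, Real.norm_of_nonneg (sub_nonneg.2 h1.le),
      norm_mul, Real.norm_eq_abs, Real.norm_eq_abs, abs_mul, abs_of_pos (hx.trans_lt h1)]
    calc |p w.1| * |kerB p n w.1 w.2| * (w.1 - x)
        ≤ |p w.1| * (eta p w.2 * kerCoeff p n) * w.1 := by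
          have := sub_nonneg.2 h1.le
          have := (abs_nonneg _).trans h3
          gcongr
          linarith
      _ = _ := by ring

/-- The Volterra iterates of the modified Jost solution are Fourier integrals of the kernels `B_n`. -/
lemma jostIter_eq_integral (hp : HalfLinePotential p) (hk0 : k ≠ 0) (n : ℕ) {x : ℝ}
    (hx : 0 ≤ x) :
    jostIter p k (n + 1) x = ∫ y in Ioi (0 : ℝ), fexp k y * (kerB p n x y : ℂ) := by
  have hcut : ∀ (x : ℝ) (h : ℝ → ℂ), ∫ t, volterraKernel k (t - x) * h t =
      ∫ t in Ioi x, volterraKernel k (t - x) * h t := fun x h ↦ by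
    refine (setIntegral_eq_integral_of_forall_compl_eq_zero fun t ht ↦ ?_).symm
    rw [volterraKernel_of_nonpos _ (by simpa using ht), zero_mul]
  -- restriction of the outer integral to `y > 0`, where the inner one does not vanish
  have hpos : ∀ (B : ℝ → ℝ) (F : ℝ → ℂ), (∀ y ≤ 0, F y = 0) → (∀ y, 0 < y → F y = B y) →
      ∫ y, fexp k y * F y = ∫ y in Ioi (0 : ℝ), fexp k y * (B y : ℂ) := by
    intro B F h0 h1
    rw [← setIntegral_eq_integral_of_forall_compl_eq_zero (s := Ioi (0 : ℝ)) fun y hy ↦ by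
      rw [h0 y (by simpa using hy), mul_zero]]
    exact setIntegral_congr_fun measurableSet_Ioi fun y hy ↦ by rw [h1 y hy]
  induction n generalizing x with
  | zero =>
    refine (hcut x _).trans ?_
    have h1 : ∫ t in Ioi x, volterraKernel k (t - x) * ((p t : ℂ) * jostIter p k 0 t) =
        ∫ t in Ioi x, (p t : ℂ) * ∫ y in (0 : ℝ)..(t - x), fexp k y := by
      refine setIntegral_congr_fun measurableSet_Ioi fun t ht ↦ ?_
      have := volterraKernel_mul_fexp hk0 (sub_nonneg.2 (le_of_lt ht)) 0
      rw [fexp_zero, mul_one, zero_add] at this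
      simp only [jostIter]
      rw [this]
      ring
    rw [h1, integral_mul_interval_eq (h := fun t ↦ (p t : ℂ)) (a := fun _ ↦ 0) (b := fun t ↦ t - x)
      (continuous_fexp k) (fun y ↦ (norm_fexp k y).le) hp.integrable.ofReal.restrict.aestronglyMeasurable
      measurable_const (measurable_id.sub_const x) ?_ ?_]
    · refine hpos _ _ (fun y hy ↦ ?_) fun y hy ↦ ?_
      · simp [hy.not_gt]
      · have h2 : {s : ℝ | 0 < y ∧ y < s - x} = Ioi (x + y) := by
          ext s
          simp only [hy, true_and, mem_ofPred_eq, mem_Ioi]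
          constructor <;> intro h <;> linarith
        rw [h2, setIntegral_indicator measurableSet_Ioi,
          inter_eq_right.2 (Ioi_subset_Ioi (by linarith)), kerB]
        exact integral_ofReal
    · filter_upwards [ae_restrict_mem measurableSet_Ioi] with t ht
      exact sub_nonneg.2 (le_of_lt ht)
    · refine hp.integrable_moment.abs.restrict.mono' ?_ ?_
      · exact (hp.measurable.complex_ofReal.norm.mul
          ((measurable_id.sub_const x).sub_const 0)).aestronglyMeasurable
      · filter_upwards [ae_restrict_mem measurableSet_Ioi] with t ht
        have ht' : x < t := ht
        rw [norm_mul, norm_norm, Complex.norm_real, sub_zero, Real.norm_eq_abs,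
          Real.norm_of_nonneg (by linarith), abs_mul, abs_of_pos (hx.trans_lt ht'), mul_comm]
        gcongr
        linarith
  | succ n ih =>
    refine (hcut x _).trans ?_
    set μ : Measure (ℝ × ℝ) := (volume.restrict (Ioi x)).prod (volume.restrict (Ioi 0)) with hμ
    have hcm : Measurable fun w : ℝ × ℝ ↦ ((p w.1 * kerB p n w.1 w.2 : ℝ) : ℂ) :=
      Complex.measurable_ofReal.comp
        ((hp.measurable.comp measurable_fst).mul (stronglyMeasurable_kerB hp n).measurable)
    have hae : ∀ᵐ w ∂μ, x < w.1 ∧ 0 < w.2 := by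
      rw [hμ, Measure.prod_restrict]
      exact ae_restrict_mem (measurableSet_Ioi.prod measurableSet_Ioi)
    have hi : Integrable (fun w : ℝ × ℝ ↦ volterraKernel k (w.1 - x) *
        ((p w.1 : ℂ) * (fexp k w.2 * (kerB p n w.1 w.2 : ℂ)))) μ := by
      have hb : Integrable (fun w : ℝ × ℝ ↦ ‖(k : ℂ)‖⁻¹ * |p w.1| *
          (eta p w.2 * kerCoeff p n)) μ :=
        (hp.integrable.abs.const_mul _).restrict.mul_prod (hp.integrableOn_eta.mul_const _)
      refine hb.mono' ?_ ?_
      · have h1 : Measurable fun w : ℝ × ℝ ↦ volterraKernel k (w.1 - x) :=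
          (continuous_volterraKernel k).measurable.comp (measurable_fst.sub_const x)
        have h2 : Measurable fun w : ℝ × ℝ ↦ fexp k w.2 :=
          (continuous_fexp k).measurable.comp measurable_snd
        refine ((h1.mul (h2.mul hcm)).aestronglyMeasurable).congr (Eventually.of_forall fun w ↦ ?_)
        simp only [Pi.mul_apply]
        push_cast
        ring
      · filter_upwards [hae] with w hw
        have h3 := abs_kerB_le_eta hp n (hx.trans hw.1.le) hw.2.le
        rw [norm_mul, norm_mul, norm_mul, norm_fexp, one_mul, Complex.norm_real,
          Complex.norm_real, ← mul_assoc, Real.norm_eq_abs, Real.norm_eq_abs]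
        gcongr
        exact norm_volterraKernel_le (by simp) _
    have h1 : ∫ t in Ioi x, volterraKernel k (t - x) * ((p t : ℂ) * jostIter p k (n + 1) t) =
        ∫ w, ((p w.1 * kerB p n w.1 w.2 : ℝ) : ℂ) *
          (∫ y in w.2..(w.2 + (w.1 - x)), fexp k y) ∂μ := by
      calc _ = ∫ t in Ioi x, ∫ z in Ioi (0 : ℝ), volterraKernel k (t - x) *
            ((p t : ℂ) * (fexp k z * (kerB p n t z : ℂ))) := by
            refine setIntegral_congr_fun measurableSet_Ioi fun t ht ↦ ?_
            rw [ih (hx.trans (le_of_lt ht)), integral_const_mul, integral_const_mul]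
        _ = _ := (integral_prod _ hi).symm
        _ = _ := by
            refine integral_congr_ae ?_
            filter_upwards [hae] with w hw
            rw [← volterraKernel_mul_fexp hk0 (sub_nonneg.2 hw.1.le)]
            push_cast
            ring
    rw [h1, integral_mul_interval_eq (a := fun w ↦ w.2) (b := fun w ↦ w.2 + (w.1 - x))
      (continuous_fexp k) (fun y ↦ (norm_fexp k y).le) hcm.aestronglyMeasurable measurable_snd
      (measurable_snd.add (measurable_fst.sub_const x)) ?_
      ((integrable_kerB_integrand hp n hx).congr (Eventually.of_forall fun w ↦ by ring))]
    · refine hpos _ _ (fun y hy ↦ ?_) fun y hy ↦ ?_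
      · rw [integral_eq_zero_of_ae]
        filter_upwards [hae] with w hw
        rw [indicator_of_notMem]
        · rfl
        · intro h
          have : w.2 < y := h.1
          linarith [hw.2]
      · rw [kerB, ← integral_complex_ofReal, Measure.prod_restrict,
          ← integral_indicator (measurableSet_Ioi.prod measurableSet_Ioi)]
        refine integral_congr_ae (Eventually.of_forall fun w ↦ ?_)
        simp only [indicator_apply, mem_prod, mem_Ioi, mem_ofPred_eq]
        split_ifs <;> first | (exfalso; tauto) | rfl
    · filter_upwards [hae] with w hw
      linarith [hw.1]

/-- The transformation kernel `B = ∑ B_n` on the quadrant `x, y ≥ 0`, extended to the plane as a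
function of the positive parts of `x` and `y`. -/
noncomputable def kerSum (p : ℝ → ℝ) (x y : ℝ) : ℝ := ∑' n, kerB p n (max x 0) (max y 0)

lemma hasSum_kerSum (hp : HalfLinePotential p) (x y : ℝ) :
    HasSum (fun n ↦ kerB p n (max x 0) (max y 0)) (kerSum p x y) :=
  (Summable.of_norm_bounded ((hasSum_kerCoeff p).summable.mul_left _) fun n ↦
    abs_kerB_le_kerCoeff hp n (le_max_right x 0) (le_max_right y 0)).hasSum

lemma abs_kerSum_le (hp : HalfLinePotential p) {x y : ℝ} (hx : 0 ≤ x) (hy : 0 ≤ y) :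
    |kerSum p x y| ≤ eta p (x + y) * Real.exp (∫ t, |t * p t|) := by
  rw [← Real.norm_eq_abs]
  refine tsum_of_norm_bounded ((hasSum_kerCoeff p).mul_left _) fun n ↦ ?_
  rw [max_eq_left hx, max_eq_left hy, Real.norm_eq_abs]
  exact abs_kerB_le_kerCoeff hp n hx hy

lemma measurable_kerSum (hp : HalfLinePotential p) :
    Measurable fun w : ℝ × ℝ ↦ kerSum p w.1 w.2 := by
  refine measurable_of_tendsto_metrizable (f := fun N (w : ℝ × ℝ) ↦
    ∑ n ∈ Finset.range N, kerB p n (max w.1 0) (max w.2 0)) (fun N ↦ ?_)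
    (tendsto_pi_nhds.2 fun w ↦ (hasSum_kerSum hp w.1 w.2).tendsto_sum_nat)
  refine Finset.measurable_fun_sum _ fun n _ ↦ ?_
  exact (stronglyMeasurable_kerB hp n).measurable.comp
    ((measurable_fst.max measurable_const).prodMk (measurable_snd.max measurable_const))

lemma jostM_eq_integral (hp : HalfLinePotential p) (hk0 : k ≠ 0) {x : ℝ} (hx : 0 ≤ x) :
    jostM p k x = 1 + ∫ y in Ioi (0 : ℝ), fexp k y * (kerSum p x y : ℂ) := by
  have hsum : HasSum (fun n ↦ jostIter p k (n + 1) x)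
      (∫ y in Ioi (0 : ℝ), fexp k y * (kerSum p x y : ℂ)) := by
    simp_rw [jostIter_eq_integral hp hk0 _ hx]
    refine hasSum_integral_of_dominated_convergence
      (fun n y ↦ eta p y * kerCoeff p n) (fun n ↦ ?_) (fun n ↦ ?_)
      (Eventually.of_forall fun y ↦ ?_) ?_ ?_
    · have := (stronglyMeasurable_kerB hp n).measurable.comp
        (measurable_prodMk_left (α := ℝ) (β := ℝ) (x := x))
      exact ((continuous_fexp k).measurable.mul
        (Complex.measurable_ofReal.comp this)).aestronglyMeasurable
    · filter_upwards [ae_restrict_mem measurableSet_Ioi] with y hy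
      rw [norm_mul, norm_fexp, one_mul, Complex.norm_real]
      exact abs_kerB_le_eta hp n hx (le_of_lt hy)
    · exact (hasSum_kerCoeff p).summable.mul_left _
    · simp_rw [tsum_mul_left]
      exact hp.integrableOn_eta.mul_const _
    · filter_upwards [ae_restrict_mem measurableSet_Ioi] with y hy
      have := hasSum_kerSum hp x y
      rw [max_eq_left hx, max_eq_left (le_of_lt hy)] at this
      exact (this.mapL Complex.ofRealCLM).mul_left _
  have h1 := hasSum_jostM hp.integrable (k := k) (by simp) x
  have h2 := h1.summable.tsum_eq_zero_add
  rw [h1.tsum_eq, hsum.tsum_eq] at h2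
  rw [h2]
  rfl

end fexp

/-! ### The second-order expansion of the Fourier transform of `q m` -/

/-- Fubini's theorem on the half-plane `t < s`. -/
lemma integral_mul_integral_Ioi {f h : ℝ → ℂ} (hf : Integrable f) (hh : Integrable h) :
    ∫ t, f t * ∫ s in Ioi t, h s = ∫ s, h s * ∫ t in Iio s, f t := by
  have hS : MeasurableSet {w : ℝ × ℝ | w.1 < w.2} := measurableSet_lt measurable_fst measurable_snd
  have hi : Integrable ({w : ℝ × ℝ | w.1 < w.2}.indicator fun w ↦ f w.1 * h w.2)
      (volume.prod volume) := (hf.mul_prod hh).indicator hS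
  calc _ = ∫ t, ∫ s, {w : ℝ × ℝ | w.1 < w.2}.indicator (fun w ↦ f w.1 * h w.2) (t, s) := by
        congr 1
        ext t
        rw [← integral_const_mul, ← integral_indicator measurableSet_Ioi]
        rfl
    _ = ∫ s, ∫ t, {w : ℝ × ℝ | w.1 < w.2}.indicator (fun w ↦ f w.1 * h w.2) (t, s) :=
        integral_integral_swap (f := fun t s ↦
          {w : ℝ × ℝ | w.1 < w.2}.indicator (fun w ↦ f w.1 * h w.2) (t, s)) hi
    _ = _ := by
        congr 1
        ext s
        rw [← integral_const_mul, ← integral_indicator measurableSet_Iio]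
        congr 1
        ext t
        simp only [indicator_apply, mem_ofPred_eq, mem_Iio]
        split_ifs <;> ring

/-- The primitive `∫_{-∞}^s p` of the potential. -/
noncomputable def lowerInt (p : ℝ → ℝ) (s : ℝ) : ℝ := ∫ t in Iio s, p t

/-- The kernel of `∫_t^∞ p m - ∫_t^∞ p`. -/
noncomputable def kerL (p : ℝ → ℝ) (t z : ℝ) : ℝ := ∫ s in Ioi t, p s * kerSum p s z

/-- The kernel `K` of `m(t) ∫_0^t p - ∫_t^∞ p m`, up to the contribution of `m = 1`. -/
noncomputable def kerK (p : ℝ → ℝ) (t z : ℝ) : ℝ := lowerInt p t * kerSum p t z - kerL p t z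

/-- The integrand of the second part of `remainder`. -/
noncomputable def remainderIntegrand (p : ℝ → ℝ) (y t : ℝ) : ℝ :=
  (Ioo 0 y).indicator (fun t ↦ p t * kerK p t (y - t)) t

/-- The function whose Fourier transform is, up to the factor `2ik`, the difference of the Fourier
transforms of `p m` and `p`. -/
noncomputable def remainder (p : ℝ → ℝ) (y : ℝ) : ℝ :=
  p y * (lowerInt p y - tail p y) + ∫ t, remainderIntegrand p y t

section remainder
variable {p : ℝ → ℝ} {k : ℝ}

lemma abs_lowerInt_le (hp : HalfLinePotential p) (s : ℝ) : |lowerInt p s| ≤ ∫ t, |p t| :=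
  abs_integral_le_integral_abs.trans
    (setIntegral_le_integral hp.integrable.abs (Eventually.of_forall fun _ ↦ abs_nonneg _))

lemma abs_tail_le (hp : HalfLinePotential p) (s : ℝ) : |tail p s| ≤ ∫ t, |p t| :=
  abs_integral_le_integral_abs.trans
    (setIntegral_le_integral hp.integrable.abs (Eventually.of_forall fun _ ↦ abs_nonneg _))

lemma continuous_lowerInt (hp : HalfLinePotential p) : Continuous (lowerInt p) := by
  have h : lowerInt p = fun s ↦ (∫ t, p t) - ∫ t in Ioi s, p t := by
    funext s
    rw [lowerInt, ← integral_Iic_eq_integral_Iio,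
      ← intervalIntegral.integral_Iic_add_Ioi (b := s) hp.integrable.integrableOn
        hp.integrable.integrableOn]
    ring
  rw [h]
  exact continuous_const.sub
    (IsPrimitive.of_Ioi fun x ↦ hp.integrable.integrableOn (s := Ioi x)).continuous

lemma measurable_kerL (hp : HalfLinePotential p) :
    Measurable fun w : ℝ × ℝ ↦ kerL p w.1 w.2 := by
  have hS : MeasurableSet {v : (ℝ × ℝ) × ℝ | v.1.1 < v.2} :=
    measurableSet_lt (measurable_fst.comp measurable_fst) measurable_snd
  have hf : Measurable fun v : (ℝ × ℝ) × ℝ ↦ p v.2 * kerSum p v.2 v.1.2 :=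
    (hp.measurable.comp measurable_snd).mul ((measurable_kerSum hp).comp
      (measurable_snd.prodMk (measurable_snd.comp measurable_fst)))
  have := (hf.indicator hS).stronglyMeasurable.integral_prod_right' (ν := volume)
  convert! this.measurable using 2 with w
  rw [kerL, ← integral_indicator measurableSet_Ioi]
  rfl

lemma measurable_kerK (hp : HalfLinePotential p) :
    Measurable fun w : ℝ × ℝ ↦ kerK p w.1 w.2 :=
  (((continuous_lowerInt hp).measurable.comp measurable_fst).mul (measurable_kerSum hp)).sub
    (measurable_kerL hp)

lemma abs_kerL_le (hp : HalfLinePotential p) {t z : ℝ} (ht : 0 ≤ t) (hz : 0 ≤ z) :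
    |kerL p t z| ≤ (∫ s, |p s|) * (eta p (t + z) * Real.exp (∫ t, |t * p t|)) := by
  have hb : Integrable fun s ↦ |p s| * (eta p (t + z) * Real.exp (∫ t, |t * p t|)) :=
    hp.integrable.abs.mul_const _
  have h1 : |kerL p t z| ≤ ∫ s in Ioi t, |p s| * (eta p (t + z) * Real.exp (∫ t, |t * p t|)) := by
    change ‖∫ s in Ioi t, p s * kerSum p s z‖ ≤ _
    refine norm_integral_le_of_norm_le hb.integrableOn ?_
    filter_upwards [ae_restrict_mem measurableSet_Ioi] with s hs
    have hs' : t < s := hs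
    rw [norm_mul, Real.norm_eq_abs, Real.norm_eq_abs]
    refine mul_le_mul_of_nonneg_left ((abs_kerSum_le hp (ht.trans hs'.le) hz).trans ?_)
      (abs_nonneg _)
    exact mul_le_mul_of_nonneg_right (hp.eta_anti (by linarith)) (Real.exp_pos _).le
  refine h1.trans ((setIntegral_le_integral hb (Eventually.of_forall fun s ↦ ?_)).trans
    (integral_mul_const _ _).le)
  exact mul_nonneg (abs_nonneg _)
    (mul_nonneg (eta_nonneg _) (Real.exp_pos _).le)

/-- The constant in the bound for the kernel `K`. -/
noncomputable def kerKBound (p : ℝ → ℝ) : ℝ := 2 * (∫ s, |p s|) * Real.exp (∫ t, |t * p t|)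

lemma kerKBound_nonneg (p : ℝ → ℝ) : 0 ≤ kerKBound p := by
  have : 0 ≤ ∫ s, |p s| := integral_nonneg fun _ ↦ abs_nonneg _
  unfold kerKBound
  positivity

lemma abs_kerK_le (hp : HalfLinePotential p) {t z : ℝ} (ht : 0 ≤ t) (hz : 0 ≤ z) :
    |kerK p t z| ≤ kerKBound p * eta p (t + z) := by
  have h1 := abs_kerL_le hp ht hz
  have h2 : |lowerInt p t * kerSum p t z| ≤
      (∫ s, |p s|) * (eta p (t + z) * Real.exp (∫ t, |t * p t|)) := by
    rw [abs_mul]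
    exact mul_le_mul (abs_lowerInt_le hp t) (abs_kerSum_le hp ht hz) (abs_nonneg _)
      (integral_nonneg fun _ ↦ abs_nonneg _)
  refine (abs_sub _ _).trans ?_
  rw [kerKBound]
  linarith

lemma integrable_remainderIntegrand (hp : HalfLinePotential p) :
    Integrable (fun w : ℝ × ℝ ↦ remainderIntegrand p w.1 w.2) (volume.prod volume) := by
  have hψ : Integrable ((Ioi (0 : ℝ)).indicator fun z ↦ kerKBound p * eta p z) :=
    (integrable_indicator_iff measurableSet_Ioi).2 (hp.integrableOn_eta.const_mul (kerKBound p))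
  -- a convolution of `|p|` with a multiple of `η` dominates the integrand
  have hb := hp.integrable.abs.convolution_integrand (ContinuousLinearMap.mul ℝ ℝ) hψ
  refine hb.mono' ?_ (Eventually.of_forall fun w ↦ ?_)
  · have hS : MeasurableSet {w : ℝ × ℝ | 0 < w.2 ∧ w.2 < w.1} :=
      (measurableSet_lt measurable_const measurable_snd).inter
        (measurableSet_lt measurable_snd measurable_fst)
    have hf : Measurable fun w : ℝ × ℝ ↦ p w.2 * kerK p w.2 (w.1 - w.2) :=
      (hp.measurable.comp measurable_snd).mul ((measurable_kerK hp).comp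
        (measurable_snd.prodMk (measurable_fst.sub measurable_snd)))
    exact (hf.indicator hS).aestronglyMeasurable
  · simp only [ContinuousLinearMap.mul_apply', remainderIntegrand]
    by_cases h : w.2 ∈ Ioo 0 w.1
    · have h1 : w.1 - w.2 ∈ Ioi (0 : ℝ) := sub_pos.2 h.2
      rw [indicator_of_mem h, indicator_of_mem h1, norm_mul, Real.norm_eq_abs, Real.norm_eq_abs]
      refine mul_le_mul_of_nonneg_left ((abs_kerK_le hp h.1.le (le_of_lt h1)).trans ?_)
        (abs_nonneg _)
      exact mul_le_mul_of_nonneg_left (hp.eta_anti (by linarith [h.1])) (kerKBound_nonneg p)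
    · rw [indicator_of_notMem h, norm_zero]
      refine mul_nonneg (abs_nonneg _) (indicator_nonneg (fun z _ ↦ ?_) _)
      exact mul_nonneg (kerKBound_nonneg p) (eta_nonneg z)

lemma integrable_remainder (hp : HalfLinePotential p) : Integrable (remainder p) := by
  refine Integrable.add ?_ (integrable_remainderIntegrand hp).integral_prod_left
  refine hp.integrable.mul_bdd (c := 2 * ∫ t, |p t|) ?_ (Eventually.of_forall fun y ↦ ?_)
  · exact ((continuous_lowerInt hp).sub (continuous_tail hp.integrable)).aestronglyMeasurable
  · refine (norm_sub_le _ _).trans ?_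
    have := abs_lowerInt_le hp y
    have := abs_tail_le hp y
    rw [Real.norm_eq_abs, Real.norm_eq_abs]
    linarith

lemma remainder_of_nonpos (hp : HalfLinePotential p) {y : ℝ} (hy : y ≤ 0) :
    remainder p y = 0 := by
  rw [remainder, hp.support y hy]
  simp [remainderIntegrand, Ioo_eq_empty hy.not_gt]

lemma abs_remainder_le (hp : HalfLinePotential p) (y : ℝ) :
    |remainder p y| ≤ 2 * (∫ t, |p t|) * |p y| + (∫ t, |p t|) * kerKBound p * eta p y := by
  have h1 : |p y * (lowerInt p y - tail p y)| ≤ 2 * (∫ t, |p t|) * |p y| := by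
    rw [abs_mul, mul_comm]
    refine mul_le_mul_of_nonneg_right ((abs_sub _ _).trans ?_) (abs_nonneg _)
    linarith [abs_lowerInt_le hp y, abs_tail_le hp y]
  have h2 : |∫ t, remainderIntegrand p y t| ≤ ∫ t, |p t| * (kerKBound p * eta p y) := by
    change ‖∫ t, remainderIntegrand p y t‖ ≤ _
    refine norm_integral_le_of_norm_le (hp.integrable.abs.mul_const _)
      (Eventually.of_forall fun t ↦ ?_)
    have h0 := mul_nonneg (kerKBound_nonneg p) (eta_nonneg (p := p) y)
    rw [remainderIntegrand]
    by_cases h : t ∈ Ioo 0 y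
    · rw [indicator_of_mem h, norm_mul, Real.norm_eq_abs, Real.norm_eq_abs]
      have h3 := abs_kerK_le hp h.1.le (sub_nonneg.2 h.2.le)
      rw [add_sub_cancel] at h3
      gcongr
    · rw [indicator_of_notMem h, norm_zero]
      positivity
  rw [integral_mul_const] at h2
  refine (abs_add_le _ _).trans ?_
  linarith

/-- A superposition of products of exponentials, collected by frequency: `y = t + z`. -/
lemma integral_fexp_mul_kerK (hp : HalfLinePotential p) (k : ℝ) :
    ∫ t, fexp k t * (p t : ℂ) * ∫ z in Ioi (0 : ℝ), fexp k z * (kerK p t z : ℂ) =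
      ∫ y, fexp k y * ((∫ t, remainderIntegrand p y t : ℝ) : ℂ) := by
  have hi : Integrable (fun w : ℝ × ℝ ↦ fexp k w.1 * (remainderIntegrand p w.1 w.2 : ℂ))
      (volume.prod volume) := by
    refine (integrable_remainderIntegrand hp).ofReal.bdd_mul (c := 1) ?_
      (Eventually.of_forall fun w ↦ (norm_fexp k w.1).le)
    exact ((continuous_fexp k).comp continuous_fst).aestronglyMeasurable
  calc _ = ∫ t, ∫ y, fexp k y * (remainderIntegrand p y t : ℂ) := by
        congr 1
        ext t
        rcases le_or_gt t 0 with ht | ht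
        · have h1 : ∀ y, remainderIntegrand p y t = 0 := fun y ↦
            indicator_of_notMem (fun h ↦ ht.not_gt h.1) _
          simp [h1, hp.support t ht]
        · rw [← integral_const_mul, ← integral_indicator measurableSet_Ioi,
            ← integral_sub_right_eq_self _ t]
          congr 1
          ext y
          have h2 : fexp k y = fexp k t * fexp k (y - t) := by
            rw [← fexp_add, add_sub_cancel]
          by_cases hy : t < y
          · rw [indicator_of_mem (show y - t ∈ Ioi (0 : ℝ) from sub_pos.2 hy),
              remainderIntegrand, indicator_of_mem (show t ∈ Ioo 0 y from ⟨ht, hy⟩), h2]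
            push_cast
            ring
          · rw [indicator_of_notMem (fun h : y - t ∈ Ioi (0 : ℝ) ↦ hy (sub_pos.1 h)),
              remainderIntegrand, indicator_of_notMem (fun h ↦ hy h.2)]
            simp
    _ = ∫ y, ∫ t, fexp k y * (remainderIntegrand p y t : ℂ) :=
        (integral_integral_swap (f := fun y t ↦ fexp k y * (remainderIntegrand p y t : ℂ)) hi).symm
    _ = _ := by
        congr 1
        ext y
        rw [integral_const_mul, integral_complex_ofReal]

/-- The tail `∫_t^∞ p m` as a Fourier integral. -/
lemma integral_Ioi_mul_jostM (hp : HalfLinePotential p) (hk0 : k ≠ 0) {t : ℝ} (ht : 0 ≤ t) :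
    ∫ s in Ioi t, (p s : ℂ) * jostM p k s =
      tail p t + ∫ z in Ioi (0 : ℝ), fexp k z * (kerL p t z : ℂ) := by
  have hi : Integrable (fun w : ℝ × ℝ ↦ (p w.1 : ℂ) * (fexp k w.2 * (kerSum p w.1 w.2 : ℂ)))
      ((volume.restrict (Ioi t)).prod (volume.restrict (Ioi 0))) := by
    have hb : Integrable (fun w : ℝ × ℝ ↦ |p w.1| *
        (eta p w.2 * Real.exp (∫ t, |t * p t|)))
        ((volume.restrict (Ioi t)).prod (volume.restrict (Ioi 0))) :=
      hp.integrable.abs.restrict.mul_prod (hp.integrableOn_eta.mul_const _)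
    refine hb.mono' ?_ ?_
    · have h1 : Measurable fun w : ℝ × ℝ ↦ fexp k w.2 :=
        (continuous_fexp k).measurable.comp measurable_snd
      have h2 : Measurable fun w : ℝ × ℝ ↦ p w.1 := hp.measurable.comp measurable_fst
      exact ((Complex.measurable_ofReal.comp h2).mul (h1.mul
        (Complex.measurable_ofReal.comp (measurable_kerSum hp)))).aestronglyMeasurable
    · rw [Measure.prod_restrict]
      filter_upwards [ae_restrict_mem (measurableSet_Ioi.prod measurableSet_Ioi)] with w hw
      have h1 : t < w.1 := hw.1
      have h2 : 0 < w.2 := hw.2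
      rw [norm_mul, norm_mul, norm_fexp, one_mul, Complex.norm_real, Complex.norm_real,
        Real.norm_eq_abs, Real.norm_eq_abs]
      refine mul_le_mul_of_nonneg_left ((abs_kerSum_le hp (ht.trans h1.le) h2.le).trans ?_)
        (abs_nonneg _)
      exact mul_le_mul_of_nonneg_right (hp.eta_anti (by linarith)) (Real.exp_pos _).le
  have h1 : ∫ s in Ioi t, (p s : ℂ) * jostM p k s = ∫ s in Ioi t, ((p s : ℂ) +
      ∫ z in Ioi (0 : ℝ), (p s : ℂ) * (fexp k z * (kerSum p s z : ℂ))) := by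
    refine setIntegral_congr_fun measurableSet_Ioi fun s hs ↦ ?_
    rw [jostM_eq_integral hp hk0 (ht.trans (le_of_lt hs)), integral_const_mul]
    ring
  have hpi : Integrable (fun s ↦ (p s : ℂ)) (volume.restrict (Ioi t)) := hp.integrable.ofReal.restrict
  rw [h1, integral_add hpi hi.integral_prod_left,
    integral_integral_swap (f := fun s z ↦ (p s : ℂ) * (fexp k z * (kerSum p s z : ℂ))) hi]
  congr 1
  · exact integral_ofReal
  · congr 1
    ext z
    rw [kerL, ← integral_complex_ofReal, ← integral_const_mul]
    congr 1
    ext s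
    push_cast
    ring

lemma integrable_fexp_mul {f : ℝ → ℂ} {μ : Measure ℝ} (hf : Integrable f μ) (k : ℝ) :
    Integrable (fun y ↦ fexp k y * f y) μ :=
  hf.bdd_mul (c := 1) (continuous_fexp k).aestronglyMeasurable
    (Eventually.of_forall fun y ↦ (norm_fexp k y).le)

lemma integrableOn_kerSum (hp : HalfLinePotential p) {t : ℝ} (ht : 0 ≤ t) :
    IntegrableOn (kerSum p t) (Ioi 0) := by
  refine Integrable.mono' (hp.integrableOn_eta.mul_const (Real.exp (∫ t, |t * p t|)))
    ((measurable_kerSum hp).comp (measurable_prodMk_left (x := t))).aestronglyMeasurable ?_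
  filter_upwards [ae_restrict_mem measurableSet_Ioi] with z hz
  refine (abs_kerSum_le hp ht (le_of_lt hz)).trans ?_
  exact mul_le_mul_of_nonneg_right (hp.eta_anti (by linarith)) (Real.exp_pos _).le

lemma integrableOn_kerL (hp : HalfLinePotential p) {t : ℝ} (ht : 0 ≤ t) :
    IntegrableOn (kerL p t) (Ioi 0) := by
  refine Integrable.mono'
    ((hp.integrableOn_eta.mul_const (Real.exp (∫ t, |t * p t|))).const_mul (∫ s, |p s|))
    ((measurable_kerL hp).comp (measurable_prodMk_left (x := t))).aestronglyMeasurable ?_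
  filter_upwards [ae_restrict_mem measurableSet_Ioi] with z hz
  refine (abs_kerL_le hp ht (le_of_lt hz)).trans ?_
  refine mul_le_mul_of_nonneg_left ?_ (integral_nonneg fun _ ↦ abs_nonneg _)
  exact mul_le_mul_of_nonneg_right (hp.eta_anti (by linarith)) (Real.exp_pos _).le

/-- The combination that appears after exchanging the integrals in `∫ e^{2ikt} p (m - 1)`, as a
Fourier integral. -/
lemma jostM_mul_lowerInt_sub (hp : HalfLinePotential p) (hk0 : k ≠ 0) {t : ℝ} (ht : 0 ≤ t) :
    jostM p k t * lowerInt p t - ∫ s in Ioi t, (p s : ℂ) * jostM p k s =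
      ((lowerInt p t - tail p t : ℝ) : ℂ) +
        ∫ z in Ioi (0 : ℝ), fexp k z * (kerK p t z : ℂ) := by
  have h1 : ∫ z in Ioi (0 : ℝ), fexp k z * (kerK p t z : ℂ) =
      (∫ z in Ioi (0 : ℝ), fexp k z * (kerSum p t z : ℂ)) * lowerInt p t -
        ∫ z in Ioi (0 : ℝ), fexp k z * (kerL p t z : ℂ) := by
    have h2 : Integrable (fun z ↦ (kerSum p t z : ℂ)) (volume.restrict (Ioi 0)) :=
      (integrableOn_kerSum hp ht).ofReal
    have h3 : Integrable (fun z ↦ (kerL p t z : ℂ)) (volume.restrict (Ioi 0)) :=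
      (integrableOn_kerL hp ht).ofReal
    rw [← integral_mul_const, ← integral_sub ((integrable_fexp_mul h2 k).mul_const _)
      (integrable_fexp_mul h3 k)]
    congr 1
    ext z
    rw [kerK]
    push_cast
    ring
  rw [h1, jostM_eq_integral hp hk0 ht, integral_Ioi_mul_jostM hp hk0 ht]
  push_cast
  ring

/-- The Volterra equation for `m`, with the two exponentials of the kernel separated. -/
lemma fexp_mul_jostM (hp : HalfLinePotential p) (k t : ℝ) :
    fexp k t * jostM p k t = fexp k t + 1 / (2 * Complex.I * k) *
      ((∫ s in Ioi t, fexp k s * ((p s : ℂ) * jostM p k s)) -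
        fexp k t * ∫ s in Ioi t, (p s : ℂ) * jostM p k s) := by
  have hF := integrable_mul_jostM hp.integrable (k := k) (by simp)
  have h0 : ∀ s ∉ Ioi t, volterraKernel k (s - t) * ((p s : ℂ) * jostM p k s) = 0 :=
    fun s hs ↦ by rw [volterraKernel_of_nonpos k (by simpa using hs), zero_mul]
  rw [← integral_const_mul, ← integral_sub (integrable_fexp_mul hF k).integrableOn
    (hF.const_mul _).integrableOn, ← integral_const_mul]
  conv_lhs => rw [jostM_eq hp.integrable (by simp),
    ← setIntegral_eq_integral_of_forall_compl_eq_zero h0, mul_add, mul_one, ← integral_const_mul]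
  congr 1
  refine setIntegral_congr_fun measurableSet_Ioi fun s hs ↦ ?_
  have h1 : fexp k s = fexp k t * fexp k (s - t) := by rw [← fexp_add, add_sub_cancel]
  rw [volterraKernel_of_nonneg k (sub_nonneg.2 (le_of_lt hs)), h1]
  change fexp k t * ((fexp k (s - t) - 1) / _ * _) = _
  ring

lemma integrable_mul_integral_Ioi {f h : ℝ → ℂ} (hf : Integrable f) (hh : Integrable h) :
    Integrable fun t ↦ f t * ∫ s in Ioi t, h s := by
  refine hf.mul_bdd (c := ∫ s, ‖h s‖) ?_ (Eventually.of_forall fun t ↦ ?_)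
  · exact (IsPrimitive.of_Ioi fun x ↦ hh.integrableOn (s := Ioi x)).continuous.aestronglyMeasurable
  · exact (norm_integral_le_integral_norm _).trans
      (setIntegral_le_integral hh.norm (Eventually.of_forall fun _ ↦ norm_nonneg _))

/-- The Fourier transform of `p m` equals that of `p` up to a Fourier transform divided
by `2ik`. -/
lemma integral_fexp_mul_jostM (hp : HalfLinePotential p) (hk0 : k ≠ 0) :
    ∫ t, fexp k t * ((p t : ℂ) * jostM p k t) = (∫ t, fexp k t * (p t : ℂ)) +
      1 / (2 * Complex.I * k) * ∫ y, fexp k y * (remainder p y : ℂ) := by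
  set F : ℝ → ℂ := fun t ↦ (p t : ℂ) * jostM p k t with hFdef
  have hF : Integrable F := integrable_mul_jostM hp.integrable (k := k) (by simp)
  have hp' : Integrable fun t ↦ (p t : ℂ) := hp.integrable.ofReal
  have hEF := integrable_fexp_mul hF k
  have hEp := integrable_fexp_mul hp' k
  have hi1 := integrable_mul_integral_Ioi hp' hEF
  have hi2 := integrable_mul_integral_Ioi hEp hF
  have hi3 : Integrable fun s ↦ fexp k s * F s * (lowerInt p s : ℂ) := by
    refine hEF.mul_bdd (c := ∫ t, |p t|) ?_ (Eventually.of_forall fun s ↦ ?_)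
    · exact (Complex.continuous_ofReal.comp (continuous_lowerInt hp)).aestronglyMeasurable
    · rw [Complex.norm_real]
      exact abs_lowerInt_le hp s
  have hi4 : Integrable fun s ↦ fexp k s * ((p s * (lowerInt p s - tail p s) : ℝ) : ℂ) := by
    refine integrable_fexp_mul (Integrable.ofReal ?_) k
    refine hp.integrable.mul_bdd (c := 2 * ∫ t, |p t|) ?_ (Eventually.of_forall fun y ↦ ?_)
    · exact ((continuous_lowerInt hp).sub (continuous_tail hp.integrable)).aestronglyMeasurable
    · refine (norm_sub_le _ _).trans ?_
      have := abs_lowerInt_le hp y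
      have := abs_tail_le hp y
      rw [Real.norm_eq_abs, Real.norm_eq_abs]
      linarith
  have hi5 : Integrable fun y ↦ fexp k y * ((∫ t, remainderIntegrand p y t : ℝ) : ℂ) :=
    integrable_fexp_mul (integrable_remainderIntegrand hp).integral_prod_left.ofReal k
  have hpt : ∀ s, fexp k s * F s * (lowerInt p s : ℂ) -
      fexp k s * (p s : ℂ) * ∫ t in Ioi s, F t =
      fexp k s * ((p s * (lowerInt p s - tail p s) : ℝ) : ℂ) +
      fexp k s * (p s : ℂ) * ∫ z in Ioi (0 : ℝ), fexp k z * (kerK p s z : ℂ) := fun s ↦ by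
    -- the Fourier representations hold for `s ≥ 0` only, but `p` vanishes for `s ≤ 0`
    rcases le_or_gt s 0 with hs | hs
    · simp [hFdef, hp.support s hs]
    · have := jostM_mul_lowerInt_sub hp hk0 hs.le
      simp only [hFdef]
      push_cast at this ⊢
      linear_combination (fexp k s * (p s : ℂ)) * this
  have hi6 : Integrable fun s ↦ fexp k s * (p s : ℂ) *
      ∫ z in Ioi (0 : ℝ), fexp k z * (kerK p s z : ℂ) := by
    refine ((hi3.sub hi2).sub hi4).congr (Eventually.of_forall fun s ↦ ?_)
    simp only [Pi.sub_apply]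
    rw [hpt]
    ring
  calc ∫ t, fexp k t * F t = ∫ t, (fexp k t * (p t : ℂ) + 1 / (2 * Complex.I * k) *
        ((p t : ℂ) * (∫ s in Ioi t, fexp k s * F s) -
          fexp k t * (p t : ℂ) * ∫ s in Ioi t, F s)) := by
        congr 1
        ext t
        have := fexp_mul_jostM hp k t
        simp only [hFdef]
        linear_combination (p t : ℂ) * this
    _ = (∫ t, fexp k t * (p t : ℂ)) + 1 / (2 * Complex.I * k) *
        ((∫ s, fexp k s * F s * (lowerInt p s : ℂ)) -
          ∫ t, fexp k t * (p t : ℂ) * ∫ s in Ioi t, F s) := by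
        have hi7 : Integrable fun t ↦ 1 / (2 * Complex.I * (k : ℂ)) *
            ((p t : ℂ) * (∫ s in Ioi t, fexp k s * F s) -
              fexp k t * (p t : ℂ) * ∫ s in Ioi t, F s) := (hi1.sub hi2).const_mul _
        rw [integral_add hEp hi7, integral_const_mul,
          integral_sub hi1 hi2, integral_mul_integral_Ioi hp' hEF]
        simp_rw [lowerInt, integral_complex_ofReal]
    _ = _ := by
        rw [← integral_sub hi3 hi2]
        simp_rw [hpt]
        rw [integral_add hi4 hi6, integral_fexp_mul_kerK hp k, ← integral_add hi4 hi5]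
        congr 3
        ext y
        rw [remainder]
        push_cast
        ring

end remainder

/-! ### The reflection coefficient of the right part -/

section rightPart
variable {q : ℝ → ℝ} {k : ℝ}

open scoped ComplexConjugate

lemma _root_.ShortRange.integrable (hq : ShortRange q) : Integrable q := by
  have h : Integrable fun x : ℝ ↦ (1 + |x|)⁻¹ * ((1 + |x|) * q x) := by
    refine Integrable.bdd_mul (c := 1) hq ?_ (Eventually.of_forall fun x ↦ ?_)
    · exact Measurable.aestronglyMeasurable (by fun_prop)
    · rw [norm_inv, Real.norm_of_nonneg (by positivity)]
      exact inv_le_one_of_one_le₀ (by linarith [abs_nonneg x])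
  refine h.congr (Eventually.of_forall fun x ↦ ?_)
  have : 1 + |x| ≠ 0 := by positivity
  simp only
  rw [inv_mul_cancel_left₀ this]

lemma _root_.ShortRange.integrable_moment (hq : ShortRange q) : Integrable fun x ↦ x * q x := by
  refine Integrable.mono hq (aestronglyMeasurable_id.mul hq.integrable.aestronglyMeasurable)
    (Eventually.of_forall fun x ↦ ?_)
  rw [norm_mul, norm_mul, Real.norm_eq_abs, Real.norm_of_nonneg (by positivity : 0 ≤ 1 + |x|)]
  gcongr
  linarith

/-- A short-range potential agrees almost everywhere on `(0, ∞)` with one to which the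
construction of the transformation kernel applies. -/
lemma exists_halfLinePotential (hq : ShortRange q) :
    ∃ p, HalfLinePotential p ∧ p =ᵐ[volume] rightPart q := by
  have hm := hq.integrable.aestronglyMeasurable
  have hae : (Ioi (0 : ℝ)).indicator (hm.mk q) =ᵐ[volume] rightPart q := by
    filter_upwards [hm.ae_eq_mk] with t ht
    simp only [rightPart, indicator_apply, ht]
  refine ⟨_, ⟨hm.stronglyMeasurable_mk.measurable.indicator measurableSet_Ioi,
    (integrable_rightPart hq.integrable).congr hae.symm, ?_,
    fun t ht ↦ indicator_of_notMem (not_lt.2 ht) _⟩, hae⟩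
  refine (hq.integrable_moment.indicator (measurableSet_Ioi (a := (0 : ℝ)))).congr ?_
  filter_upwards [hae] with t ht
  rw [ht]
  simp only [rightPart, indicator_apply]
  split_ifs <;> simp

/-- In terms of `m = e^{-ikx} ψ₊`, the ratio `R₊ / T₊` is `-∂ₓ m(0)^* / (2ik)`. -/
lemma rightReflection_rightPart_eq (hq : Integrable q) (hk0 : k ≠ 0) :
    rightReflection (rightPart q) k = transmission (rightPart q) k *
      (1 / (2 * Complex.I * k) * -conj (jostD (rightPart q) k 0)) := by
  have hk : 0 ≤ (k : ℂ).im := by simp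
  have hk0' : (k : ℂ) ≠ 0 := by exact_mod_cast hk0
  have hq' := integrable_rightPart hq
  have hw := jostW_ne_zero_of_real hq' hk0
  obtain ⟨h1, h2⟩ := left_data_rightPart hq hk
  have h3 : rightVal (rightPart q) k = jostM (rightPart q) k 0 := by simp [rightVal, jostSol]
  have h4 : rightSlope (rightPart q) k =
      Complex.I * k * jostM (rightPart q) k 0 + jostD (rightPart q) k 0 := by
    simp [rightSlope, jostSolDeriv]
  rw [rightReflection_eq hq' hk0, transmission_eq hq' hk0, h1, h2, h3, h4]
  simp only [map_add, map_mul, Complex.conj_I, Complex.conj_ofReal]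
  field_simp
  ring

/-- The second-order expansion of `R₊ / T₊`. -/
lemma rightReflection_rightPart_expansion (hq : Integrable q) {p : ℝ → ℝ}
    (hp : HalfLinePotential p) (hpq : p =ᵐ[volume] rightPart q) (hk0 : k ≠ 0) :
    rightReflection (rightPart q) k = transmission (rightPart q) k *
      (1 / (2 * Complex.I * k) *
          (∫ x in Ioi (0 : ℝ), Complex.exp (-(2 * Complex.I * k * x)) * (q x : ℂ)) -
        1 / (2 * Complex.I * k) ^ 2 *
          ∫ x in Ioi (0 : ℝ), Complex.exp (-(2 * Complex.I * k * x)) * (remainder p x : ℂ)) := by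
  have hcut : ∀ f : ℝ → ℂ, (∀ t ≤ 0, f t = 0) → ∫ t in Ioi (0 : ℝ), f t = ∫ t, f t := fun f hf ↦
    setIntegral_eq_integral_of_forall_compl_eq_zero fun t ht ↦ hf t (not_lt.1 ht)
  have hconj : ∀ f : ℝ → ℝ, (∀ t ≤ 0, f t = 0) → conj (∫ t, fexp k t * (f t : ℂ)) =
      ∫ x in Ioi (0 : ℝ), Complex.exp (-(2 * Complex.I * k * x)) * (f x : ℂ) := fun f hf ↦ by
    rw [← integral_conj, hcut _ fun t ht ↦ by simp [hf t ht]]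
    simp only [map_mul, conj_fexp, Complex.conj_ofReal]
  have hD : -jostD (rightPart q) k 0 = (∫ t, fexp k t * (p t : ℂ)) +
      1 / (2 * Complex.I * k) * ∫ y, fexp k y * (remainder p y : ℂ) := by
    rw [← integral_fexp_mul_jostM hp hk0, ← hcut _ fun t ht ↦ by simp [hp.support t ht],
      jostD_congr (q' := p) (by filter_upwards [hpq] with t ht _ using ht.symm) _ le_rfl, jostD,
      neg_neg]
    simp [fexp]
  have hq1 : ∫ x in Ioi (0 : ℝ), Complex.exp (-(2 * Complex.I * k * x)) * (p x : ℂ) =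
      ∫ x in Ioi (0 : ℝ), Complex.exp (-(2 * Complex.I * k * x)) * (q x : ℂ) := by
    refine integral_congr_ae ?_
    filter_upwards [ae_restrict_of_ae hpq, ae_restrict_mem measurableSet_Ioi] with x hx hx0
    rw [hx, rightPart_of_pos hx0]
  rw [rightReflection_rightPart_eq hq hk0, ← map_neg, hD, map_add, map_mul,
    hconj p hp.support, hconj _ fun t ht ↦ remainder_of_nonpos hp ht, hq1]
  have h2 : conj (1 / (2 * Complex.I * (k : ℂ))) = -(1 / (2 * Complex.I * k)) := by
    simp [Complex.conj_ofReal, Complex.conj_I, Complex.conj_ofNat]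
  rw [h2]
  ring

lemma integral_abs_eq_normL1 {p : ℝ → ℝ} (hpq : p =ᵐ[volume] rightPart q) :
    ∫ t, |p t| = normL1 (rightPart q) :=
  integral_congr_ae (by filter_upwards [hpq] with t ht; rw [ht])

lemma integral_moment_le_normL11 (hq : ShortRange q) {p : ℝ → ℝ} (hp : HalfLinePotential p)
    (hpq : p =ᵐ[volume] rightPart q) : ∫ t, |t * p t| ≤ normL11 (rightPart q) := by
  have h : Integrable fun x ↦ (1 + |x|) * |rightPart q x| := by
    refine ((Integrable.abs hq).indicator (measurableSet_Ioi (a := (0 : ℝ)))).congr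
      (Eventually.of_forall fun x ↦ ?_)
    simp only [rightPart, indicator_apply]
    split_ifs
    · rw [abs_mul, abs_of_nonneg (by positivity : 0 ≤ 1 + |x|)]
    · simp
  refine integral_mono_ae hp.integrable_moment.abs h ?_
  filter_upwards [hpq] with t ht
  rw [ht, abs_mul]
  gcongr
  linarith

lemma eta_eq {p : ℝ → ℝ} (hpq : p =ᵐ[volume] rightPart q) {x : ℝ} (hx : 0 ≤ x) :
    eta p x = ∫ t in Ioi x, |q t| := by
  refine integral_congr_ae ?_
  filter_upwards [ae_restrict_of_ae hpq, ae_restrict_mem measurableSet_Ioi] with t ht htx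
  rw [ht, rightPart_of_pos (hx.trans_lt htx)]

/-- The representation of `R₊` with `Q = -∫_0^x remainder`. -/
lemma exists_rightReflection_representation (hq : ShortRange q) :
    ∃ Q : ℝ → ℝ, (∀ b : ℝ, 0 < b → AbsolutelyContinuousOnInterval Q 0 b) ∧
      IntegrableOn (deriv Q) (Ioi 0) ∧
      (∀ᵐ x ∂(volume.restrict (Ioi (0 : ℝ))),
        |deriv Q x| ≤ 2 * normL1 (rightPart q) * |q x| +
          2 * normL1 (rightPart q) ^ 2 * Real.exp (normL11 (rightPart q)) *
            ∫ t in Ioi x, |q t|) ∧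
      ∀ k : ℝ, k ≠ 0 → rightReflection (rightPart q) k = transmission (rightPart q) k *
        (1 / (2 * Complex.I * k) *
            (∫ x in Ioi (0 : ℝ), Complex.exp (-(2 * Complex.I * k * x)) * ((q x : ℝ) : ℂ))
          + 1 / (2 * Complex.I * k) ^ 2 *
            (∫ x in Ioi (0 : ℝ),
              Complex.exp (-(2 * Complex.I * k * x)) * ((deriv Q x : ℝ) : ℂ))) := by
  obtain ⟨p, hp, hpq⟩ := exists_halfLinePotential hq
  have hg : Integrable fun x ↦ -remainder p x := (integrable_remainder hp).neg
  have hQ : IsPrimitive (fun x ↦ -remainder p x) (fun x ↦ ∫ y in (0 : ℝ)..x, -remainder p y) :=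
    ⟨fun _ _ ↦ hg.intervalIntegrable, fun _ _ ↦ intervalIntegral.integral_interval_sub_left
      hg.intervalIntegrable hg.intervalIntegrable⟩
  have hd : deriv (fun x ↦ ∫ y in (0 : ℝ)..x, -remainder p y) =ᵐ[volume]
      fun x ↦ -remainder p x := by
    filter_upwards [LocallyIntegrable.ae_hasDerivAt_integral hg.locallyIntegrable] with x hx
    exact (hx 0).deriv
  refine ⟨_, fun b _ ↦ hQ.absolutelyContinuous 0 b, (hg.congr hd.symm).integrableOn, ?_,
    fun k hk0 ↦ ?_⟩
  · filter_upwards [ae_restrict_of_ae hd, ae_restrict_of_ae hpq,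
      ae_restrict_mem measurableSet_Ioi] with x hx hx' hx0
    have h1 := abs_remainder_le hp x
    have h2 := integral_moment_le_normL11 hq hp hpq
    have h3 : 0 ≤ normL1 (rightPart q) := integral_nonneg fun _ ↦ abs_nonneg _
    have h4 : 0 ≤ ∫ t in Ioi x, |q t| := integral_nonneg fun _ ↦ abs_nonneg _
    rw [kerKBound, integral_abs_eq_normL1 hpq, eta_eq hpq (le_of_lt hx0), hx',
      rightPart_of_pos hx0] at h1
    rw [hx, abs_neg]
    refine h1.trans (add_le_add_right (mul_le_mul_of_nonneg_right ?_ h4) _)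
    calc normL1 (rightPart q) * (2 * normL1 (rightPart q) * Real.exp (∫ t, |t * p t|)) =
          2 * normL1 (rightPart q) ^ 2 * Real.exp (∫ t, |t * p t|) := by ring
      _ ≤ _ := by gcongr
  · rw [rightReflection_rightPart_expansion hq.integrable hp hpq hk0]
    have h1 : ∫ x in Ioi (0 : ℝ), Complex.exp (-(2 * Complex.I * k * x)) *
        ((deriv (fun x ↦ ∫ y in (0 : ℝ)..x, -remainder p y) x : ℝ) : ℂ) =
        -∫ x in Ioi (0 : ℝ), Complex.exp (-(2 * Complex.I * k * x)) * (remainder p x : ℂ) := by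
      rw [← integral_neg]
      refine integral_congr_ae ?_
      filter_upwards [ae_restrict_of_ae hd] with x hx
      rw [hx]
      push_cast
      ring
    rw [h1]
    ring

end rightPart

end Scattering

theorem mainTheorem3 :
    ∃ C₁ C₂ : ℝ → ℝ → ℝ, ∀ q : ℝ → ℝ, ShortRange q →
      -- the splitting, and the properties of `G`
      (∃ G : ℂ → ℂ,
        (∀ k : ℝ, k ≠ 0 →
          rightReflection q k = G k + rightReflection (rightPart q) k) ∧
        (∀ k : ℝ, k ≠ 0 →
          1 - leftReflection (rightPart q) k * rightReflection (leftPart q) k ≠ 0 ∧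
          G k = transmission (rightPart q) k ^ 2 * rightReflection (leftPart q) k
            / (1 - leftReflection (rightPart q) k * rightReflection (leftPart q) k)) ∧
        (∃ M : ℝ, ∀ k : ℝ, ‖G k‖ ≤ M) ∧
        -- `G` on the real line is the boundary value of `G` in the upper half plane
        (∀ k : ℝ, k ≠ 0 → ContinuousWithinAt G {z : ℂ | 0 ≤ z.im} (k : ℂ)) ∧
        MeromorphicOn G {z : ℂ | 0 < z.im} ∧
        (∀ z : ℂ, 0 < z.im →
          (∀ κ : ℝ, IsBoundState q κ ∨ IsBoundState (rightPart q) κ → z ≠ Complex.I * κ) →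
          AnalyticAt ℂ G z) ∧
        (∀ κ : ℝ, IsBoundState q κ → ¬ IsBoundState (rightPart q) κ →
          HasSimplePole G (Complex.I * κ) (Complex.I * (normingConstant q κ : ℂ) ^ 2)) ∧
        (∀ κ : ℝ, IsBoundState (rightPart q) κ → ¬ IsBoundState q κ →
          HasSimplePole G (Complex.I * κ)
            (-(Complex.I * (normingConstant (rightPart q) κ : ℂ) ^ 2))) ∧
        (∀ κ : ℝ, IsBoundState q κ → IsBoundState (rightPart q) κ →
          HasResidueSimple G (Complex.I * κ)
            (Complex.I * ((normingConstant q κ : ℂ) ^ 2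
              - (normingConstant (rightPart q) κ : ℂ) ^ 2)))) ∧
      -- the representation of the right reflection coefficient of `q` restricted to `(0, ∞)`
      (∃ Q : ℝ → ℝ,
        (∀ b : ℝ, 0 < b → AbsolutelyContinuousOnInterval Q 0 b) ∧
        MeasureTheory.IntegrableOn (deriv Q) (Set.Ioi 0) ∧
        (∀ᵐ x ∂(MeasureTheory.volume.restrict (Set.Ioi (0 : ℝ))),
          |deriv Q x| ≤ C₁ (normL1 (rightPart q)) (normL11 (rightPart q)) * |q x|
            + C₂ (normL1 (rightPart q)) (normL11 (rightPart q)) * ∫ t in Set.Ioi x, |q t|) ∧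
        (∀ k : ℝ, k ≠ 0 →
          rightReflection (rightPart q) k = transmission (rightPart q) k *
            (1 / (2 * Complex.I * k) *
                (∫ x in Set.Ioi (0 : ℝ), Complex.exp (-(2 * Complex.I * k * x)) * ((q x : ℝ) : ℂ))
              + 1 / (2 * Complex.I * k) ^ 2 *
                (∫ x in Set.Ioi (0 : ℝ),
                  Complex.exp (-(2 * Complex.I * k * x)) * ((deriv Q x : ℝ) : ℂ))))) := by
  refine ⟨fun a _ ↦ 2 * a, fun a b ↦ 2 * a ^ 2 * Real.exp b, fun q hq ↦
    ⟨⟨Scattering.splitG q, ?_⟩, Scattering.exists_rightReflection_representation hq⟩⟩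
  have hi := hq.integrable
  exact ⟨fun k hk0 ↦ Scattering.rightReflection_split hi hk0,
    fun k hk0 ↦ Scattering.splitG_eq hi hk0,
    ⟨2, Scattering.norm_splitG_le hi⟩,
    fun k hk0 ↦ Scattering.continuousWithinAt_splitG hi hk0,
    fun z hz ↦ Scattering.meromorphicAt_splitG hi hz,
    fun z hz h ↦ Scattering.analyticAt_splitG hi hz h,
    fun κ h h' ↦ Scattering.splitG_residue_left hi h h',
    fun κ h h' ↦ Scattering.splitG_residue_right hi h h',
    fun κ h h' ↦ Scattering.splitG_residue_common hi h h'⟩
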